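/- \textbf{Setting.} Let $n\in\mathbb N$, $T>0$, let $\Omega\subset\mathbb R^n$ and $\Lambda\subset\mathbb R$ be open, $f:\Lambda\times\Omega\times[0,T]\to\mathbb R^n$, $g:\Omega\times[0,T]\to\mathbb R^n$, and let $h:(-\infty,T]\to\mathbb R$ be left-continuous, of bounded variation on $[0,T]$, with $h(t)=h(0)$ for $t<0$. Write $\|x\|=\sum_i|x_i|$ on $\mathbb R^n$ and $\|A\|=\max_i\sum_j|a_{ij}|$ for $n\times n$ matrices. Integrals with respect to $h$ or $\mathrm{var}_0^{\cdot}h$ are Kurzweil--Stieltjes integrals, and $f'_x,g'_x$ denote total differentials with respect to $x$. $G[0,T]$ is the Banach space of regulated functions $[0,T]\to\mathbb R^n$ (all one-sided limits exist) with the norm $\|\cdot\|_\infty$, and $B(x_0,\rho)$ is the closed ball in $G[0,T]$. \textbf{Assumptions.} \begin{enumerate} \item $f(\lambda,\cdot,t)$ is continuous on $\Omega$ for all $\lambda\in\Lambda$, $t\in[0,T]$; $f(\lambda,x,\cdot)$ is Lebesgue measurable for all $\lambda\in\Lambda$, $x\in\Omega$; there is a Lebesgue integrable $m:[0,T]\to[0,\infty)$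 with $\|f(\lambda,x,t)\|\le m(t)$ on $\Lambda\times\Omega\times[0,T]$. \item $g(\cdot,t)$ is continuous on $\Omega$ for all $t\in[0,T]$; $\int_0^Tg(x,s)\,dh(s)$ exists for all $x\in\Omega$; there is $m_h:[0,T]\to[0,\infty)$ such that $\int_0^Tm_h(t)\,d[\mathrm{var}_0^th]$ exists (and is finite) and $\|g(x,t)\|\le m_h(t)$ on $\Omega\times[0,T]$. \item $f'_x$ exists on $\Lambda\times\Omega\times[0,T]$ and is continuous in $x\in\Omega$ for all $\lambda\in\Lambda$, $t\in[0,T]$; there is a Lebesgue integrable $\Theta$ on $[0,T]$ with $\|f'_x(\lambda,x,t)\|\le\Theta(t)$ on $\Lambda\times\Omega\times[0,T]$. \item $g'_x$ exists and is bounded on $\Omega\times[0,T]$ and is continuous in $x\in\Omega$ for all $t\in[0,T]$; there is $\Theta_h:[0,T]\to\mathbb R$ such that $\int_0^T\Theta_h(s)\,d[\mathrm{var}_0^sh]$ exists (and is finite) and $\|g'_x(x,t)\|\le\Theta_h(t)$ on $\Omega\times[0,T]$. \item $x_0\in G[0,T]$ is such that, for every $\lambda\in\Lambda$, $(x_0,\lambda)$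 is a solution of $$Dx=f(\lambda,x,t)+g(x,t)\,.\,Dh,\qquad x(0)=x(T),$$ that is: $x_0$ has bounded variation, is left-continuous on $(0,T]$, takes values in $\Omega$, $x_0(0)=x_0(T)$, the integral $\int_0^Tg(x_0(s),s)\,dh(s)$ exists, and $Dx_0=f(\lambda,x_0(\cdot),\cdot)+DH$, where $H(t)=\int_0^tg(x_0(s),s)\,dh(s)$ and $D$ is the distributional derivative, tested with the $C^\infty$ functions $\varphi:\mathbb R\to\mathbb R^n$ that vanish outside $(0,T)$. Moreover, $\rho>0$ is such that $x(t)\in\Omega$ for all $x\in B(x_0,\rho)$ and $t\in[0,T]$. \item There is a nondecreasing $\gamma:[0,T]\to\mathbb R$ such that for every $\varepsilon>0$ there is $\delta>0$ with $$\Big\|\int_s^t[f(\lambda_2,x,r)-f(\lambda_1,x,r)]\,dr\Big\|\le\varepsilon\,|\gamma(t)-\gamma(s)|$$ for all $x\in\Omega$, $s,t\in[0,T]$ and $\lambda_1,\lambda_2\in\Lambda$ with $|\lambda_1-\lambda_2|<\delta$. \item There is a nondecreasing $\widetilde\gamma:[0,T]\to\mathbb R$ such that for every $\varepsilon>0$ there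 is $\delta>0$ with $$\Big\|\int_s^t[f'_x(\lambda_1,x,r)-f'_x(\lambda_2,y,r)]\,dr+\int_s^t[g'_x(x,r)-g'_x(y,r)]\,dh(r)\Big\|\le\varepsilon\,|\widetilde\gamma(t)-\widetilde\gamma(s)|$$ for all $s,t\in[0,T]$, $x,y\in\Omega$, $\lambda_1,\lambda_2\in\Lambda$ with $|\lambda_1-\lambda_2|+\|x-y\|<\delta$. \end{enumerate} For $\lambda\in\Lambda$ and $x\in B(x_0,\rho)$ let $$\widetilde\Phi(\lambda,x)(t)=x(T)+\int_0^tf(\lambda,x(s),s)\,ds+\int_0^tg(x(s),s)\,dh(s),\qquad t\in[0,T].$$ A couple $(y,\mu)\in B(x_0,\rho)\times\Lambda$ is a bifurcation point of the equation $\widetilde\Phi(\lambda,x)=x$ if $\widetilde\Phi(\mu,y)=y$ and every neighbourhood of $(y,\mu)$ in $B(x_0,\rho)\times\Lambda$ contains some $(x,\lambda)$ with $\widetilde\Phi(\lambda,x)=x$ and $x\ne y$. \textbf{Theorem.} Let $\lambda_0\in\Lambda$ be such that $\mathrm{Id}-\widetilde\Phi'_x(\lambda_0,x_0)$ is an isomorphism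 of $G[0,T]$ onto $G[0,T]$, where $\widetilde\Phi'_x(\lambda_0,x_0)$ is the Fr\'echet derivative of $\widetilde\Phi(\lambda_0,\cdot)$ at $x_0$ (which exists under the assumptions above). Then there is $\delta>0$ such that $(x,\lambda)$ is not a bifurcation point of the equation $\widetilde\Phi(\lambda,x)=x$ whenever $\|x-x_0\|_\infty+|\lambda-\lambda_0|<\delta$. -/

import Mathlib

open MeasureTheory Set Filter Topology
open scoped ENNReal ContDiff

namespace MDEBif

noncomputable section

/-- The space of column vectors with the norm `‖x‖ = ∑ i, |x i|`. -/
abbrev Vec (n : ℕ) : Type := PiLp 1 (fun _ : Fin n => ℝ)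

/-- The scalar product of two vectors. -/
def dot {n : ℕ} (x y : Vec n) : ℝ := ∑ i, x i * y i

/-- The maximal absolute row sum of the matrix that represents `A` in the standard basis. -/
def matNorm {n : ℕ} (A : Vec n →L[ℝ] Vec n) : ℝ :=
  ⨆ i : Fin n, ∑ j : Fin n, |(A (PiLp.single 1 j (1 : ℝ))) i|

/-! ## The Kurzweil-Stieltjes integral -/

/-- Tagged partitions `a = t₀ ≤ t₁ ≤ ⋯ ≤ t_ν = b` with tags `τ_j ∈ [t_j, t_{j+1}]`, `j < ν`. -/
structure TaggedPart (a b : ℝ) where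
  size : ℕ
  pt : ℕ → ℝ
  tag : ℕ → ℝ
  pt_zero : pt 0 = a
  pt_size : pt size = b
  tag_mem : ∀ j < size, pt j ≤ tag j ∧ tag j ≤ pt (j + 1)

/-- `P` is fine with respect to the gauge `δ`. -/
def TaggedPart.IsFine {a b : ℝ} (P : TaggedPart a b) (δ : ℝ → ℝ) : Prop :=
  ∀ j < P.size, Icc (P.pt j) (P.pt (j + 1)) ⊆
    Ioo (P.tag j - δ (P.tag j)) (P.tag j + δ (P.tag j))

/-- The integral sum `∑ j, (h(t_{j+1}) - h(t_j)) g(τ_j)`. -/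
def TaggedPart.sum {a b : ℝ} {X : Type*} [NormedAddCommGroup X] [NormedSpace ℝ X]
    (P : TaggedPart a b) (g : ℝ → X) (h : ℝ → ℝ) : X :=
  ∑ j ∈ Finset.range P.size, (h (P.pt (j + 1)) - h (P.pt j)) • g (P.tag j)

/-- `I` is the Kurzweil-Stieltjes integral of `g` with respect to `h` over `[a, b]`, `a ≤ b`. -/
def HasKSIntegral {X : Type*} [NormedAddCommGroup X] [NormedSpace ℝ X]
    (g : ℝ → X) (h : ℝ → ℝ) (a b : ℝ) (I : X) : Prop :=
  ∀ ε > 0, ∃ δ : ℝ → ℝ, (∀ s, 0 < δ s) ∧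
    ∀ P : TaggedPart a b, P.IsFine δ → ‖P.sum g h - I‖ < ε

/-- Existence of the Kurzweil-Stieltjes integral over `[a, b]`, `a ≤ b`. -/
def KSIntegrable {X : Type*} [NormedAddCommGroup X] [NormedSpace ℝ X]
    (g : ℝ → X) (h : ℝ → ℝ) (a b : ℝ) : Prop :=
  ∃ I : X, HasKSIntegral g h a b I

open Classical in
/-- The value of the Kurzweil-Stieltjes integral; for `b < a` it is minus the integral over
`[b, a]`. If the integral does not exist, the value is `0` by convention. -/
def ksIntegral {X : Type*} [NormedAddCommGroup X] [NormedSpace ℝ X]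
    (g : ℝ → X) (h : ℝ → ℝ) (a b : ℝ) : X :=
  if a ≤ b then (if H : KSIntegrable g h a b then H.choose else 0)
  else -(if H : KSIntegrable g h b a then H.choose else 0)

/-- The variation function `t ↦ var_0^t h` of `h` on `[0, T]`. -/
def varFun (T : ℝ) (h : ℝ → ℝ) (t : ℝ) : ℝ := variationOnFromTo h (Icc 0 T) 0 t

/-! ## The Banach space of regulated functions -/

/-- One-sided limits exist at every point of `[0, T]` from each side that is available: the
filter `𝓝[<] t` of the subtype is trivial at the left end and `𝓝[>] t` at the right end. -/
def IsRegulated {n : ℕ} {T : ℝ} (x : Icc (0 : ℝ) T → Vec n) : Prop :=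
  ∀ t, (∃ l, Tendsto x (𝓝[<] t) (𝓝 l)) ∧ (∃ l, Tendsto x (𝓝[>] t) (𝓝 l))

theorem IsRegulated.bounded {n : ℕ} {T : ℝ} {x : Icc (0 : ℝ) T → Vec n} (hx : IsRegulated x) :
    ∃ C, ∀ t, ‖x t‖ ≤ C := by
  have key : ∃ C, ∀ t ∈ (univ : Set (Icc (0 : ℝ) T)), ‖x t‖ ≤ C := by
    refine isCompact_univ.induction_on (p := fun s => ∃ C, ∀ t ∈ s, ‖x t‖ ≤ C) ?_ ?_ ?_ ?_
    · exact ⟨0, by simp⟩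
    · rintro s t hst ⟨C, hC⟩
      exact ⟨C, fun u hu => hC u (hst hu)⟩
    · rintro s t ⟨C, hC⟩ ⟨D, hD⟩
      refine ⟨max C D, ?_⟩
      rintro u (hu | hu)
      · exact (hC u hu).trans (le_max_left _ _)
      · exact (hD u hu).trans (le_max_right _ _)
    · intro t _
      obtain ⟨⟨l, hl⟩, ⟨r, hr⟩⟩ := hx t
      have h1 : ∀ᶠ u in 𝓝[<] t, ‖x u‖ < ‖l‖ + 1 :=
        hl.norm.eventually (gt_mem_nhds (lt_add_one _))
      have h2 : ∀ᶠ u in 𝓝[>] t, ‖x u‖ < ‖r‖ + 1 :=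
        hr.norm.eventually (gt_mem_nhds (lt_add_one _))
      rw [eventually_nhdsWithin_iff] at h1 h2
      refine ⟨{u | ‖x u‖ ≤ max (max (‖l‖ + 1) (‖r‖ + 1)) ‖x t‖}, ?_, _, fun u hu => hu⟩
      rw [nhdsWithin_univ]
      filter_upwards [h1, h2] with u hu1 hu2
      rcases lt_trichotomy u t with h | h | h
      · exact (hu1 h).le.trans ((le_max_left _ _).trans (le_max_left _ _))
      · subst h
        exact le_max_right _ _
      · exact (hu2 h).le.trans ((le_max_right _ _).trans (le_max_left _ _))
  obtain ⟨C, hC⟩ := key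
  exact ⟨C, fun t => hC t (mem_univ t)⟩

theorem IsRegulated.memLp {n : ℕ} {T : ℝ} {x : Icc (0 : ℝ) T → Vec n} (hx : IsRegulated x) :
    Memℓp x ∞ := by
  obtain ⟨C, hC⟩ := hx.bounded
  refine memℓp_infty ⟨C, ?_⟩
  rintro _ ⟨t, rfl⟩
  exact hC t

/-- Regulated functions form a linear subspace of the bounded functions with the sup norm. -/
def regSubmodule (n : ℕ) (T : ℝ) :
    Submodule ℝ (lp (fun _ : Icc (0 : ℝ) T => Vec n) ∞) where
  carrier := {x | IsRegulated (x : Icc (0 : ℝ) T → Vec n)}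
  add_mem' := by
    intro x y hx hy t
    obtain ⟨⟨l, hl⟩, ⟨r, hr⟩⟩ := hx t
    obtain ⟨⟨l', hl'⟩, ⟨r', hr'⟩⟩ := hy t
    exact ⟨⟨_, hl.add hl'⟩, ⟨_, hr.add hr'⟩⟩
  zero_mem' := fun _ => ⟨⟨0, tendsto_const_nhds⟩, ⟨0, tendsto_const_nhds⟩⟩
  smul_mem' := by
    intro c x hx t
    obtain ⟨⟨l, hl⟩, ⟨r, hr⟩⟩ := hx t
    exact ⟨⟨_, hl.const_smul c⟩, ⟨_, hr.const_smul c⟩⟩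

/-- The space `G[0, T]` of regulated functions `[0, T] → ℝⁿ` with the sup norm. -/
abbrev Reg (n : ℕ) (T : ℝ) : Type := ↥(regSubmodule n T)

/-- A regulated function as an element of `G[0, T]`. -/
def Reg.mk {n : ℕ} {T : ℝ} (x : Icc (0 : ℝ) T → Vec n) (hx : IsRegulated x) : Reg n T :=
  ⟨⟨x, hx.memLp⟩, hx⟩

open Classical in
/-- The value `x(s)` for `s ∈ [0, T]` (and `0` elsewhere, a value that is never used). -/
def Reg.val {n : ℕ} {T : ℝ} (x : Reg n T) (s : ℝ) : Vec n :=
  if hs : s ∈ Icc (0 : ℝ) T then (x : lp (fun _ : Icc (0 : ℝ) T => Vec n) ∞) ⟨s, hs⟩ else 0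

/-! ## The measure differential equation -/

/-- Test functions: smooth vector functions on the line that vanish outside `(0, T)`. -/
def IsTest {n : ℕ} (T : ℝ) (φ : ℝ → Vec n) : Prop :=
  ContDiff ℝ ∞ φ ∧ ∀ t, t ∉ Ioo 0 T → φ t = 0

/-- The regular distribution `⟨u, φ⟩ = ∫_0^T u(t) φ(t) dt`. -/
def pairing {n : ℕ} (T : ℝ) (u φ : ℝ → Vec n) : ℝ := ∫ t in (0 : ℝ)..T, dot (u t) (φ t)

/-- The distributional derivative `⟨Du, φ⟩ = -⟨u, φ'⟩`. -/
def pairingD {n : ℕ} (T : ℝ) (u φ : ℝ → Vec n) : ℝ := -pairing T u (deriv φ)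

/-- `x` is a solution of `Dx = f(lam, x, t) + g(x, t) . Dh`, `x(0) = x(T)`, in the sense of
distributions. The product `g(x, t) . Dh` has a sense if the Kurzweil-Stieltjes integral over
`[0, T]` exists, and it is then the distributional derivative of the indefinite integral. -/
structure IsPeriodicSolution {n : ℕ} (T : ℝ) (Ω : Set (Vec n)) (f : ℝ → Vec n → ℝ → Vec n)
    (g : Vec n → ℝ → Vec n) (h : ℝ → ℝ) (x : Reg n T) (lam : ℝ) : Prop where
  bv : BoundedVariationOn x.val (Icc 0 T)
  left_cont : ∀ t ∈ Ioc 0 T, ContinuousWithinAt x.val (Iic t) t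
  mem : ∀ t ∈ Icc 0 T, x.val t ∈ Ω
  product : KSIntegrable (fun s => g (x.val s) s) h 0 T
  eqn : ∀ φ : ℝ → Vec n, IsTest T φ →
    pairingD T x.val φ = pairing T (fun t => f lam (x.val t) t) φ
      + pairingD T (fun t => ksIntegral (fun s => g (x.val s) s) h 0 t) φ
  periodic : x.val 0 = x.val T

/-- The function
`t ↦ x(T) + ∫_0^t f(lam, x(s), s) ds + ∫_0^t g(x(s), s) dh(s)` on `[0, T]`. -/
def phiFun {n : ℕ} {T : ℝ} (f : ℝ → Vec n → ℝ → Vec n) (g : Vec n → ℝ → Vec n) (h : ℝ → ℝ)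
    (lam : ℝ) (x : Reg n T) (t : Icc (0 : ℝ) T) : Vec n :=
  x.val T + (∫ s in (0 : ℝ)..t, f lam (x.val s) s) + ksIntegral (fun s => g (x.val s) s) h 0 t

open Classical in
/-- The operator `Φ̃(lam, ·)`, as a map from `G[0, T]` to `G[0, T]`. The convention `0` concerns
only functions `x` outside the domain of the operator. -/
def phi {n : ℕ} {T : ℝ} (f : ℝ → Vec n → ℝ → Vec n) (g : Vec n → ℝ → Vec n) (h : ℝ → ℝ)
    (lam : ℝ) (x : Reg n T) : Reg n T :=
  if H : IsRegulated (phiFun f g h lam x) then Reg.mk _ H else 0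

/-- `(y, mu)` is a solution in `K × Λ` of `Φ̃(lam, x) = x`, each neighbourhood of which in `K × Λ`
contains a solution `(x, lam)` with `x ≠ y`. -/
def IsBifurcationPoint {n : ℕ} {T : ℝ} (f : ℝ → Vec n → ℝ → Vec n) (g : Vec n → ℝ → Vec n)
    (h : ℝ → ℝ) (K : Set (Reg n T)) (Λ : Set ℝ) (y : Reg n T) (mu : ℝ) : Prop :=
  (y ∈ K ∧ mu ∈ Λ ∧ phi f g h mu y = y) ∧
    ∀ U ∈ 𝓝[K ×ˢ Λ] (y, mu), ∃ x lam, (x, lam) ∈ U ∧ x ∈ K ∧ lam ∈ Λ ∧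
      phi f g h lam x = x ∧ x ≠ y

/-! ## The hypotheses -/

/-- `h : (-∞, T] → ℝ` is left-continuous, has bounded variation on `[0, T]` and is constant on
the negative half-line. -/
structure IntegratorCond (T : ℝ) (h : ℝ → ℝ) : Prop where
  left_cont : ∀ t ≤ T, ContinuousWithinAt h (Iic t) t
  bv : BoundedVariationOn h (Icc 0 T)
  const : ∀ t < 0, h t = h 0

/-- Carathéodory conditions on `f`. -/
structure CaraCond {n : ℕ} (T : ℝ) (Ω : Set (Vec n)) (Λ : Set ℝ)
    (f : ℝ → Vec n → ℝ → Vec n) : Prop where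
  cont : ∀ lam ∈ Λ, ∀ t ∈ Icc 0 T, ContinuousOn (fun x => f lam x t) Ω
  meas : ∀ lam ∈ Λ, ∀ x ∈ Ω, AEStronglyMeasurable (f lam x) (volume.restrict (Icc 0 T))
  bound : ∃ m : ℝ → ℝ, (∀ t ∈ Icc 0 T, 0 ≤ m t) ∧ IntegrableOn m (Icc 0 T) ∧
    ∀ lam ∈ Λ, ∀ x ∈ Ω, ∀ t ∈ Icc 0 T, ‖f lam x t‖ ≤ m t

/-- Conditions on `g`, including that `∫_0^T g(x, s) dh(s)` has a sense for `x ∈ Ω`. -/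
structure StieltjesCond {n : ℕ} (T : ℝ) (Ω : Set (Vec n)) (g : Vec n → ℝ → Vec n)
    (h : ℝ → ℝ) : Prop where
  cont : ∀ t ∈ Icc 0 T, ContinuousOn (fun x => g x t) Ω
  integrable : ∀ x ∈ Ω, KSIntegrable (g x) h 0 T
  bound : ∃ m : ℝ → ℝ, (∀ t ∈ Icc 0 T, 0 ≤ m t) ∧ KSIntegrable m (varFun T h) 0 T ∧
    ∀ x ∈ Ω, ∀ t ∈ Icc 0 T, ‖g x t‖ ≤ m t

/-- The total differential `f'_x(lam, x, t)`. -/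
def dfx {n : ℕ} (f : ℝ → Vec n → ℝ → Vec n) (lam : ℝ) (x : Vec n) (t : ℝ) :
    Vec n →L[ℝ] Vec n := fderiv ℝ (fun y => f lam y t) x

/-- The total differential `g'_x(x, t)`. -/
def dgx {n : ℕ} (g : Vec n → ℝ → Vec n) (x : Vec n) (t : ℝ) :
    Vec n →L[ℝ] Vec n := fderiv ℝ (fun y => g y t) x

/-- `f` has a total differential in `x`, continuous in `x`, with an integrable bound. -/
structure DiffCondF {n : ℕ} (T : ℝ) (Ω : Set (Vec n)) (Λ : Set ℝ)
    (f : ℝ → Vec n → ℝ → Vec n) : Prop where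
  diff : ∀ lam ∈ Λ, ∀ x ∈ Ω, ∀ t ∈ Icc 0 T, DifferentiableAt ℝ (fun y => f lam y t) x
  cont : ∀ lam ∈ Λ, ∀ t ∈ Icc 0 T, ContinuousOn (fun x => dfx f lam x t) Ω
  bound : ∃ θ : ℝ → ℝ, IntegrableOn θ (Icc 0 T) ∧
    ∀ lam ∈ Λ, ∀ x ∈ Ω, ∀ t ∈ Icc 0 T, matNorm (dfx f lam x t) ≤ θ t

/-- `g` has a bounded total differential in `x`, continuous in `x`, with a bound that is
integrable with respect to the variation of `h`. -/
structure DiffCondG {n : ℕ} (T : ℝ) (Ω : Set (Vec n)) (g : Vec n → ℝ → Vec n)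
    (h : ℝ → ℝ) : Prop where
  diff : ∀ x ∈ Ω, ∀ t ∈ Icc 0 T, DifferentiableAt ℝ (fun y => g y t) x
  bdd : ∃ C : ℝ, ∀ x ∈ Ω, ∀ t ∈ Icc 0 T, matNorm (dgx g x t) ≤ C
  cont : ∀ t ∈ Icc 0 T, ContinuousOn (fun x => dgx g x t) Ω
  bound : ∃ θ : ℝ → ℝ, KSIntegrable θ (varFun T h) 0 T ∧
    ∀ x ∈ Ω, ∀ t ∈ Icc 0 T, matNorm (dgx g x t) ≤ θ t

/-- Uniform continuity in the parameter of the integrals of `f`. -/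
def ParamCond {n : ℕ} (T : ℝ) (Ω : Set (Vec n)) (Λ : Set ℝ)
    (f : ℝ → Vec n → ℝ → Vec n) : Prop :=
  ∃ γ : ℝ → ℝ, MonotoneOn γ (Icc 0 T) ∧ ∀ ε > 0, ∃ δ > 0,
    ∀ x ∈ Ω, ∀ t ∈ Icc 0 T, ∀ s ∈ Icc 0 T, ∀ lam₁ ∈ Λ, ∀ lam₂ ∈ Λ, |lam₁ - lam₂| < δ →
      ‖∫ r in s..t, (f lam₂ x r - f lam₁ x r)‖ ≤ ε * |γ t - γ s|

/-- Uniform continuity in the parameter and in `x` of the integrals of the differentials. -/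
def ParamDiffCond {n : ℕ} (T : ℝ) (Ω : Set (Vec n)) (Λ : Set ℝ)
    (f : ℝ → Vec n → ℝ → Vec n) (g : Vec n → ℝ → Vec n) (h : ℝ → ℝ) : Prop :=
  ∃ γ : ℝ → ℝ, MonotoneOn γ (Icc 0 T) ∧ ∀ ε > 0, ∃ δ > 0,
    ∀ t ∈ Icc 0 T, ∀ s ∈ Icc 0 T, ∀ x ∈ Ω, ∀ y ∈ Ω, ∀ lam₁ ∈ Λ, ∀ lam₂ ∈ Λ,
      |lam₁ - lam₂| + ‖x - y‖ < δ →
      matNorm ((∫ r in s..t, (dfx f lam₁ x r - dfx f lam₂ y r))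
        + ksIntegral (fun r => dgx g x r - dgx g y r) h s t) ≤ ε * |γ t - γ s|

end

end MDEBif

namespace MDEBif

/-! Write `p` for the value of `phi` at `(λ₀, x₀)` and `L` for the derivative of `phi f g h λ₀` at
`x₀`.

Since `x₀` solves the equation for every parameter, subtracting two of the distributional equations
shows that `f(λ, x₀(·), ·)` and `f(λ₀, x₀(·), ·)` agree almost everywhere. Hence `phi(λ, x₀) = p`
for all `λ` in `Λ`. It is not claimed that `p = x₀`: the test functions do not see a jump of `x₀` at
`0`, so a distributional solution need not be a fixed point of the operator.

If `phi(λ, x) = x`, then `(Id - L)(x - x₀) - (p - x₀)` is the sum of two terms. One is the remainder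
`phi(λ₀, x) - phi(λ₀, x₀) - L(x - x₀)`, small relative to `‖x - x₀‖` by Fréchet differentiability.
The other is the increment from `x₀` to `x` of `phi(λ, ·) - phi(λ₀, ·)`. The Stieltjes parts cancel
in it, and its Lipschitz constant at `x₀` is small for `λ` near `λ₀`
(`norm_integral_superposition_sub_le`). So the expression is at most `ε ‖x - x₀‖`. As `Id - L` is
invertible, this forces `x = x₀` near `x₀` (`exists_forall_eq_of_approx`), whether or not `p = x₀`.
All solutions near `(x₀, λ₀)` thus have first component `x₀`, which excludes bifurcation.

Differentiability of `phi` (`exists_hasFDerivAt_phi`) is the analytic core. Its Lebesgue part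
follows from dominated convergence. Its Stieltjes part rests on `ksIntegral_bounded_convergence`,
whose bounds are uniform in the upper limit of integration. That theorem is built from Cousin's
lemma, the Saks-Henstock lemma, integrability of `|u|` with respect to the variation of `h`, and
monotone convergence. Superpositions `g(x(s), s)` are integrable because a regulated `x` is almost
constant on short open intervals at each side of a point, where it can be replaced by a fixed
vector. -/

/-! ## Chains of tagged cells -/

/-- A tagged interval `[lo, hi]`. -/
structure Cell where
  tag : ℝ
  lo : ℝ
  hi : ℝ

/-- `Chain a b l`: the cells of `l` are consecutive, lead from `a` to `b`, and each of them is
tagged by one of its end points. -/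
inductive Chain : ℝ → ℝ → List Cell → Prop
  | nil (a : ℝ) : Chain a a []
  | cons {a c b τ : ℝ} {l : List Cell} (hac : a ≤ c) (hτ : τ = a ∨ τ = c) (hl : Chain c b l) :
      Chain a b (⟨τ, a, c⟩ :: l)

/-- Every cell of `l` is shorter than the gauge at its tag. -/
def FineFor (δ : ℝ → ℝ) (l : List Cell) : Prop := ∀ x ∈ l, x.hi - x.lo < δ x.tag

theorem FineFor.mono {δ δ' : ℝ → ℝ} {l : List Cell} (h : FineFor δ l) (hδ : ∀ s, δ s ≤ δ' s) :
    FineFor δ' l := fun x hx => (h x hx).trans_le (hδ _)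

theorem fineFor_cons {δ : ℝ → ℝ} {x : Cell} {l : List Cell} :
    FineFor δ (x :: l) ↔ x.hi - x.lo < δ x.tag ∧ FineFor δ l := by
  simp [FineFor]

theorem fineFor_append {δ : ℝ → ℝ} {l l' : List Cell} :
    FineFor δ (l ++ l') ↔ FineFor δ l ∧ FineFor δ l' := by
  simp only [FineFor, List.mem_append]
  exact ⟨fun h => ⟨fun x hx => h x (.inl hx), fun x hx => h x (.inr hx)⟩,
    fun h x hx => hx.elim (h.1 x) (h.2 x)⟩

theorem Chain.le {a b : ℝ} {l : List Cell} (h : Chain a b l) : a ≤ b := by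
  induction h with
  | nil a => exact le_rfl
  | cons hac _ _ ih => exact hac.trans ih

theorem Chain.append {a b c : ℝ} {l l' : List Cell} (h : Chain a b l) (h' : Chain b c l') :
    Chain a c (l ++ l') := by
  induction h with
  | nil a => exact h'
  | cons hac hτ _ ih => exact .cons hac hτ (ih h')

theorem Chain.mem {a b : ℝ} {l : List Cell} (h : Chain a b l) : ∀ x ∈ l,
    a ≤ x.lo ∧ x.lo ≤ x.hi ∧ x.hi ≤ b ∧ (x.tag = x.lo ∨ x.tag = x.hi) := by
  induction h with
  | nil a => simp
  | cons hac hτ hl ih =>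
    intro x hx
    rcases List.mem_cons.1 hx with rfl | hx
    · exact ⟨le_rfl, hac, hl.le, hτ⟩
    · obtain ⟨h1, h2⟩ := ih x hx
      exact ⟨hac.trans h1, h2⟩

theorem Chain.tag_mem {a b : ℝ} {l : List Cell} (h : Chain a b l) {x : Cell} (hx : x ∈ l) :
    x.tag ∈ Icc a b := by
  obtain ⟨h1, h2, h3, h4 | h4⟩ := h.mem x hx <;> rw [h4] <;> constructor <;> linarith

/-- Cousin's lemma. -/
theorem exists_fine_chain {a b : ℝ} (hab : a ≤ b) {δ : ℝ → ℝ} (hδ : ∀ s, 0 < δ s) :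
    ∃ l, Chain a b l ∧ FineFor δ l := by
  set S : Set ℝ := {x | x ≤ b ∧ ∃ l, Chain a x l ∧ FineFor δ l}
  have haS : a ∈ S := ⟨hab, [], .nil a, by simp [FineFor]⟩
  have hbdd : BddAbove S := ⟨b, fun x hx => hx.1⟩
  have snoc : ∀ x y τ, x ∈ S → x ≤ y → y ≤ b → (τ = x ∨ τ = y) → y - x < δ τ → y ∈ S := by
    rintro x y τ ⟨-, l, hl, hf⟩ hxy hyb hτ hd
    refine ⟨hyb, l ++ [⟨τ, x, y⟩], hl.append (.cons hxy hτ (.nil y)), ?_⟩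
    rw [fineFor_append]
    exact ⟨hf, by simpa [FineFor] using hd⟩
  set s := sSup S
  have hsb : s ≤ b := csSup_le ⟨a, haS⟩ fun x hx => hx.1
  -- A last cell tagged by its right end point `s` shows that the supremum is attained; a further
  -- cell tagged by its left end point `s` would pass beyond it unless `s = b`.
  have hsS : s ∈ S := by
    obtain ⟨x, hxS, hx⟩ := exists_lt_of_lt_csSup ⟨a, haS⟩ (sub_lt_self s (hδ s))
    exact snoc x s s hxS (le_csSup hbdd hxS) hsb (.inr rfl) (by linarith)
  have : min b (s + δ s / 2) ∈ S := by
    refine snoc s _ s hsS (le_min hsb (by linarith [hδ s])) (min_le_left _ _) (.inl rfl) ?_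
    linarith [min_le_right b (s + δ s / 2), hδ s]
  have h1 := le_csSup hbdd this
  have hsb' : s = b := by
    rcases min_le_iff.1 h1 with h | h
    · exact le_antisymm hsb h
    · linarith [hδ s]
  exact hsb' ▸ hsS.2

/-- An additive relation on intervals that holds for short intervals at each of their end points
holds for all intervals. -/
theorem cousin_induction {P : ℝ → ℝ → Prop} {a b : ℝ} (hab : a ≤ b)
    (refl : ∀ c ∈ Icc a b, P c c)
    (trans : ∀ c d e, a ≤ c → c ≤ d → d ≤ e → e ≤ b → P c d → P d e → P c e)
    (loc : ∀ t ∈ Icc a b, ∃ η > 0, ∀ c d, a ≤ c → c < d → d ≤ b → (t = c ∨ t = d) →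
      d - c < η → P c d) : P a b := by
  choose! η hη hP using loc
  obtain ⟨l, hl, hf⟩ := exists_fine_chain hab (δ := fun s => if s ∈ Icc a b then η s else 1)
    (fun s => by
      split_ifs with h
      · exact hη s h
      · exact one_pos)
  have key : ∀ c d l, Chain c d l → a ≤ c → d ≤ b →
      FineFor (fun s => if s ∈ Icc a b then η s else 1) l → P c d := by
    clear hl hf l
    intro c d l hl
    induction hl with
    | nil c => exact fun h h' _ => refl c ⟨h, h'⟩
    | @cons c d e τ l hcd hτ hl ih =>
      intro hac heb hf
      have hde := hl.le
      have hmem : τ ∈ Icc a b := by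
        rcases hτ with rfl | rfl <;> constructor <;> linarith
      rw [fineFor_cons] at hf
      refine trans c d e hac hcd hde heb ?_ (ih (hac.trans hcd) heb hf.2)
      rcases hcd.eq_or_lt with rfl | hlt
      · exact refl c ⟨hac, hde.trans heb⟩
      · refine hP τ hmem c d hac hlt (hde.trans heb) hτ ?_
        have := hf.1
        simpa only [if_pos hmem] using this
  exact key a b l hl le_rfl le_rfl hf

/-- The filter of chains from `a` to `b` that become fine. -/
def gaugeFilter (a b : ℝ) : Filter (List Cell) where
  sets := {S | ∃ δ : ℝ → ℝ, (∀ s, 0 < δ s) ∧ ∀ l, Chain a b l → FineFor δ l → l ∈ S}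
  univ_sets := ⟨fun _ => 1, fun _ => one_pos, fun _ _ _ => mem_univ _⟩
  sets_of_superset := by
    rintro S S' ⟨δ, hδ, h⟩ hS
    exact ⟨δ, hδ, fun l hl hf => hS (h l hl hf)⟩
  inter_sets := by
    rintro S S' ⟨δ, hδ, h⟩ ⟨δ', hδ', h'⟩
    exact ⟨fun s => min (δ s) (δ' s), fun s => lt_min (hδ s) (hδ' s), fun l hl hf =>
      ⟨h l hl (hf.mono fun s => min_le_left _ _), h' l hl (hf.mono fun s => min_le_right _ _)⟩⟩

theorem eventually_gauge {a b : ℝ} {p : List Cell → Prop} :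
    (∀ᶠ l in gaugeFilter a b, p l) ↔
      ∃ δ : ℝ → ℝ, (∀ s, 0 < δ s) ∧ ∀ l, Chain a b l → FineFor δ l → p l := Iff.rfl

theorem eventually_chain (a b : ℝ) : ∀ᶠ l in gaugeFilter a b, Chain a b l :=
  eventually_gauge.2 ⟨fun _ => 1, fun _ => one_pos, fun _ h _ => h⟩

theorem eventually_fine (a b : ℝ) {δ : ℝ → ℝ} (hδ : ∀ s, 0 < δ s) :
    ∀ᶠ l in gaugeFilter a b, FineFor δ l :=
  eventually_gauge.2 ⟨δ, hδ, fun _ _ h => h⟩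

theorem gaugeFilter_neBot {a b : ℝ} (hab : a ≤ b) : (gaugeFilter a b).NeBot := by
  refine ⟨fun h => ?_⟩
  have : ∀ᶠ _ in gaugeFilter a b, False := by simp [h]
  obtain ⟨δ, hδ, H⟩ := eventually_gauge.1 this
  obtain ⟨l, hl, hf⟩ := exists_fine_chain hab hδ
  exact H l hl hf

/-- A cell tagged by one of its end points and shorter than the distance from the tag to `e` cannot
contain `e`. A cell tagged by `e` has `e` as an end point. In both cases `e` is not interior to a
cell. -/
theorem chain_split {a e b : ℝ} {l : List Cell} (hl : Chain a b l) (hae : a ≤ e) (heb : e ≤ b)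
    (hf : ∀ x ∈ l, x.tag = e ∨ x.hi - x.lo < |x.tag - e|) :
    ∃ l₁ l₂, l = l₁ ++ l₂ ∧ Chain a e l₁ ∧ Chain e b l₂ := by
  induction hl with
  | nil a =>
    obtain rfl : a = e := le_antisymm hae heb
    exact ⟨[], [], rfl, .nil a, .nil a⟩
  | @cons a c b τ l hac hτ hl ih =>
    rcases hae.eq_or_lt with rfl | hlt
    · exact ⟨[], _, rfl, .nil a, .cons hac hτ hl⟩
    have hce : c ≤ e := by
      by_contra! hec
      have := hf _ List.mem_cons_self
      simp only at this
      rcases hτ with rfl | rfl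
      · rcases this with h | h
        · exact hlt.ne h
        · rw [abs_sub_comm, abs_of_pos (by linarith)] at h
          linarith
      · rcases this with h | h
        · exact hec.ne' h
        · rw [abs_of_pos (by linarith)] at h
          linarith
    obtain ⟨l₁, l₂, rfl, h1, h2⟩ := ih hce heb fun x hx => hf x (List.mem_cons_of_mem _ hx)
    exact ⟨_ :: l₁, l₂, rfl, .cons hac hτ h1, h2⟩

/-- Fine chains have a prescribed point as an end point of their cells. -/
theorem eventually_split {a e b : ℝ} (hae : a ≤ e) (heb : e ≤ b) {p q : List Cell → Prop}
    (hp : ∀ᶠ l in gaugeFilter a e, p l) (hq : ∀ᶠ l in gaugeFilter e b, q l) :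
    ∀ᶠ l in gaugeFilter a b, ∃ l₁ l₂, l = l₁ ++ l₂ ∧ p l₁ ∧ q l₂ := by
  obtain ⟨δ₁, h₁, H₁⟩ := eventually_gauge.1 hp
  obtain ⟨δ₂, h₂, H₂⟩ := eventually_gauge.1 hq
  refine eventually_gauge.2
    ⟨fun s => min (min (δ₁ s) (δ₂ s)) (if s = e then 1 else |s - e|), fun s => ?_, ?_⟩
  · refine lt_min (lt_min (h₁ s) (h₂ s)) ?_
    split_ifs with h
    · exact one_pos
    · exact abs_pos.2 (sub_ne_zero.2 h)
  · intro l hl hf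
    obtain ⟨l₁, l₂, rfl, c₁, c₂⟩ := chain_split hl hae heb (fun x hx => by
      by_cases h : x.tag = e
      · exact .inl h
      · have := (hf x hx).trans_le (min_le_right _ _)
        rw [if_neg h] at this
        exact .inr this)
    rw [fineFor_append] at hf
    exact ⟨l₁, l₂, rfl,
      H₁ _ c₁ (hf.1.mono fun s => (min_le_left _ _).trans (min_le_left _ _)),
      H₂ _ c₂ (hf.2.mono fun s => (min_le_left _ _).trans (min_le_right _ _))⟩

/-! ## Sums over chains -/

/-- The sum of a cell function over a list of cells. -/
def cellSum {X : Type*} [AddCommMonoid X] (F : Cell → X) (l : List Cell) : X := (l.map F).sum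

section cellSum

variable {X : Type*} [AddCommGroup X]

theorem cellSum_nil (F : Cell → X) : cellSum F [] = 0 := rfl

theorem cellSum_cons (F : Cell → X) (x : Cell) (l : List Cell) :
    cellSum F (x :: l) = F x + cellSum F l := by simp [cellSum]

theorem cellSum_append (F : Cell → X) (l l' : List Cell) :
    cellSum F (l ++ l') = cellSum F l + cellSum F l' := by simp [cellSum]

theorem cellSum_add (F G : Cell → X) (l : List Cell) :
    cellSum (fun x => F x + G x) l = cellSum F l + cellSum G l := by
  simp [cellSum, List.sum_map_add]

theorem cellSum_neg (F : Cell → X) (l : List Cell) :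
    cellSum (fun x => -F x) l = -cellSum F l := by
  induction l with
  | nil => simp [cellSum]
  | cons x l ih => rw [cellSum_cons, cellSum_cons, ih]; abel

theorem cellSum_sub (F G : Cell → X) (l : List Cell) :
    cellSum (fun x => F x - G x) l = cellSum F l - cellSum G l := by
  simp only [sub_eq_add_neg]
  rw [cellSum_add, cellSum_neg]

theorem cellSum_congr {F G : Cell → X} {l : List Cell} (h : ∀ x ∈ l, F x = G x) :
    cellSum F l = cellSum G l := by
  unfold cellSum
  rw [List.map_congr_left h]

theorem cellSum_eq_zero {F : Cell → X} {l : List Cell} (h : ∀ x ∈ l, F x = 0) :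
    cellSum F l = 0 := by
  rw [cellSum_congr h]
  simp [cellSum]

theorem cellSum_le {F G : Cell → ℝ} {l : List Cell} (h : ∀ x ∈ l, F x ≤ G x) :
    cellSum F l ≤ cellSum G l := by
  induction l with
  | nil => exact le_rfl
  | cons x l ih =>
    rw [cellSum_cons, cellSum_cons]
    exact add_le_add (h x List.mem_cons_self) (ih fun y hy => h y (List.mem_cons_of_mem _ hy))

theorem norm_cellSum_le {Y : Type*} [NormedAddCommGroup Y] (F : Cell → Y) (l : List Cell) :
    ‖cellSum F l‖ ≤ cellSum (fun x => ‖F x‖) l := by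
  induction l with
  | nil => simp [cellSum]
  | cons x l ih =>
    rw [cellSum_cons, cellSum_cons]
    exact (norm_add_le _ _).trans (by gcongr)

theorem cellSum_mul_left (c : ℝ) (F : Cell → ℝ) (l : List Cell) :
    cellSum (fun x => c * F x) l = c * cellSum F l := by
  simp [cellSum, List.sum_map_mul_left]

theorem cellSum_increment {a b : ℝ} {l : List Cell} (hl : Chain a b l) (U : ℝ → X) :
    cellSum (fun x => U x.hi - U x.lo) l = U b - U a := by
  induction hl with
  | nil a => simp [cellSum]
  | cons hac hτ hl ih => rw [cellSum_cons, ih]; abel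

end cellSum

/-- The cell function of the Riemann-Stieltjes sums. -/
def rsTerm {X : Type*} [AddCommGroup X] [Module ℝ X] (u : ℝ → X) (h : ℝ → ℝ) (x : Cell) : X :=
  (h x.hi - h x.lo) • u x.tag

section Equivalence

variable {X : Type*} [NormedAddCommGroup X] [NormedSpace ℝ X] {u : ℝ → X} {h : ℝ → ℝ}

theorem Chain.exists_taggedPart {a b : ℝ} {l : List Cell} {δ : ℝ → ℝ} (hl : Chain a b l)
    (hf : FineFor δ l) (hδ : ∀ s, 0 < δ s) :
    ∃ P : TaggedPart a b, P.IsFine δ ∧ P.sum u h = cellSum (rsTerm u h) l := by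
  induction hl with
  | nil a =>
    refine ⟨⟨0, fun _ => a, fun _ => a, rfl, rfl, by simp⟩, fun j hj => ?_, ?_⟩
    · exact absurd hj (Nat.not_lt_zero j)
    · simp [TaggedPart.sum, cellSum]
  | @cons a c b τ l hac hτ hl ih =>
    rw [fineFor_cons] at hf
    obtain ⟨P, hP, hs⟩ := ih hf.2
    refine ⟨⟨P.size + 1, fun j => Nat.casesOn j a P.pt, fun j => Nat.casesOn j τ P.tag, rfl,
      P.pt_size, fun j hj => ?_⟩, fun j hj => ?_, ?_⟩
    · cases j with
      | zero =>
        change a ≤ τ ∧ τ ≤ P.pt 0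
        rw [P.pt_zero]
        rcases hτ with rfl | rfl
        · exact ⟨le_rfl, hac⟩
        · exact ⟨hac, le_rfl⟩
      | succ j => exact P.tag_mem j (Nat.lt_of_succ_lt_succ hj)
    · cases j with
      | zero =>
        change Icc a (P.pt 0) ⊆ Ioo (τ - δ τ) (τ + δ τ)
        rw [P.pt_zero]
        intro s hs
        have h1 := hf.1
        have h2 := hδ τ
        simp only at h1
        rcases hτ with rfl | rfl <;> constructor <;> linarith [hs.1, hs.2]
      | succ j => exact hP j (Nat.lt_of_succ_lt_succ hj)
    · simp only [cellSum_cons, ← hs]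
      simp only [TaggedPart.sum]
      rw [Finset.sum_range_succ', add_comm]
      congr 1
      change (h (P.pt 0) - h a) • u τ = _
      rw [P.pt_zero]
      rfl

/-- Cutting a cell at its tag leaves its term unchanged, because the two increments of `h` add up.
Tags at end points therefore lose no generality. -/
theorem TaggedPart.exists_chain {a b : ℝ} {δ : ℝ → ℝ} (P : TaggedPart a b) (hP : P.IsFine δ) :
    ∃ l, Chain a b l ∧ FineFor δ l ∧ cellSum (rsTerm u h) l = P.sum u h := by
  have key : ∀ k ≤ P.size, ∃ l, Chain a (P.pt k) l ∧ FineFor δ l ∧ cellSum (rsTerm u h) l =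
      ∑ j ∈ Finset.range k, (h (P.pt (j + 1)) - h (P.pt j)) • u (P.tag j) := by
    intro k
    induction k with
    | zero =>
      intro _
      rw [P.pt_zero]
      exact ⟨[], .nil a, by simp [FineFor], by simp [cellSum]⟩
    | succ k ih =>
      intro hk
      obtain ⟨l, hl, hf, hs⟩ := ih (Nat.le_of_succ_le hk)
      obtain ⟨h1, h2⟩ := P.tag_mem k hk
      have h3 := hP k hk
      have h4 := (h3 ⟨le_rfl, h1.trans h2⟩).1
      have h5 := (h3 ⟨h1.trans h2, le_rfl⟩).2
      refine ⟨l ++ [⟨P.tag k, P.pt k, P.tag k⟩, ⟨P.tag k, P.tag k, P.pt (k + 1)⟩],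
        hl.append (.cons h1 (.inr rfl) (.cons h2 (.inl rfl) (.nil _))), ?_, ?_⟩
      · rw [fineFor_append, fineFor_cons, fineFor_cons]
        refine ⟨hf, ?_, ?_, by simp [FineFor]⟩ <;> simp only <;> linarith
      · rw [cellSum_append, hs, Finset.sum_range_succ, cellSum_cons, cellSum_cons, cellSum_nil,
          add_zero]
        congr 1
        simp only [rsTerm]
        rw [← add_smul]
        congr 1
        ring
  obtain ⟨l, hl, hf, hs⟩ := key P.size le_rfl
  rw [P.pt_size] at hl
  exact ⟨l, hl, hf, hs⟩

theorem hasKSIntegral_iff {a b : ℝ} {I : X} :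
    HasKSIntegral u h a b I ↔ Tendsto (cellSum (rsTerm u h)) (gaugeFilter a b) (𝓝 I) := by
  rw [Metric.tendsto_nhds]
  constructor
  · intro H ε hε
    obtain ⟨δ, hδ, HP⟩ := H ε hε
    refine eventually_gauge.2 ⟨δ, hδ, fun l hl hf => ?_⟩
    obtain ⟨P, hP, hs⟩ := hl.exists_taggedPart (u := u) (h := h) hf hδ
    rw [← hs, dist_eq_norm]
    exact HP P hP
  · intro H ε hε
    obtain ⟨δ, hδ, Hl⟩ := eventually_gauge.1 (H ε hε)
    refine ⟨δ, hδ, fun P hP => ?_⟩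
    obtain ⟨l, hl, hf, hs⟩ := P.exists_chain (u := u) (h := h) hP
    rw [← hs, ← dist_eq_norm]
    exact Hl l hl hf

theorem HasKSIntegral.unique {a b : ℝ} (hab : a ≤ b) {I J : X} (hI : HasKSIntegral u h a b I)
    (hJ : HasKSIntegral u h a b J) : I = J := by
  have := gaugeFilter_neBot hab
  exact tendsto_nhds_unique (hasKSIntegral_iff.1 hI) (hasKSIntegral_iff.1 hJ)

theorem HasKSIntegral.ksIntegral_eq {a b : ℝ} (hab : a ≤ b) {I : X}
    (hI : HasKSIntegral u h a b I) : ksIntegral u h a b = I := by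
  have H : KSIntegrable u h a b := ⟨I, hI⟩
  rw [ksIntegral, if_pos hab, dif_pos H]
  exact H.choose_spec.unique hab hI

theorem KSIntegrable.hasKSIntegral {a b : ℝ} (hab : a ≤ b) (H : KSIntegrable u h a b) :
    HasKSIntegral u h a b (ksIntegral u h a b) := by
  obtain ⟨I, hI⟩ := H
  rwa [hI.ksIntegral_eq hab]

theorem ksIntegrable_iff_cauchy [CompleteSpace X] {a b : ℝ} (hab : a ≤ b) :
    KSIntegrable u h a b ↔ ∀ ε > 0, ∃ δ : ℝ → ℝ, (∀ s, 0 < δ s) ∧ ∀ l l', Chain a b l →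
      FineFor δ l → Chain a b l' → FineFor δ l' →
        ‖cellSum (rsTerm u h) l - cellSum (rsTerm u h) l'‖ ≤ ε := by
  have := gaugeFilter_neBot hab
  constructor
  · rintro ⟨I, hI⟩ ε hε
    obtain ⟨δ, hδ, H⟩ := eventually_gauge.1
      (Metric.tendsto_nhds.1 (hasKSIntegral_iff.1 hI) (ε / 2) (half_pos hε))
    refine ⟨δ, hδ, fun l l' hl hf hl' hf' => ?_⟩
    rw [← dist_eq_norm]
    linarith [dist_triangle_right (cellSum (rsTerm u h) l) (cellSum (rsTerm u h) l') I, H l hl hf,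
      H l' hl' hf']
  · intro H
    have : Cauchy (map (cellSum (rsTerm u h)) (gaugeFilter a b)) := by
      rw [Metric.cauchy_iff]
      refine ⟨inferInstance, fun ε hε => ?_⟩
      obtain ⟨δ, hδ, Hl⟩ := H (ε / 2) (half_pos hε)
      refine ⟨cellSum (rsTerm u h) '' {l | Chain a b l ∧ FineFor δ l},
        image_mem_map (eventually_gauge.2 ⟨δ, hδ, fun l h1 h2 => ⟨h1, h2⟩⟩), ?_⟩
      rintro _ ⟨l, hl, rfl⟩ _ ⟨l', hl', rfl⟩
      rw [dist_eq_norm]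
      linarith [Hl l l' hl.1 hl.2 hl'.1 hl'.2]
    obtain ⟨I, hI⟩ := cauchy_map_iff_exists_tendsto.1 this
    exact ⟨I, hasKSIntegral_iff.2 hI⟩

end Equivalence

/-! ## Elementary properties of the Kurzweil-Stieltjes integral -/

section Basic

variable {X : Type*} [NormedAddCommGroup X] [NormedSpace ℝ X] {u v : ℝ → X} {h V : ℝ → ℝ}
  {a b e : ℝ} {I J : X}

theorem HasKSIntegral.add (hu : HasKSIntegral u h a b I) (hv : HasKSIntegral v h a b J) :
    HasKSIntegral (fun s => u s + v s) h a b (I + J) := by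
  rw [hasKSIntegral_iff] at *
  refine (hu.add hv).congr fun l => ?_
  rw [← cellSum_add]
  exact cellSum_congr fun x _ => (smul_add _ _ _).symm

theorem HasKSIntegral.map {Y : Type*} [NormedAddCommGroup Y] [NormedSpace ℝ Y]
    (hu : HasKSIntegral u h a b I) (A : X →L[ℝ] Y) :
    HasKSIntegral (fun s => A (u s)) h a b (A I) := by
  rw [hasKSIntegral_iff] at *
  refine ((A.continuous.tendsto I).comp hu).congr fun l => ?_
  simp only [Function.comp_apply, cellSum, map_list_sum, List.map_map]
  congr 1
  refine List.map_congr_left fun x _ => ?_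
  simp [rsTerm]

theorem HasKSIntegral.smul (hu : HasKSIntegral u h a b I) (c : ℝ) :
    HasKSIntegral (fun s => c • u s) h a b (c • I) :=
  hu.map (c • ContinuousLinearMap.id ℝ X)

theorem HasKSIntegral.sub (hu : HasKSIntegral u h a b I) (hv : HasKSIntegral v h a b J) :
    HasKSIntegral (fun s => u s - v s) h a b (I - J) := by
  simpa [sub_eq_add_neg] using hu.add (hv.smul (-1))

theorem HasKSIntegral.congr (hu : HasKSIntegral u h a b I) (huv : ∀ s ∈ Icc a b, u s = v s) :
    HasKSIntegral v h a b I := by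
  rw [hasKSIntegral_iff] at *
  refine hu.congr' ?_
  filter_upwards [eventually_chain a b] with l hl
  exact cellSum_congr fun x hx => by rw [rsTerm, rsTerm, huv _ (hl.tag_mem hx)]

theorem hasKSIntegral_const (k : X) :
    HasKSIntegral (fun _ => k) h a b ((h b - h a) • k) := by
  rw [hasKSIntegral_iff]
  refine tendsto_const_nhds.congr' ?_
  filter_upwards [eventually_chain a b] with l hl
  have := cellSum_increment hl fun s => h s • k
  rw [sub_smul, ← this]
  exact cellSum_congr fun x _ => (sub_smul _ _ _).symm

theorem hasKSIntegral_refl : HasKSIntegral u h a a 0 := by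
  rw [hasKSIntegral_iff]
  refine tendsto_const_nhds.congr' ?_
  filter_upwards [eventually_chain a a] with l hl
  refine (cellSum_eq_zero fun x hx => ?_).symm
  obtain ⟨h1, h2, h3, -⟩ := hl.mem x hx
  have h4 : x.lo = x.hi := le_antisymm h2 (h3.trans h1)
  simp [rsTerm, h4]

theorem HasKSIntegral.append (hae : a ≤ e) (heb : e ≤ b) (hu : HasKSIntegral u h a e I)
    (hv : HasKSIntegral u h e b J) : HasKSIntegral u h a b (I + J) := by
  rw [hasKSIntegral_iff, Metric.tendsto_nhds] at *
  intro ε hε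
  filter_upwards [eventually_split hae heb (hu (ε / 2) (half_pos hε)) (hv (ε / 2) (half_pos hε))]
  rintro _ ⟨l₁, l₂, rfl, h1, h2⟩
  rw [cellSum_append]
  linarith [dist_add_add_le (cellSum (rsTerm u h) l₁) (cellSum (rsTerm u h) l₂) I J]

/-- Two fine chains on the subinterval are completed by the same fine chains outside it. These
cancel in the difference of the sums, so the Cauchy criterion is inherited. -/
theorem KSIntegrable.mono [CompleteSpace X] {c d : ℝ} (H : KSIntegrable u h a b) (hac : a ≤ c)
    (hcd : c ≤ d) (hdb : d ≤ b) : KSIntegrable u h c d := by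
  rw [ksIntegrable_iff_cauchy (hac.trans (hcd.trans hdb))] at H
  rw [ksIntegrable_iff_cauchy hcd]
  intro ε hε
  obtain ⟨δ, hδ, Hl⟩ := H ε hε
  refine ⟨δ, hδ, fun l l' hl hf hl' hf' => ?_⟩
  obtain ⟨l₁, h₁, f₁⟩ := exists_fine_chain hac hδ
  obtain ⟨l₂, h₂, f₂⟩ := exists_fine_chain hdb hδ
  have := Hl (l₁ ++ (l ++ l₂)) (l₁ ++ (l' ++ l₂)) (h₁.append (hl.append h₂))
    (by simp only [fineFor_append]; exact ⟨f₁, hf, f₂⟩) (h₁.append (hl'.append h₂))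
    (by simp only [fineFor_append]; exact ⟨f₁, hf', f₂⟩)
  simpa only [cellSum_append, add_sub_add_left_eq_sub, add_sub_add_right_eq_sub] using this

theorem KSIntegrable.hasKSIntegral_sub [CompleteSpace X] {c d : ℝ} (H : KSIntegrable u h a b)
    (hac : a ≤ c) (hcd : c ≤ d) (hdb : d ≤ b) :
    HasKSIntegral u h c d (ksIntegral u h a d - ksIntegral u h a c) := by
  have h1 := (H.mono le_rfl hac (hcd.trans hdb)).hasKSIntegral hac
  have h2 := (H.mono hac hcd hdb).hasKSIntegral hcd
  rw [(h1.append hac hcd h2).ksIntegral_eq (hac.trans hcd), add_sub_cancel_left]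
  exact h2

theorem ksIntegral_self : ksIntegral u h a a = 0 := hasKSIntegral_refl.ksIntegral_eq le_rfl

/-- The increments of `h` on `[a, b]` are dominated by those of `V`. -/
def DominatedBy (h V : ℝ → ℝ) (a b : ℝ) : Prop :=
  ∀ c d, a ≤ c → c ≤ d → d ≤ b → |h d - h c| ≤ V d - V c

theorem DominatedBy.cell (hV : DominatedBy h V a b) {l : List Cell} (hl : Chain a b l) {x : Cell}
    (hx : x ∈ l) : |h x.hi - h x.lo| ≤ V x.hi - V x.lo := by
  obtain ⟨h1, h2, h3, -⟩ := hl.mem x hx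
  exact hV _ _ h1 h2 h3

theorem DominatedBy.mono {c d : ℝ} (hV : DominatedBy h V a b) (hac : a ≤ c) (hdb : d ≤ b) :
    DominatedBy h V c d := fun s t hs hst ht => hV s t (hac.trans hs) hst (ht.trans hdb)

theorem DominatedBy.increment_nonneg {c d : ℝ} (hV : DominatedBy h V a b) (hac : a ≤ c) (hcd : c ≤ d)
    (hdb : d ≤ b) : 0 ≤ V d - V c := (abs_nonneg _).trans (hV c d hac hcd hdb)

theorem DominatedBy.self (hV : DominatedBy h V a b) : DominatedBy V V a b :=
  fun _ _ hc hcd hd => (abs_of_nonneg (hV.increment_nonneg hc hcd hd)).le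

theorem norm_cellSum_rsTerm_le (hV : DominatedBy h V a b) {m : ℝ → ℝ}
    (hm : ∀ s ∈ Icc a b, ‖u s‖ ≤ m s) {l : List Cell} (hl : Chain a b l) :
    ‖cellSum (rsTerm u h) l‖ ≤ cellSum (rsTerm m V) l := by
  refine (norm_cellSum_le _ _).trans (cellSum_le fun x hx => ?_)
  rw [rsTerm, rsTerm, norm_smul, smul_eq_mul]
  have h1 := hV.cell hl hx
  exact mul_le_mul h1 (hm _ (hl.tag_mem hx)) (norm_nonneg _) ((abs_nonneg _).trans h1)

theorem HasKSIntegral.norm_le (hab : a ≤ b) (hV : DominatedBy h V a b) {m : ℝ → ℝ} {M : ℝ}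
    (hm : ∀ s ∈ Icc a b, ‖u s‖ ≤ m s) (hu : HasKSIntegral u h a b I)
    (hM : HasKSIntegral m V a b M) : ‖I‖ ≤ M := by
  have := gaugeFilter_neBot hab
  rw [hasKSIntegral_iff] at *
  refine le_of_tendsto_of_tendsto hu.norm hM ?_
  filter_upwards [eventually_chain a b] with l hl
  exact norm_cellSum_rsTerm_le hV hm hl

theorem HasKSIntegral.norm_le_const (hab : a ≤ b) (hV : DominatedBy h V a b) {C : ℝ}
    (hC : ∀ s ∈ Icc a b, ‖u s‖ ≤ C) (hu : HasKSIntegral u h a b I) : ‖I‖ ≤ C * (V b - V a) := by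
  have := hu.norm_le hab hV hC (hasKSIntegral_const C)
  rwa [smul_eq_mul, mul_comm] at this

theorem HasKSIntegral.mono_of_le {m m' : ℝ → ℝ} {M M' : ℝ} (hab : a ≤ b)
    (hV : DominatedBy V V a b) (hm : ∀ s ∈ Icc a b, m s ≤ m' s) (hM : HasKSIntegral m V a b M)
    (hM' : HasKSIntegral m' V a b M') : M ≤ M' := by
  have h1 := (hM'.sub hM).norm_le hab hV (m := fun s => m' s - m s)
    (fun s hs => (abs_of_nonneg (sub_nonneg.2 (hm s hs))).le) (hM'.sub hM)
  linarith [norm_nonneg (M' - M)]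

/-- A function that can be approximated by integrable functions up to an error with small integral
is integrable. -/
theorem ksIntegrable_of_approx [CompleteSpace X] (hab : a ≤ b) (hV : DominatedBy h V a b)
    (H : ∀ ε > 0, ∃ (w : ℝ → X) (m : ℝ → ℝ) (M : ℝ), KSIntegrable w h a b ∧
      HasKSIntegral m V a b M ∧ M < ε ∧ ∀ s ∈ Icc a b, ‖u s - w s‖ ≤ m s) :
    KSIntegrable u h a b := by
  rw [ksIntegrable_iff_cauchy hab]
  intro ε hε
  obtain ⟨w, m, M, hw, hm, hM, huw⟩ := H (ε / 3) (by positivity)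
  obtain ⟨δ₁, hδ₁, H₁⟩ := (ksIntegrable_iff_cauchy hab).1 hw (ε / 3) (by positivity)
  obtain ⟨δ₂, hδ₂, H₂⟩ := eventually_gauge.1
    ((hasKSIntegral_iff.1 hm).eventually (gt_mem_nhds hM))
  refine ⟨fun s => min (δ₁ s) (δ₂ s), fun s => lt_min (hδ₁ s) (hδ₂ s),
    fun l l' hl hf hl' hf' => ?_⟩
  have key : ∀ l, Chain a b l → FineFor (fun s => min (δ₁ s) (δ₂ s)) l →
      ‖cellSum (rsTerm u h) l - cellSum (rsTerm w h) l‖ ≤ ε / 3 := by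
    intro l hl hf
    rw [← cellSum_sub, cellSum_congr (F := fun x => rsTerm u h x - rsTerm w h x)
      (G := rsTerm (fun s => u s - w s) h) fun x _ => (smul_sub _ _ _).symm]
    exact (norm_cellSum_rsTerm_le hV huw hl).trans
      (H₂ l hl (hf.mono fun s => min_le_right _ _)).le
  have h1 := key l hl hf
  have h2 := key l' hl' hf'
  have h3 := H₁ l l' hl (hf.mono fun s => min_le_left _ _) hl' (hf'.mono fun s => min_le_left _ _)
  rw [← dist_eq_norm] at *
  rw [dist_comm] at h2
  linarith [dist_triangle4 (cellSum (rsTerm u h) l) (cellSum (rsTerm w h) l)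
    (cellSum (rsTerm w h) l') (cellSum (rsTerm u h) l')]

theorem ksIntegrable_of_uniform_approx [CompleteSpace X] (hab : a ≤ b)
    (hV : DominatedBy h V a b)
    (H : ∀ ε > 0, ∃ w : ℝ → X, KSIntegrable w h a b ∧ ∀ s ∈ Icc a b, ‖u s - w s‖ ≤ ε) :
    KSIntegrable u h a b := by
  refine ksIntegrable_of_approx hab hV fun ε hε => ?_
  have hD := hV.increment_nonneg le_rfl hab le_rfl
  obtain ⟨w, hw, huw⟩ := H (ε / (V b - V a + 1)) (by positivity)
  refine ⟨w, _, _, hw, hasKSIntegral_const (ε / (V b - V a + 1)), ?_, huw⟩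
  rw [smul_eq_mul, mul_div_assoc', div_lt_iff₀ (by linarith)]
  nlinarith

end Basic

/-! ## One-sided limits and functions that vanish except at a point -/

section Limits

/-- A function whose increments are dominated by those of a bounded nondecreasing function is
Cauchy along every filter on which the dominating function converges. -/
theorem exists_tendsto_of_dominated {α E : Type*} [LinearOrder α] [NormedAddCommGroup E]
    [CompleteSpace E] {F : α → E} {M : α → ℝ} (hM : Monotone M)
    (hF : ∀ c d, c ≤ d → ‖F d - F c‖ ≤ M d - M c) {f : Filter α} {L : ℝ}
    (hL : Tendsto M f (𝓝 L)) : ∃ l, Tendsto F f (𝓝 l) := by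
  rcases f.eq_or_neBot with rfl | hf
  · exact ⟨0, tendsto_bot⟩
  refine cauchy_map_iff_exists_tendsto.1 ?_
  have hc : Cauchy (map M f) := cauchy_map_iff_exists_tendsto.2 ⟨L, hL⟩
  rw [Metric.cauchy_iff] at hc ⊢
  refine ⟨inferInstance, fun ε hε => ?_⟩
  obtain ⟨t, ht, H⟩ := hc.2 ε hε
  refine ⟨F '' (M ⁻¹' t), image_mem_map ht, ?_⟩
  rintro _ ⟨x, hx, rfl⟩ _ ⟨y, hy, rfl⟩
  refine lt_of_le_of_lt ?_ (H _ hx _ hy)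
  rw [dist_eq_norm, Real.dist_eq]
  rcases le_total x y with h | h
  · rw [norm_sub_rev, abs_sub_comm, abs_of_nonneg (sub_nonneg.2 (hM h))]
    exact hF x y h
  · rw [abs_of_nonneg (sub_nonneg.2 (hM h))]
    exact hF y x h

variable {h V : ℝ → ℝ} {a b : ℝ}

theorem DominatedBy.exists_right_limit (hab : a < b) (hV : DominatedBy h V a b) :
    ∃ L, ∀ ε > 0, ∃ η > 0, ∀ d, a < d → d ≤ b → d - a < η → |h d - L| < ε := by
  have hmono : Monotone fun s : Icc a b => V s := fun s t hst =>
    sub_nonneg.1 (hV.increment_nonneg s.2.1 hst t.2.2)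
  have hlim := hmono.tendsto_nhdsGT ⟨a, le_rfl, hab.le⟩
  obtain ⟨L, hL⟩ := exists_tendsto_of_dominated (F := fun s : Icc a b => h s) hmono
    (fun c d hcd => hV c d c.2.1 hcd d.2.2) hlim
  refine ⟨L, fun ε hε => ?_⟩
  have h1 := Metric.tendsto_nhds.1 hL ε hε
  rw [eventually_nhdsWithin_iff, Metric.eventually_nhds_iff] at h1
  obtain ⟨η, hη, H⟩ := h1
  refine ⟨η, hη, fun d had hdb hd => ?_⟩
  refine H (y := ⟨d, had.le, hdb⟩) ?_ had
  rw [Subtype.dist_eq, Real.dist_eq, abs_of_pos (by simpa using had)]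
  exact hd

theorem DominatedBy.exists_left_limit (hab : a < b) (hV : DominatedBy h V a b) :
    ∃ L, ∀ ε > 0, ∃ η > 0, ∀ d, a ≤ d → d < b → b - d < η → |h d - L| < ε := by
  have hmono : Monotone fun s : Icc a b => V s := fun s t hst =>
    sub_nonneg.1 (hV.increment_nonneg s.2.1 hst t.2.2)
  have hlim := hmono.tendsto_nhdsLT ⟨b, hab.le, le_rfl⟩
  obtain ⟨L, hL⟩ := exists_tendsto_of_dominated (F := fun s : Icc a b => h s) hmono
    (fun c d hcd => hV c d c.2.1 hcd d.2.2) hlim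
  refine ⟨L, fun ε hε => ?_⟩
  have h1 := Metric.tendsto_nhds.1 hL ε hε
  rw [eventually_nhdsWithin_iff, Metric.eventually_nhds_iff] at h1
  obtain ⟨η, hη, H⟩ := h1
  refine ⟨η, hη, fun d had hdb hd => ?_⟩
  refine H (y := ⟨d, had, hdb.le⟩) ?_ hdb
  rw [Subtype.dist_eq, Real.dist_eq, abs_sub_comm, abs_of_pos (by simpa using hdb)]
  exact hd

variable {X : Type*} [NormedAddCommGroup X] [NormedSpace ℝ X]

/-- The gauge condition forces the first nondegenerate cell to be tagged by `a`. Degenerate cells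
contribute nothing, whatever their tags, and all later tags exceed `a`. -/
theorem cellSum_indicator_left {k : X} {l : List Cell} (hab : a < b) (hl : Chain a b l)
    (hf : ∀ x ∈ l, x.tag = a ∨ x.hi - x.lo < x.tag - a) :
    ∃ x ∈ l, x.tag = a ∧ a = x.lo ∧ a < x.hi ∧ x.hi ≤ b ∧
      cellSum (rsTerm (fun s => if s = a then k else 0) h) l = (h x.hi - h a) • k := by
  induction hl with
  | nil a => exact absurd hab (lt_irrefl _)
  | @cons a c b τ l hac hτ hl ih =>
    rcases hac.eq_or_lt with rfl | hlt
    · obtain ⟨x, hx, h1, h2, h3, h4, h5⟩ := ih hab fun x hx => hf x (List.mem_cons_of_mem _ hx)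
      refine ⟨x, List.mem_cons_of_mem _ hx, h1, h2, h3, h4, ?_⟩
      rw [cellSum_cons, h5]
      simp [rsTerm]
    · have hτa : τ = a := by
        rcases hτ with h1 | rfl
        · exact h1
        · rcases hf _ List.mem_cons_self with h2 | h2
          · exact h2
          · exact absurd h2 (lt_irrefl _)
      refine ⟨_, List.mem_cons_self, hτa, rfl, hlt, hl.le, ?_⟩
      rw [cellSum_cons, cellSum_eq_zero, add_zero]
      · simp [rsTerm, hτa]
      · intro x hx
        have := (hl.tag_mem hx).1
        rw [rsTerm, if_neg (by linarith), smul_zero]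

theorem cellSum_indicator_right {k : X} {l : List Cell} (hab : a < b) (hl : Chain a b l)
    (hf : ∀ x ∈ l, x.tag = b ∨ x.hi - x.lo < b - x.tag) :
    ∃ x ∈ l, x.tag = b ∧ a ≤ x.lo ∧ x.lo < b ∧ x.hi = b ∧
      cellSum (rsTerm (fun s => if s = b then k else 0) h) l = (h b - h x.lo) • k := by
  induction hl with
  | nil a => exact absurd hab (lt_irrefl _)
  | @cons a c b τ l hac hτ hl ih =>
    rcases hl.le.eq_or_lt with rfl | hlt
    · have hτb : τ = c := by
        rcases hτ with rfl | h1
        · rcases hf _ List.mem_cons_self with h2 | h2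
          · exact h2
          · exact absurd h2 (lt_irrefl _)
        · exact h1
      refine ⟨_, List.mem_cons_self, hτb, le_rfl, hab, rfl, ?_⟩
      rw [cellSum_cons, cellSum_eq_zero, add_zero]
      · simp [rsTerm, hτb]
      · intro x hx
        obtain ⟨h1, h2, h3, -⟩ := hl.mem x hx
        have h4 : x.lo = x.hi := le_antisymm h2 (h3.trans h1)
        simp [rsTerm, h4]
    · obtain ⟨x, hx, h1, h2, h3, h4, h5⟩ := ih hlt fun x hx => hf x (List.mem_cons_of_mem _ hx)
      refine ⟨x, List.mem_cons_of_mem _ hx, h1, hac.trans h2, h3, h4, ?_⟩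
      rw [cellSum_cons, h5]
      have : τ ≠ b := by
        rcases hτ with rfl | rfl
        · exact hab.ne
        · exact hlt.ne
      simp [rsTerm, this]

/-- The value is the jump `(h(a+) - h(a)) • k`; the one-sided limit exists because the increments of
`h` are dominated. -/
theorem ksIntegrable_indicator_left (hab : a < b) (hV : DominatedBy h V a b) (k : X) :
    KSIntegrable (fun s => if s = a then k else 0) h a b := by
  obtain ⟨L, hL⟩ := hV.exists_right_limit hab
  refine ⟨(L - h a) • k, hasKSIntegral_iff.2 (Metric.tendsto_nhds.2 fun ε hε => ?_)⟩
  obtain ⟨η, hη, H⟩ := hL (ε / (‖k‖ + 1)) (by positivity)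
  refine eventually_gauge.2 ⟨fun s => if s = a then η else |s - a|, fun s => ?_,
    fun l hl hf => ?_⟩
  · dsimp only
    split_ifs with h
    · exact hη
    · exact abs_pos.2 (sub_ne_zero.2 h)
  · obtain ⟨x, hx, h1, h2, h3, h4, h5⟩ := cellSum_indicator_left (h := h) (k := k) hab hl
      fun x hx => by
        by_cases h : x.tag = a
        · exact .inl h
        · have := hf x hx
          beta_reduce at this
          rw [if_neg h, abs_of_nonneg (sub_nonneg.2 (hl.tag_mem hx).1)] at this
          exact .inr this
    have h6 := hf x hx
    beta_reduce at h6
    rw [if_pos h1, ← h2] at h6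
    have h7 := H x.hi h3 h4 h6
    rw [h5, dist_eq_norm, ← sub_smul, norm_smul, sub_sub_sub_cancel_right, Real.norm_eq_abs]
    rw [lt_div_iff₀ (by positivity)] at h7
    nlinarith [abs_nonneg (h x.hi - L), norm_nonneg k]

theorem ksIntegrable_indicator_right (hab : a < b) (hV : DominatedBy h V a b) (k : X) :
    KSIntegrable (fun s => if s = b then k else 0) h a b := by
  obtain ⟨L, hL⟩ := hV.exists_left_limit hab
  refine ⟨(h b - L) • k, hasKSIntegral_iff.2 (Metric.tendsto_nhds.2 fun ε hε => ?_)⟩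
  obtain ⟨η, hη, H⟩ := hL (ε / (‖k‖ + 1)) (by positivity)
  refine eventually_gauge.2 ⟨fun s => if s = b then η else |s - b|, fun s => ?_,
    fun l hl hf => ?_⟩
  · dsimp only
    split_ifs with h
    · exact hη
    · exact abs_pos.2 (sub_ne_zero.2 h)
  · obtain ⟨x, hx, h1, h2, h3, h4, h5⟩ := cellSum_indicator_right (h := h) (k := k) hab hl
      fun x hx => by
        by_cases h : x.tag = b
        · exact .inl h
        · have := hf x hx
          beta_reduce at this
          rw [if_neg h, abs_sub_comm, abs_of_nonneg (sub_nonneg.2 (hl.tag_mem hx).2)] at this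
          exact .inr this
    have h6 := hf x hx
    beta_reduce at h6
    rw [if_pos h1, h4] at h6
    have h7 := H x.lo h2 h3 h6
    rw [h5, dist_eq_norm, ← sub_smul, norm_smul, sub_sub_sub_cancel_left, Real.norm_eq_abs,
      abs_sub_comm]
    rw [lt_div_iff₀ (by positivity)] at h7
    nlinarith [abs_nonneg (h x.lo - L), norm_nonneg k]

/-- Integrability of functions that are locally close to integrable functions, with no condition
at the points of a finite set. -/
theorem ksIntegrable_of_local_approx [CompleteSpace X] {u : ℝ → X} (hab : a ≤ b)
    (hV : DominatedBy h V a b)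
    (H : ∀ ε > 0, ∀ t ∈ Icc a b, ∃ η > 0, ∀ c d, a ≤ c → c < d → d ≤ b → (t = c ∨ t = d) →
      d - c < η → ∃ w : ℝ → X, KSIntegrable w h c d ∧ ∀ s ∈ Ioo c d, ‖u s - w s‖ ≤ ε) :
    KSIntegrable u h a b := by
  refine ksIntegrable_of_uniform_approx hab hV fun ε hε => ?_
  -- Agreement with `u` at both end points is added to the claim so that approximants on adjacent
  -- intervals can be glued.
  suffices ∃ w : ℝ → X, KSIntegrable w h a b ∧ (∀ s ∈ Icc a b, ‖u s - w s‖ ≤ ε) ∧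
      w a = u a ∧ w b = u b by
    obtain ⟨w, h1, h2, -⟩ := this
    exact ⟨w, h1, h2⟩
  refine cousin_induction (P := fun c d => ∃ w : ℝ → X, KSIntegrable w h c d ∧
      (∀ s ∈ Icc c d, ‖u s - w s‖ ≤ ε) ∧ w c = u c ∧ w d = u d) hab ?_ ?_ ?_
  · exact fun c _ => ⟨u, ⟨0, hasKSIntegral_refl⟩, fun s _ => by simpa using hε.le, rfl, rfl⟩
  · rintro c d e - hcd hde - ⟨w, ⟨I, hI⟩, hw, hwc, hwd⟩ ⟨w', ⟨J, hJ⟩, hw', hwd', hwe'⟩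
    refine ⟨fun s => if s ≤ d then w s else w' s, ⟨I + J, ?_⟩, fun s hs => ?_, ?_, ?_⟩
    · refine HasKSIntegral.append hcd hde (hI.congr fun s hs => by rw [if_pos hs.2])
        (hJ.congr fun s hs => ?_)
      split_ifs with h1
      · obtain rfl := le_antisymm h1 hs.1
        rw [hwd, hwd']
      · rfl
    · dsimp only
      split_ifs with h1
      · exact hw s ⟨hs.1, h1⟩
      · exact hw' s ⟨(not_le.1 h1).le, hs.2⟩
    · beta_reduce
      rw [if_pos hcd, hwc]
    · beta_reduce
      split_ifs with h1
      · obtain rfl := le_antisymm h1 hde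
        exact hwd
      · exact hwe'
  · intro t ht
    obtain ⟨η, hη, Hη⟩ := H ε hε t ht
    refine ⟨η, hη, fun c d hac hcd hdb htcd hd => ?_⟩
    obtain ⟨w, ⟨I, hI⟩, hw⟩ := Hη c d hac hcd hdb htcd hd
    have hV' := hV.mono hac hdb
    -- Nothing is known about `u - w` at the end points `c` and `d`, so the values there are
    -- corrected by functions supported at one point.
    obtain ⟨I₁, h₁⟩ := ksIntegrable_indicator_left hcd hV' (u c - w c)
    obtain ⟨I₂, h₂⟩ := ksIntegrable_indicator_right hcd hV' (u d - w d)
    refine ⟨_, ⟨_, (hI.add h₁).add h₂⟩, fun s hs => ?_, ?_, ?_⟩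
    · rcases hs.1.eq_or_lt with rfl | h1
      · simpa [hcd.ne] using hε.le
      rcases hs.2.eq_or_lt with rfl | h2
      · simpa [hcd.ne'] using hε.le
      · simpa [h1.ne', h2.ne] using hw s ⟨h1, h2⟩
    · simp [hcd.ne]
    · simp [hcd.ne']

end Limits

/-! ## The Saks-Henstock lemma -/

section SaksHenstock

variable {u h V : ℝ → ℝ} {a b : ℝ}

/-- The cells that fail `p` are replaced by fine chains on which the sum of `G` is almost
nonnegative. The partial sum is then at most a full fine sum plus an arbitrarily small error. -/
theorem cellSum_ite_le {G : Cell → ℝ} {δ : ℝ → ℝ} {ε : ℝ}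
    (H : ∀ l, Chain a b l → FineFor δ l → cellSum G l ≤ ε)
    (K : ∀ c d, a ≤ c → c ≤ d → d ≤ b → ∀ η > 0, ∃ l, Chain c d l ∧ FineFor δ l ∧
      -η ≤ cellSum G l)
    {l : List Cell} (hl : Chain a b l) (p : Cell → Prop) [DecidablePred p]
    (hf : ∀ x ∈ l, p x → x.hi - x.lo < δ x.tag) :
    cellSum (fun x => if p x then G x else 0) l ≤ ε := by
  have key : ∀ c d l, Chain c d l → a ≤ c → d ≤ b →
      (∀ x ∈ l, p x → x.hi - x.lo < δ x.tag) → ∀ η > 0, ∃ l', Chain c d l' ∧ FineFor δ l' ∧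
        cellSum (fun x => if p x then G x else 0) l - η ≤ cellSum G l' := by
    clear hl hf l
    intro c d l hl
    induction hl with
    | nil c => exact fun _ _ _ η hη => ⟨[], .nil c, by simp [FineFor], by simp [cellSum, hη.le]⟩
    | @cons c d e τ l hcd hτ hl ih =>
      intro hac heb hf η hη
      obtain ⟨l', h1, h2, h3⟩ := ih (hac.trans hcd) heb
        (fun x hx => hf x (List.mem_cons_of_mem _ hx)) (η / 2) (half_pos hη)
      rw [cellSum_cons]
      by_cases hp : p ⟨τ, c, d⟩
      · refine ⟨⟨τ, c, d⟩ :: l', .cons hcd hτ h1, fineFor_cons.2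
          ⟨hf _ List.mem_cons_self hp, h2⟩, ?_⟩
        rw [cellSum_cons, if_pos hp]
        linarith
      · obtain ⟨l₀, h4, h5, h6⟩ := K c d hac hcd (hl.le.trans heb) (η / 2) (half_pos hη)
        refine ⟨l₀ ++ l', h4.append h1, fineFor_append.2 ⟨h5, h2⟩, ?_⟩
        rw [cellSum_append, if_neg hp]
        linarith
  refine le_of_forall_pos_le_add fun η hη => ?_
  obtain ⟨l', h1, h2, h3⟩ := key a b l hl le_rfl le_rfl hf η hη
  linarith [H l' h1 h2]

/-- The deviation of a term of the integral sum from the integral over the cell. -/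
noncomputable def deviation (u h : ℝ → ℝ) (a : ℝ) (x : Cell) : ℝ :=
  rsTerm u h x - (ksIntegral u h a x.hi - ksIntegral u h a x.lo)

theorem cellSum_deviation {l : List Cell} {c d : ℝ} (hl : Chain c d l) :
    cellSum (deviation u h a) l =
      cellSum (rsTerm u h) l - (ksIntegral u h a d - ksIntegral u h a c) := by
  rw [← cellSum_increment hl, ← cellSum_sub]
  rfl

/-- The Saks-Henstock lemma. -/
theorem saks_henstock (hab : a ≤ b) (hu : KSIntegrable u h a b) {ε : ℝ} (hε : 0 < ε) :
    ∃ δ : ℝ → ℝ, (∀ s, 0 < δ s) ∧ ∀ l, Chain a b l → ∀ (p : Cell → Prop) [DecidablePred p],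
      (∀ x ∈ l, p x → x.hi - x.lo < δ x.tag) →
        cellSum (fun x => if p x then |deviation u h a x| else 0) l ≤ ε := by
  obtain ⟨δ, hδ, H⟩ := eventually_gauge.1 (Metric.tendsto_nhds.1
    (hasKSIntegral_iff.1 (hu.hasKSIntegral_sub le_rfl hab le_rfl)) (ε / 2) (half_pos hε))
  have H' : ∀ l, Chain a b l → FineFor δ l → |cellSum (deviation u h a) l| ≤ ε / 2 := by
    intro l hl hf
    rw [cellSum_deviation hl]
    exact (H l hl hf).le
  have K : ∀ c d, a ≤ c → c ≤ d → d ≤ b → ∀ η > 0, ∃ l, Chain c d l ∧ FineFor δ l ∧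
      |cellSum (deviation u h a) l| ≤ η := by
    intro c d hac hcd hdb η hη
    have := gaugeFilter_neBot hcd
    obtain ⟨l, h1, h2, h3⟩ := ((Metric.tendsto_nhds.1
      (hasKSIntegral_iff.1 (hu.hasKSIntegral_sub hac hcd hdb)) η hη).and
      ((eventually_chain c d).and (eventually_fine c d hδ))).exists
    refine ⟨l, h2, h3, ?_⟩
    rw [cellSum_deviation h2]
    exact h1.le
  refine ⟨δ, hδ, fun l hl p _ hf => ?_⟩
  classical
  -- The cells with nonnegative deviation and those with negative deviation are treated separately;
  -- each group contributes at most `ε / 2`.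
  have h1 := cellSum_ite_le (G := deviation u h a) (ε := ε / 2)
    (fun l hl hf => (abs_le.1 (H' l hl hf)).2)
    (fun c d hac hcd hdb η hη => by
      obtain ⟨l, h1, h2, h3⟩ := K c d hac hcd hdb η hη
      exact ⟨l, h1, h2, (abs_le.1 h3).1⟩) hl
    (fun x => p x ∧ 0 ≤ deviation u h a x) fun x hx hp => hf x hx hp.1
  have h2 := cellSum_ite_le (G := fun x => -deviation u h a x) (ε := ε / 2)
    (fun l hl hf => by
      rw [cellSum_neg]
      linarith [(abs_le.1 (H' l hl hf)).1])
    (fun c d hac hcd hdb η hη => by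
      obtain ⟨l, h1, h2, h3⟩ := K c d hac hcd hdb η hη
      refine ⟨l, h1, h2, ?_⟩
      rw [cellSum_neg]
      linarith [(abs_le.1 h3).2]) hl
    (fun x => p x ∧ ¬ 0 ≤ deviation u h a x) fun x hx hp => hf x hx hp.1
  refine le_trans (le_of_eq ?_) ((add_le_add h1 h2).trans (add_halves ε).le)
  rw [← cellSum_add]
  refine cellSum_congr fun x _ => ?_
  by_cases hp : p x <;> by_cases hd : 0 ≤ deviation u h a x
  · simp [hp, hd, abs_of_nonneg hd]
  · simp [hp, hd, abs_of_neg (not_le.1 hd)]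
  · simp [hp]
  · simp [hp]

theorem tendsto_cellSum_abs_deviation (hab : a ≤ b) (hu : KSIntegrable u h a b) :
    Tendsto (cellSum fun x => |deviation u h a x|) (gaugeFilter a b) (𝓝 0) := by
  rw [Metric.tendsto_nhds]
  intro ε hε
  obtain ⟨δ, hδ, H⟩ := saks_henstock hab hu (half_pos hε)
  refine eventually_gauge.2 ⟨δ, hδ, fun l hl hf => ?_⟩
  have h1 := H l hl (fun _ => True) fun x hx _ => hf x hx
  simp only [if_true] at h1
  have h2 : 0 ≤ cellSum (fun x => |deviation u h a x|) l :=
    (norm_nonneg _).trans (norm_cellSum_le (deviation u h a) l)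
  rw [Real.dist_eq, sub_zero, abs_of_nonneg h2]
  linarith

end SaksHenstock

/-! ## Subadditive interval functions -/

section Subadditive

variable {q : ℝ → ℝ → ℝ} {a b : ℝ}

theorem le_cellSum_of_subadditive (h0 : ∀ c, q c c ≤ 0)
    (hq : ∀ c d e, c ≤ d → d ≤ e → q c e ≤ q c d + q d e) {l : List Cell} (hl : Chain a b l) :
    q a b ≤ cellSum (fun x => q x.lo x.hi) l := by
  induction hl with
  | nil a => exact h0 a
  | cons hac hτ hl ih =>
    rw [cellSum_cons]
    exact (hq _ _ _ hac hl.le).trans (by gcongr)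

/-- Sufficiently fine chains have all end points of `l₀` among their own. They refine `l₀`, and
refinement does not decrease the sum. -/
theorem eventually_cellSum_le_of_subadditive (h0 : ∀ c, q c c ≤ 0)
    (hq : ∀ c d e, c ≤ d → d ≤ e → q c e ≤ q c d + q d e) {l₀ : List Cell}
    (hl₀ : Chain a b l₀) : ∀ᶠ l in gaugeFilter a b,
      cellSum (fun x => q x.lo x.hi) l₀ ≤ cellSum (fun x => q x.lo x.hi) l := by
  induction hl₀ with
  | nil a =>
    filter_upwards [eventually_chain a a] with l hl
    induction l with
    | nil => exact le_rfl
    | cons x l ih =>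
      rcases hl with _ | ⟨hac, hτ, hl⟩
      obtain rfl := le_antisymm hac hl.le
      refine (ih hl).trans ?_
      rw [cellSum_cons]
      have := hq _ _ _ (le_refl a) (le_refl a)
      dsimp only
      linarith
  | cons hac hτ hl ih =>
    filter_upwards [eventually_split hac hl.le (eventually_chain _ _) ih]
    rintro _ ⟨l₁, l₂, rfl, h1, h2⟩
    rw [cellSum_cons, cellSum_append]
    exact add_le_add (le_cellSum_of_subadditive h0 hq h1) h2

theorem tendsto_cellSum_of_subadditive (h0 : ∀ c, q c c ≤ 0)
    (hq : ∀ c d e, c ≤ d → d ≤ e → q c e ≤ q c d + q d e) {B : ℝ}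
    (hB : ∀ l, Chain a b l → cellSum (fun x => q x.lo x.hi) l ≤ B)
    (hB' : ∀ ε > 0, ∃ l, Chain a b l ∧ B - ε < cellSum (fun x => q x.lo x.hi) l) :
    Tendsto (cellSum fun x => q x.lo x.hi) (gaugeFilter a b) (𝓝 B) := by
  rw [Metric.tendsto_nhds]
  intro ε hε
  obtain ⟨l₀, hl₀, h1⟩ := hB' ε hε
  filter_upwards [eventually_cellSum_le_of_subadditive h0 hq hl₀, eventually_chain a b] with l h2 h3
  rw [Real.dist_eq, abs_lt]
  constructor <;> linarith [hB l h3]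

theorem exists_tendsto_cellSum_of_subadditive (hab : a ≤ b) (h0 : ∀ c, q c c ≤ 0)
    (hq : ∀ c d e, c ≤ d → d ≤ e → q c e ≤ q c d + q d e) {B : ℝ}
    (hB : ∀ l, Chain a b l → cellSum (fun x => q x.lo x.hi) l ≤ B) :
    ∃ L, Tendsto (cellSum fun x => q x.lo x.hi) (gaugeFilter a b) (𝓝 L) := by
  set S := (cellSum fun x => q x.lo x.hi) '' {l | Chain a b l}
  have hS : BddAbove S := ⟨B, by rintro _ ⟨l, hl, rfl⟩; exact hB l hl⟩
  have hne : S.Nonempty := ⟨_, [⟨a, a, b⟩], .cons hab (.inl rfl) (.nil b), rfl⟩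
  refine ⟨sSup S, tendsto_cellSum_of_subadditive h0 hq (fun l hl => le_csSup hS ⟨l, hl, rfl⟩)
    fun ε hε => ?_⟩
  obtain ⟨_, ⟨l, hl, rfl⟩, h⟩ := exists_lt_of_lt_csSup hne (sub_lt_self _ hε)
  exact ⟨l, hl, h⟩

theorem abs_increment_subadditive (U : ℝ → ℝ) (c d e : ℝ) :
    |U e - U c| ≤ |U d - U c| + |U e - U d| := by
  have := abs_sub_le (U e) (U d) (U c)
  linarith

end Subadditive

/-! ## The lattice property -/

section Lattice

variable {u v h V : ℝ → ℝ} {a b C : ℝ}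

/-- `V` is the variation of `h` on `[a, b]`, up to a constant. -/
structure IsVariation (h V : ℝ → ℝ) (a b : ℝ) : Prop where
  dominated : DominatedBy h V a b
  tendsto : Tendsto (cellSum fun x => |h x.hi - h x.lo|) (gaugeFilter a b) (𝓝 (V b - V a))

theorem DominatedBy.isVariation_self (hV : DominatedBy V V a b) : IsVariation V V a b := by
  refine ⟨hV, tendsto_const_nhds.congr' ?_⟩
  filter_upwards [eventually_chain a b] with l hl
  rw [← cellSum_increment hl]
  refine cellSum_congr fun x hx => ?_
  rw [abs_of_nonneg ((abs_nonneg _).trans (hV.cell hl hx))]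

/-- The absolute value of a bounded integrable function is integrable with respect to the
variation of the integrator. -/
theorem KSIntegrable.abs (hab : a ≤ b) (hV : IsVariation h V a b) (hu : KSIntegrable u h a b)
    (hC : ∀ s ∈ Icc a b, |u s| ≤ C) : KSIntegrable (fun s => |u s|) V a b := by
  set U := ksIntegral u h a
  have hC0 : 0 ≤ C := (abs_nonneg _).trans (hC a ⟨le_rfl, hab⟩)
  -- The integral of `|u|` will be the variation of the indefinite integral `U`, which is finite
  -- because `u` is bounded.
  obtain ⟨L, hL⟩ := exists_tendsto_cellSum_of_subadditive (q := fun c d => |U d - U c|) hab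
    (fun c => by simp) (fun c d e _ _ => abs_increment_subadditive U c d e)
    (B := C * (V b - V a)) (fun l hl => by
      rw [← cellSum_increment hl, ← cellSum_mul_left]
      refine cellSum_le fun x hx => ?_
      obtain ⟨h1, h2, h3, -⟩ := hl.mem x hx
      exact (hu.hasKSIntegral_sub h1 h2 h3).norm_le_const h2 (hV.dominated.mono h1 h3)
        fun s hs => hC s ⟨h1.trans hs.1, hs.2.trans h3⟩)
  refine ⟨L, hasKSIntegral_iff.2 ?_⟩
  -- By Saks-Henstock, the increments of `U` may replace the terms of the integral sum even inside
  -- absolute values.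
  have h2 : Tendsto (cellSum fun x => |rsTerm u h x| - |U x.hi - U x.lo|) (gaugeFilter a b)
      (𝓝 0) := by
    refine squeeze_zero_norm (fun l => (norm_cellSum_le _ l).trans (cellSum_le fun x _ => ?_))
      (tendsto_cellSum_abs_deviation hab hu)
    exact abs_abs_sub_abs_le_abs_sub _ _
  have h3 : Tendsto (cellSum fun x => |u x.tag| * ((V x.hi - V x.lo) - |h x.hi - h x.lo|))
      (gaugeFilter a b) (𝓝 0) := by
    -- The differences between increments of `V` and absolute increments of `h` are nonnegative, and
    -- their sum tends to zero because `V` is the variation of `h`. A bounded factor does no harm.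
    have h4 : Tendsto (fun l => C * ((V b - V a) - cellSum (fun x => |h x.hi - h x.lo|) l))
        (gaugeFilter a b) (𝓝 0) := by
      simpa using (hV.tendsto.const_sub (V b - V a)).const_mul C
    refine squeeze_zero_norm' ?_ h4
    filter_upwards [eventually_chain a b] with l hl
    rw [← cellSum_increment hl, ← cellSum_sub, ← cellSum_mul_left]
    refine (norm_cellSum_le _ l).trans (cellSum_le fun x hx => ?_)
    have h5 := sub_nonneg.2 (hV.dominated.cell hl hx)
    rw [Real.norm_eq_abs, abs_mul, abs_abs, abs_of_nonneg h5]
    exact mul_le_mul_of_nonneg_right (hC _ (hl.tag_mem hx)) h5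
  have h4 := (h3.add h2).add hL
  rw [zero_add, zero_add] at h4
  refine h4.congr fun l => ?_
  rw [← cellSum_add, ← cellSum_add]
  refine cellSum_congr fun x _ => ?_
  simp only [rsTerm, smul_eq_mul, abs_mul]
  ring

theorem KSIntegrable.max (hab : a ≤ b) (hV : DominatedBy V V a b) (hu : KSIntegrable u V a b)
    (hv : KSIntegrable v V a b) (hC : ∀ s ∈ Icc a b, |u s| ≤ C) (hC' : ∀ s ∈ Icc a b, |v s| ≤ C) :
    KSIntegrable (fun s => max (u s) (v s)) V a b := by
  obtain ⟨I, hI⟩ := hu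
  obtain ⟨J, hJ⟩ := hv
  obtain ⟨K, hK⟩ := KSIntegrable.abs (C := C + C) hab hV.isVariation_self ⟨_, hI.sub hJ⟩
    fun s hs => (abs_sub _ _).trans (add_le_add (hC s hs) (hC' s hs))
  refine ⟨_, (((hI.add hJ).add hK).smul (1 / 2)).congr fun s _ => ?_⟩
  rw [smul_eq_mul]
  rcases le_total (u s) (v s) with h | h
  · rw [max_eq_right h, abs_of_nonpos (sub_nonpos.2 h)]
    ring
  · rw [max_eq_left h, abs_of_nonneg (sub_nonneg.2 h)]
    ring

theorem KSIntegrable.partialSups {d : ℕ → ℝ → ℝ} (hab : a ≤ b) (hV : DominatedBy V V a b)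
    (hd : ∀ j, KSIntegrable (d j) V a b) (hC : ∀ j, ∀ s ∈ Icc a b, |d j s| ≤ C) (K : ℕ) :
    KSIntegrable (fun s => partialSups (fun j => d j s) K) V a b ∧
      ∀ s ∈ Icc a b, |partialSups (fun j => d j s) K| ≤ C := by
  induction K with
  | zero => exact ⟨by simpa using hd 0, by simpa only [partialSups_zero] using hC 0⟩
  | succ K ih =>
    simp only [partialSups_add_one]
    exact ⟨ih.1.max hab hV (hd _) ih.2 (hC _), fun s hs =>
      (abs_max_le_max_abs_abs).trans (max_le (ih.2 s hs) (hC _ s hs))⟩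

end Lattice

/-! ## Convergence theorems -/

section Convergence

variable {V : ℝ → ℝ} {a b C : ℝ}

theorem cellSum_finset_sum {ι : Type*} (s : Finset ι) (F : ι → Cell → ℝ) (l : List Cell) :
    cellSum (fun x => ∑ i ∈ s, F i x) l = ∑ i ∈ s, cellSum (F i) l := by
  induction l with
  | nil => simp [cellSum]
  | cons x l ih => simp only [cellSum_cons, ih, Finset.sum_add_distrib]

/-- The monotone convergence theorem. -/
theorem hasKSIntegral_of_monotone {u : ℕ → ℝ → ℝ} {u' : ℝ → ℝ} {J : ℝ} (hab : a ≤ b)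
    (hV : DominatedBy V V a b) (hu : ∀ k, KSIntegrable (u k) V a b)
    (hmono : ∀ s ∈ Icc a b, Monotone fun k => u k s)
    (hlim : ∀ s ∈ Icc a b, Tendsto (fun k => u k s) atTop (𝓝 (u' s)))
    (hJ : Tendsto (fun k => ksIntegral (u k) V a b) atTop (𝓝 J)) :
    HasKSIntegral u' V a b J := by
  rw [hasKSIntegral_iff, Metric.tendsto_nhds]
  intro ε₀ hε₀
  have hD := hV.increment_nonneg le_rfl hab le_rfl
  set D := V b - V a
  obtain ⟨ε, hε, hεD⟩ : ∃ ε > 0, ε * D + ε + ε < ε₀ := by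
    refine ⟨ε₀ / (D + 3), by positivity, ?_⟩
    have : ε₀ / (D + 3) * D + ε₀ / (D + 3) + ε₀ / (D + 3) = ε₀ * ((D + 2) / (D + 3)) := by
      field_simp
      ring
    rw [this]
    refine mul_lt_of_lt_one_right hε₀ ?_
    rw [div_lt_one (by positivity)]
    linarith
  have hincr : ∀ k c d, a ≤ c → c ≤ d → d ≤ b →
      HasKSIntegral (u k) V c d (ksIntegral (u k) V a d - ksIntegral (u k) V a c) :=
    fun k c d hac hcd hdb => (hu k).hasKSIntegral_sub hac hcd hdb
  have hJmono : Monotone fun k => ksIntegral (u k) V a b := fun j k hjk =>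
    ((hu j).hasKSIntegral hab).mono_of_le hab hV (fun s hs => hmono s hs hjk)
      ((hu k).hasKSIntegral hab)
  have hJle : ∀ k, ksIntegral (u k) V a b ≤ J := hJmono.ge_of_tendsto hJ
  -- The errors allotted to the functions `u k` form a geometric series with sum `ε`.
  choose δ hδ H using fun k : ℕ => saks_henstock hab (hu k) (ε := ε * (1 / 2) ^ (k + 1))
    (by positivity)
  obtain ⟨N, hN⟩ := ((Metric.tendsto_nhds.1 hJ) ε hε).exists
  rw [Real.dist_eq, abs_lt] at hN
  have hk : ∀ s, ∃ k ≥ N, s ∈ Icc a b → |u' s - u k s| ≤ ε := by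
    intro s
    by_cases hs : s ∈ Icc a b
    · obtain ⟨k, h1, h2⟩ := ((Metric.tendsto_nhds.1 (hlim s hs) ε hε).and
        (eventually_ge_atTop N)).exists
      refine ⟨k, h2, fun _ => ?_⟩
      rw [abs_sub_comm]
      exact h1.le
    · exact ⟨N, le_rfl, fun h => absurd h hs⟩
  choose k hkN hk using hk
  -- At the tag `s` the gauge is the one of `u (k s)`, where the index `k s ≥ N` is chosen with `u
  -- (k s) s` within `ε` of the limit.
  refine eventually_gauge.2 ⟨fun s => δ (k s) s, fun s => hδ _ _, fun l hl hf => ?_⟩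
  obtain ⟨K, hK⟩ : ∃ K, ∀ x ∈ l, k x.tag < K := by
    clear hl hf
    induction l with
    | nil => exact ⟨0, by simp⟩
    | cons x l ih =>
      obtain ⟨K, hK⟩ := ih
      refine ⟨max K (k x.tag + 1), fun y hy => ?_⟩
      rcases List.mem_cons.1 hy with rfl | hy
      · exact lt_max_of_lt_right (Nat.lt_succ_self _)
      · exact lt_max_of_lt_left (hK y hy)
  have hA : |cellSum (fun x => (V x.hi - V x.lo) * (u' x.tag - u (k x.tag) x.tag)) l| ≤
      ε * D := by
    rw [show D = V b - V a from rfl, ← cellSum_increment hl, ← cellSum_mul_left]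
    rw [← Real.norm_eq_abs]
    refine (norm_cellSum_le _ l).trans (cellSum_le fun x hx => ?_)
    have h1 := (abs_nonneg _).trans (hV.cell hl hx)
    rw [Real.norm_eq_abs, abs_mul, abs_of_nonneg h1, mul_comm]
    exact mul_le_mul_of_nonneg_right (hk _ (hl.tag_mem hx)) h1
  -- The cells are grouped by the index `k x.tag`. Saks-Henstock applies to each group as a part of
  -- the whole chain.
  have hB : |cellSum (fun x => deviation (u (k x.tag)) V a x) l| ≤ ε := by
    have h1 : ∑ j ∈ Finset.range K, ε * (1 / 2 : ℝ) ^ (j + 1) ≤ ε := by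
      have h2 : ∀ K : ℕ, ∑ j ∈ Finset.range K, ε * (1 / 2 : ℝ) ^ (j + 1) =
          ε * (1 - (1 / 2) ^ K) := by
        intro K
        induction K with
        | zero => simp
        | succ K ih => rw [Finset.sum_range_succ, ih]; ring
      rw [h2]
      have : (0 : ℝ) < (1 / 2) ^ K := by positivity
      nlinarith
    refine le_trans ?_ ((Finset.sum_le_sum fun j _ => H j l hl (fun x => k x.tag = j)
      fun x hx hx' => ?_).trans h1)
    · rw [← cellSum_finset_sum, ← Real.norm_eq_abs]
      refine (norm_cellSum_le _ l).trans (cellSum_le fun x hx => ?_)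
      rw [Finset.sum_ite_eq, if_pos (Finset.mem_range.2 (hK x hx)), Real.norm_eq_abs]
    · have := hf x hx
      rwa [← hx']
  -- The indices vary from cell to cell but lie between `N` and `K`. By monotonicity the mixed sum
  -- lies between the integrals of `u N` and `u K`, hence between `J - ε` and `J`.
  have hC1 : ksIntegral (u N) V a b ≤ cellSum (fun x => ksIntegral (u (k x.tag)) V a x.hi -
      ksIntegral (u (k x.tag)) V a x.lo) l := by
    have := cellSum_increment hl (ksIntegral (u N) V a)
    rw [ksIntegral_self, sub_zero] at this
    rw [← this]
    refine cellSum_le fun x hx => ?_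
    obtain ⟨h1, h2, h3, -⟩ := hl.mem x hx
    exact (hincr N _ _ h1 h2 h3).mono_of_le h2 (hV.mono h1 h3)
      (fun s hs => hmono s ⟨h1.trans hs.1, hs.2.trans h3⟩ (hkN _)) (hincr _ _ _ h1 h2 h3)
  have hC2 : cellSum (fun x => ksIntegral (u (k x.tag)) V a x.hi -
      ksIntegral (u (k x.tag)) V a x.lo) l ≤ ksIntegral (u K) V a b := by
    have := cellSum_increment hl (ksIntegral (u K) V a)
    rw [ksIntegral_self, sub_zero] at this
    rw [← this]
    refine cellSum_le fun x hx => ?_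
    obtain ⟨h1, h2, h3, -⟩ := hl.mem x hx
    exact (hincr _ _ _ h1 h2 h3).mono_of_le h2 (hV.mono h1 h3)
      (fun s hs => hmono s ⟨h1.trans hs.1, hs.2.trans h3⟩ (hK x hx).le) (hincr _ _ _ h1 h2 h3)
  have hsum : cellSum (rsTerm u' V) l =
      cellSum (fun x => (V x.hi - V x.lo) * (u' x.tag - u (k x.tag) x.tag)) l +
      cellSum (fun x => deviation (u (k x.tag)) V a x) l +
      cellSum (fun x => ksIntegral (u (k x.tag)) V a x.hi -
        ksIntegral (u (k x.tag)) V a x.lo) l := by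
    rw [← cellSum_add, ← cellSum_add]
    refine cellSum_congr fun x _ => ?_
    simp only [deviation, rsTerm, smul_eq_mul]
    ring
  rw [hsum, Real.dist_eq, abs_lt]
  rw [abs_le] at hA hB
  have := hJle K
  constructor <;> linarith [hA.1, hA.2, hB.1, hB.2, hN.1, hN.2]

theorem ksIntegrable_of_monotone {u : ℕ → ℝ → ℝ} {u' : ℝ → ℝ} (hab : a ≤ b)
    (hV : DominatedBy V V a b) (hu : ∀ k, KSIntegrable (u k) V a b)
    (hC : ∀ k, ∀ s ∈ Icc a b, |u k s| ≤ C)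
    (hmono : ∀ s ∈ Icc a b, Monotone fun k => u k s)
    (hlim : ∀ s ∈ Icc a b, Tendsto (fun k => u k s) atTop (𝓝 (u' s))) :
    KSIntegrable u' V a b ∧
      Tendsto (fun k => ksIntegral (u k) V a b) atTop (𝓝 (ksIntegral u' V a b)) := by
  have hJmono : Monotone fun k => ksIntegral (u k) V a b := fun j k hjk =>
    ((hu j).hasKSIntegral hab).mono_of_le hab hV (fun s hs => hmono s hs hjk)
      ((hu k).hasKSIntegral hab)
  have hJ := tendsto_atTop_ciSup hJmono ⟨C * (V b - V a), by
    rintro _ ⟨k, rfl⟩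
    exact (le_abs_self _).trans (((hu k).hasKSIntegral hab).norm_le_const hab hV (hC k))⟩
  have h := hasKSIntegral_of_monotone hab hV hu hmono hlim hJ
  refine ⟨⟨_, h⟩, ?_⟩
  rwa [h.ksIntegral_eq hab]

theorem KSIntegrable.norm {n : ℕ} {h : ℝ → ℝ} {u : ℝ → Vec n} (hab : a ≤ b)
    (hV : IsVariation h V a b) (hu : KSIntegrable u h a b) (hC : ∀ s ∈ Icc a b, ‖u s‖ ≤ C) :
    KSIntegrable (fun s => ‖u s‖) V a b := by
  obtain ⟨I, hI⟩ := hu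
  have h1 : ∀ t : Finset (Fin n), KSIntegrable (fun s => ∑ i ∈ t, |u s i|) V a b := by
    intro t
    induction t using Finset.induction_on with
    | empty => exact ⟨_, by simpa using hasKSIntegral_const (0 : ℝ)⟩
    | insert i t hi ih =>
      obtain ⟨J, hJ⟩ := ih
      obtain ⟨K, hK⟩ := KSIntegrable.abs (C := C) hab hV
        ⟨_, hI.map (PiLp.proj 1 (fun _ : Fin n => ℝ) i)⟩
        fun s hs => (PiLp.norm_apply_le (u s) i).trans (hC s hs)
      refine ⟨_, (hK.add hJ).congr fun s _ => ?_⟩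
      rw [Finset.sum_insert hi]
      rfl
  simpa [PiLp.norm_eq_of_L1] using h1 Finset.univ

/-- The bounded convergence theorem. -/
theorem ksIntegral_bounded_convergence {n : ℕ} {h : ℝ → ℝ} {u : ℕ → ℝ → Vec n} {u' : ℝ → Vec n}
    (hab : a ≤ b) (hV : IsVariation h V a b) (hu : ∀ k, KSIntegrable (u k) h a b)
    (hC : ∀ k, ∀ s ∈ Icc a b, ‖u k s‖ ≤ C)
    (hlim : ∀ s ∈ Icc a b, Tendsto (fun k => u k s) atTop (𝓝 (u' s))) :
    KSIntegrable u' h a b ∧ ∃ η : ℕ → ℝ, Tendsto η atTop (𝓝 0) ∧ ∀ k, ∀ t ∈ Icc a b,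
      ‖ksIntegral (u k) h a t - ksIntegral u' h a t‖ ≤ η k := by
  have hVV := hV.dominated.self
  -- Pairs of indices `≥ N` are enumerated by one natural number. The supremum `w N` of the mutual
  -- distances is then the limit of its partial suprema, which are integrable by the lattice
  -- property.
  set d : ℕ → ℕ → ℝ → ℝ := fun N j s => ‖u (N + j.unpair.1) s - u (N + j.unpair.2) s‖ with hd
  have hdC : ∀ N j : ℕ, ∀ s ∈ Icc a b, ‖u (N + j.unpair.1) s - u (N + j.unpair.2) s‖ ≤ C + C :=
    fun N j s hs => (norm_sub_le _ _).trans (add_le_add (hC _ s hs) (hC _ s hs))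
  have hdC' : ∀ N j, ∀ s ∈ Icc a b, |d N j s| ≤ C + C := fun N j s hs => by
    rw [abs_of_nonneg (norm_nonneg _)]
    exact hdC N j s hs
  have hdi : ∀ N j, KSIntegrable (d N j) V a b := fun N j => by
    obtain ⟨I, hI⟩ := hu (N + j.unpair.1)
    obtain ⟨J, hJ⟩ := hu (N + j.unpair.2)
    exact KSIntegrable.norm hab hV ⟨_, hI.sub hJ⟩ (hdC N j)
  set w : ℕ → ℝ → ℝ := fun N s => ⨆ j, d N j s with hw
  have hbdd : ∀ N, ∀ s ∈ Icc a b, BddAbove (range fun j => d N j s) := by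
    rintro N s hs
    refine ⟨C + C, ?_⟩
    rintro _ ⟨j, rfl⟩
    exact hdC N j s hs
  have hw0 : ∀ N, ∀ s ∈ Icc a b, 0 ≤ w N s := fun N s hs =>
    (norm_nonneg _).trans (le_ciSup (hbdd N s hs) 0)
  have hwC : ∀ N, ∀ s ∈ Icc a b, w N s ≤ C + C := fun N s hs => ciSup_le fun j => hdC N j s hs
  have hle : ∀ N i j, ∀ s ∈ Icc a b, ‖u (N + i) s - u (N + j) s‖ ≤ w N s := by
    intro N i j s hs
    have := le_ciSup (hbdd N s hs) (Nat.pair i j)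
    simpa [hd] using this
  have hwi : ∀ N, KSIntegrable (w N) V a b := by
    intro N
    have h1 := fun K => KSIntegrable.partialSups hab hVV (hdi N) (hdC' N) K
    refine (ksIntegrable_of_monotone hab hVV (fun K => (h1 K).1) (fun K => (h1 K).2)
      (fun s _ => (partialSups _).monotone) fun s hs => ?_).1
    rw [hw]
    dsimp only
    rw [← ciSup_partialSups_eq (hbdd N s hs)]
    exact tendsto_atTop_ciSup (partialSups _).monotone
      ⟨C + C, by rintro _ ⟨K, rfl⟩; exact (le_abs_self _).trans ((h1 K).2 s hs)⟩
  have hwanti : ∀ s ∈ Icc a b, Antitone fun N => w N s := by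
    intro s hs
    refine antitone_nat_of_succ_le fun N => ciSup_le fun j => ?_
    have := hle N (1 + j.unpair.1) (1 + j.unpair.2) s hs
    rwa [← add_assoc, ← add_assoc] at this
  have hwlim : ∀ s ∈ Icc a b, Tendsto (fun N => w N s) atTop (𝓝 0) := by
    intro s hs
    rw [Metric.tendsto_atTop]
    intro ε hε
    obtain ⟨N, hN⟩ := Metric.cauchySeq_iff.1 (hlim s hs).cauchySeq (ε / 2) (half_pos hε)
    refine ⟨N, fun M hM => ?_⟩
    rw [Real.dist_eq, sub_zero, abs_of_nonneg (hw0 M s hs)]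
    refine lt_of_le_of_lt (ciSup_le fun j => ?_) (half_lt_self hε)
    rw [hd]
    dsimp only
    rw [← dist_eq_norm]
    exact (hN _ (hM.trans (Nat.le_add_right _ _)) _ (hM.trans (Nat.le_add_right _ _))).le
  have hneg : ∀ N, HasKSIntegral (fun s => (-1 : ℝ) • w N s) V a b ((-1 : ℝ) • ksIntegral (w N) V a b) :=
    fun N => ((hwi N).hasKSIntegral hab).smul (-1)
  have hW : Tendsto (fun N => ksIntegral (w N) V a b) atTop (𝓝 0) := by
    -- The functions `w N` decrease to zero, so monotone convergence is applied to their negatives.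
    have h1 := (ksIntegrable_of_monotone (u := fun N s => (-1 : ℝ) • w N s) (u' := fun _ => 0)
      (C := C + C) hab hVV (fun N => ⟨_, hneg N⟩) (fun N s hs => ?_) (fun s hs N M hNM => ?_)
      fun s hs => ?_).2
    · have h2 : ksIntegral (fun _ => (0 : ℝ)) V a b = 0 := by
        have := (hasKSIntegral_const (h := V) (a := a) (b := b) (0 : ℝ)).ksIntegral_eq hab
        rwa [smul_zero] at this
      rw [h2] at h1
      simp only [(hneg _).ksIntegral_eq hab] at h1
      simpa using h1.neg
    · rw [neg_one_smul, abs_neg, abs_of_nonneg (hw0 N s hs)]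
      exact hwC N s hs
    · have := hwanti s hs hNM
      simp only [neg_one_smul]
      exact neg_le_neg this
    · simpa using (hwlim s hs).neg
  have huw : ∀ k, ∀ s ∈ Icc a b, ‖u k s - u' s‖ ≤ w k s := by
    intro k s hs
    refine le_of_tendsto ((((hlim s hs).comp (tendsto_add_atTop_nat k)).const_sub (u k s)).norm)
      (Eventually.of_forall fun j => ?_)
    have := hle k 0 j s hs
    rwa [add_zero, add_comm k j] at this
  have hu' : KSIntegrable u' h a b := by
    refine ksIntegrable_of_approx hab hV.dominated fun ε hε => ?_
    obtain ⟨N, hN⟩ := (hW.eventually (gt_mem_nhds hε)).exists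
    refine ⟨u N, w N, _, hu N, (hwi N).hasKSIntegral hab, hN, fun s hs => ?_⟩
    rw [norm_sub_rev]
    exact huw N s hs
  refine ⟨hu', _, hW, fun k t ht => ?_⟩
  have h1 := ((hu k).mono le_rfl ht.1 ht.2).hasKSIntegral ht.1
  have h2 := (hu'.mono le_rfl ht.1 ht.2).hasKSIntegral ht.1
  have h3 := ((hwi k).mono le_rfl ht.1 ht.2).hasKSIntegral ht.1
  refine ((h1.sub h2).norm_le ht.1 (hV.dominated.mono le_rfl ht.2)
    (fun s hs => huw k s ⟨hs.1, hs.2.trans ht.2⟩) h3).trans ?_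
  -- Since `w k ≥ 0`, its integral over `[a, t]` is at most the one over `[a, b]`. This makes the
  -- bound independent of `t`.
  have h4 := (hwi k).hasKSIntegral_sub ht.1 ht.2 le_rfl
  have h5 := (hasKSIntegral_const (h := V) (a := t) (b := b) (0 : ℝ)).mono_of_le ht.2
    (hVV.mono ht.1 le_rfl) (fun s hs => hw0 k s ⟨ht.1.trans hs.1, hs.2⟩) h4
  rw [smul_zero] at h5
  linarith

end Convergence

/-! ## The variation function -/

section Variation

variable {T : ℝ} {h : ℝ → ℝ}

theorem abs_sub_le_variationOnFromTo {s : Set ℝ} (hb : LocallyBoundedVariationOn h s) {c d : ℝ}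
    (hc : c ∈ s) (hd : d ∈ s) (hcd : c ≤ d) : |h d - h c| ≤ variationOnFromTo h s c d := by
  rw [variationOnFromTo.eq_of_le h s hcd, ← Real.dist_eq, dist_edist]
  exact ENNReal.toReal_mono (hb c d hc hd)
    (eVariationOn.edist_le h ⟨hd, hcd, le_rfl⟩ ⟨hc, le_rfl, hcd⟩)

theorem dominatedBy_varFun (hb : BoundedVariationOn h (Icc 0 T)) :
    DominatedBy h (varFun T h) 0 T := by
  intro c d hc hcd hd
  have hl := hb.locallyBoundedVariationOn
  have h0 : (0 : ℝ) ∈ Icc 0 T := ⟨le_rfl, hc.trans (hcd.trans hd)⟩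
  have hcm : c ∈ Icc 0 T := ⟨hc, hcd.trans hd⟩
  have hdm : d ∈ Icc 0 T := ⟨hc.trans hcd, hd⟩
  have := variationOnFromTo.add hl h0 hcm hdm
  rw [varFun, varFun, ← this, add_sub_cancel_left]
  exact abs_sub_le_variationOnFromTo hl hcm hdm hcd

theorem exists_chain_of_monotone {u : ℕ → ℝ} (hu : Monotone u) (q : ℝ → ℝ → ℝ) (N : ℕ) :
    ∃ l, Chain (u 0) (u N) l ∧
      cellSum (fun x => q x.lo x.hi) l = ∑ i ∈ Finset.range N, q (u i) (u (i + 1)) := by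
  induction N with
  | zero => exact ⟨[], .nil _, by simp [cellSum]⟩
  | succ N ih =>
    obtain ⟨l, hl, hs⟩ := ih
    refine ⟨l ++ [⟨u N, u N, u (N + 1)⟩],
      hl.append (.cons (hu (Nat.le_succ N)) (.inl rfl) (.nil _)), ?_⟩
    rw [cellSum_append, hs, Finset.sum_range_succ]
    simp [cellSum]

/-- The variation is the supremum of the sums of `|h d - h c|` over partitions. These sums do not
decrease under refinement, so they converge to the supremum along fine chains. -/
theorem isVariation_varFun (hT : 0 ≤ T) (hb : BoundedVariationOn h (Icc 0 T)) :
    IsVariation h (varFun T h) 0 T := by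
  have hV := dominatedBy_varFun hb
  refine ⟨hV, tendsto_cellSum_of_subadditive (q := fun c d => |h d - h c|) (fun c => by simp)
    (fun c d e _ _ => abs_increment_subadditive h c d e) (fun l hl => ?_) fun ε hε => ?_⟩
  · rw [← cellSum_increment hl]
    exact cellSum_le fun x hx => hV.cell hl hx
  · have h1 : varFun T h T - varFun T h 0 = (eVariationOn h (Icc 0 T)).toReal := by
      rw [varFun, varFun, variationOnFromTo.self, sub_zero, variationOnFromTo.eq_of_le h _ hT,
        inter_self]
    -- `ENNReal.ofReal` truncates negative numbers, so this case is separated; any chain works in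
    -- it.
    by_cases h2 : varFun T h T - varFun T h 0 - ε < 0
    · exact ⟨[⟨0, 0, T⟩], .cons hT (.inl rfl) (.nil T), h2.trans_le (by simp [cellSum])⟩
    · have h3 : ENNReal.ofReal (varFun T h T - varFun T h 0 - ε) < eVariationOn h (Icc 0 T) := by
        rw [ENNReal.ofReal_lt_iff_lt_toReal (not_lt.1 h2) hb, ← h1]
        linarith
      obtain ⟨⟨N, u, hu, hus⟩, hN⟩ := lt_iSup_iff.1 h3
      obtain ⟨l, hl, hs⟩ := exists_chain_of_monotone hu (fun c d => |h d - h c|) N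
      -- The finite sequence need not reach the ends of `[0, T]`. The two cells added there only
      -- increase the sum.
      refine ⟨⟨0, 0, u 0⟩ :: (l ++ [⟨u N, u N, T⟩]), .cons (hus 0).1 (.inl rfl)
        (hl.append (.cons (hus N).2 (.inl rfl) (.nil T))), ?_⟩
      rw [cellSum_cons, cellSum_append, hs, cellSum_cons, cellSum_nil]
      have h4 : varFun T h T - varFun T h 0 - ε <
          ∑ i ∈ Finset.range N, |h (u (i + 1)) - h (u i)| := by
        rw [ENNReal.ofReal_lt_iff_lt_toReal (not_lt.1 h2) (by simp [ENNReal.sum_eq_top, edist_ne_top])] at hN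
        refine hN.trans_eq ?_
        simp only
        rw [ENNReal.toReal_sum fun i _ => edist_ne_top _ _]
        exact Finset.sum_congr rfl fun i _ => by rw [← dist_edist, Real.dist_eq]
      linarith [abs_nonneg (h (u 0) - h 0), abs_nonneg (h T - h (u N))]

end Variation

/-! ## Matrix norms -/

theorem matNorm_nonneg {n : ℕ} (A : Vec n →L[ℝ] Vec n) : 0 ≤ matNorm A :=
  Real.iSup_nonneg fun _ => Finset.sum_nonneg fun _ _ => abs_nonneg _

theorem vec_eq_sum {n : ℕ} (v : Vec n) : v = ∑ j, v j • PiLp.single 1 j (1 : ℝ) := by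
  ext i
  simp [Pi.single_apply]

/-- The maximal row sum bounds each coordinate of `A v` by `matNorm A * ‖v‖`. The domain and the
target carry the sum norm, so the `n` coordinates give the factor `n`. -/
theorem opNorm_le_matNorm {n : ℕ} (A : Vec n →L[ℝ] Vec n) : ‖A‖ ≤ n * matNorm A := by
  refine A.opNorm_le_bound (mul_nonneg n.cast_nonneg (matNorm_nonneg A)) fun v => ?_
  rw [PiLp.norm_eq_of_L1 (A v)]
  have h1 : ∀ i, ‖A v i‖ ≤ matNorm A * ‖v‖ := by
    intro i
    have h2 : A v i = ∑ j, v j * A (PiLp.single 1 j (1 : ℝ)) i := by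
      conv_lhs => rw [vec_eq_sum v]
      simp
    have h3 : ∑ j, |A (PiLp.single 1 j (1 : ℝ)) i| ≤ matNorm A :=
      le_ciSup (f := fun i => ∑ j, |A (PiLp.single 1 j (1 : ℝ)) i|) (finite_range _).bddAbove i
    rw [h2]
    refine (norm_sum_le _ _).trans ?_
    refine le_trans ?_ (mul_le_mul_of_nonneg_right h3 (norm_nonneg v))
    rw [Finset.sum_mul]
    refine Finset.sum_le_sum fun j _ => ?_
    rw [norm_mul, mul_comm]
    exact mul_le_mul_of_nonneg_left (PiLp.norm_apply_le v j) (abs_nonneg _)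
  refine (Finset.sum_le_sum fun i _ => h1 i).trans_eq ?_
  simp [mul_assoc]

theorem norm_sub_le_of_fderiv_le {n : ℕ} {G : Vec n → Vec n} {S : Set (Vec n)} {C : ℝ}
    (hS : Convex ℝ S) (hd : ∀ y ∈ S, DifferentiableAt ℝ G y) (hC : ∀ y ∈ S, ‖fderiv ℝ G y‖ ≤ C)
    {y y' : Vec n} (hy : y ∈ S) (hy' : y' ∈ S) : ‖G y' - G y‖ ≤ C * ‖y' - y‖ :=
  hS.norm_image_sub_le_of_norm_hasFDerivWithin_le
    (fun z hz => (hd z hz).hasFDerivAt.hasFDerivWithinAt) hC hy hy'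

/-! ## Regulated functions -/

section Reg

variable {n : ℕ} {T : ℝ}

theorem Reg.val_mk {x : Icc (0 : ℝ) T → Vec n} (hx : IsRegulated x) {s : ℝ}
    (hs : s ∈ Icc (0 : ℝ) T) : (Reg.mk x hx).val s = x ⟨s, hs⟩ := by
  rw [Reg.val, dif_pos hs]
  rfl

theorem Reg.val_add (x y : Reg n T) (s : ℝ) : (x + y).val s = x.val s + y.val s := by
  unfold Reg.val
  split_ifs
  · rfl
  · rw [add_zero]

theorem Reg.val_smul (c : ℝ) (x : Reg n T) (s : ℝ) : (c • x).val s = c • x.val s := by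
  unfold Reg.val
  split_ifs
  · rfl
  · rw [smul_zero]

theorem Reg.val_sub (x y : Reg n T) (s : ℝ) : (x - y).val s = x.val s - y.val s := by
  unfold Reg.val
  split_ifs
  · rfl
  · rw [sub_zero]

theorem Reg.norm_val_le (x : Reg n T) (s : ℝ) : ‖x.val s‖ ≤ ‖x‖ := by
  unfold Reg.val
  split_ifs with hs
  · exact lp.norm_apply_le_norm ENNReal.top_ne_zero _ _
  · rw [norm_zero]
    exact norm_nonneg _

theorem Reg.norm_val_sub_le (x y : Reg n T) (s : ℝ) : ‖x.val s - y.val s‖ ≤ ‖x - y‖ := by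
  rw [← Reg.val_sub]
  exact Reg.norm_val_le _ _

theorem Reg.norm_le {x : Reg n T} {C : ℝ} (hC : 0 ≤ C) (h : ∀ s ∈ Icc 0 T, ‖x.val s‖ ≤ C) :
    ‖x‖ ≤ C := by
  refine lp.norm_le_of_forall_le hC fun s => ?_
  have := h s s.2
  rwa [Reg.val, dif_pos s.2] at this

theorem Reg.ext_val {x y : Reg n T} (h : ∀ s ∈ Icc 0 T, x.val s = y.val s) : x = y := by
  refine Subtype.ext (lp.ext (funext fun s => ?_))
  have := h s s.2
  rwa [Reg.val, Reg.val, dif_pos s.2, dif_pos s.2] at this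

theorem isRegulated_const (v : Vec n) : IsRegulated fun _ : Icc (0 : ℝ) T => v :=
  fun _ => ⟨⟨v, tendsto_const_nhds⟩, ⟨v, tendsto_const_nhds⟩⟩

/-- Adding a constant function to `x₀` reaches every point of the ball. These balls are the convex
subsets of `Ω` on which the mean value inequality is used, since `Ω` itself need not be convex. -/
theorem closedBall_subset_of_forall_reg {Ω : Set (Vec n)} {x₀ : Reg n T} {ρ : ℝ}
    (hρ : 0 ≤ ρ) (hball : ∀ x ∈ Metric.closedBall x₀ ρ, ∀ t ∈ Icc 0 T, x.val t ∈ Ω) {s : ℝ}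
    (hs : s ∈ Icc 0 T) : Metric.closedBall (x₀.val s) ρ ⊆ Ω := by
  intro y hy
  rw [mem_closedBall_iff_norm] at hy
  have h1 := hball (x₀ + Reg.mk _ (isRegulated_const (y - x₀.val s))) (by
    rw [mem_closedBall_iff_norm, add_sub_cancel_left]
    refine Reg.norm_le hρ fun t ht => ?_
    rwa [Reg.val_mk _ ht]) s hs
  rwa [Reg.val_add, Reg.val_mk _ hs, add_sub_cancel] at h1

theorem isRegulated_of_dominated {F : Icc (0 : ℝ) T → Vec n} {M : ℝ → ℝ}
    (hF : ∀ c d : Icc (0 : ℝ) T, c ≤ d → ‖F d - F c‖ ≤ M d - M c) : IsRegulated F := by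
  have hM : Monotone fun s : Icc (0 : ℝ) T => M s := fun c d hcd =>
    sub_nonneg.1 ((norm_nonneg _).trans (hF c d hcd))
  exact fun t => ⟨exists_tendsto_of_dominated hM hF (hM.tendsto_nhdsLT t),
    exists_tendsto_of_dominated hM hF (hM.tendsto_nhdsGT t)⟩

/-- The oscillation of a regulated function is small in short open intervals on each side of a
given point. -/
theorem Reg.exists_oscillation_lt (x : Reg n T) {κ : ℝ} (hκ : 0 < κ) {t : ℝ} (ht : t ∈ Icc 0 T) :
    ∃ η > 0, ∀ c d, 0 ≤ c → c < d → d ≤ T → (t = c ∨ t = d) → d - c < η →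
      ∀ s ∈ Ioo c d, ∀ s' ∈ Ioo c d, ‖x.val s - x.val s'‖ < κ := by
  obtain ⟨⟨l, hl⟩, ⟨r, hr⟩⟩ := x.2 ⟨t, ht⟩
  have hl := Metric.tendsto_nhds.1 hl (κ / 2) (half_pos hκ)
  have hr := Metric.tendsto_nhds.1 hr (κ / 2) (half_pos hκ)
  rw [eventually_nhdsWithin_iff, Metric.eventually_nhds_iff] at hl hr
  obtain ⟨η₁, hη₁, h₁⟩ := hl
  obtain ⟨η₂, hη₂, h₂⟩ := hr
  refine ⟨min η₁ η₂, lt_min hη₁ hη₂, fun c d hc hcd hd htcd hη => ?_⟩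
  suffices ∃ p : Vec n, ∀ s ∈ Ioo c d, dist (x.val s) p < κ / 2 by
    obtain ⟨p, hp⟩ := this
    intro s hs s' hs'
    rw [← dist_eq_norm]
    linarith [dist_triangle_right (x.val s) (x.val s') p, hp s hs, hp s' hs']
  rcases htcd with rfl | rfl
  · refine ⟨r, fun s hs => ?_⟩
    have hsT : s ∈ Icc 0 T := ⟨hc.trans hs.1.le, hs.2.le.trans hd⟩
    have := @h₂ ⟨s, hsT⟩ (by
      rw [Subtype.dist_eq, Real.dist_eq, abs_of_pos (sub_pos.2 hs.1)]
      linarith [hs.2, min_le_right η₁ η₂]) hs.1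
    rwa [Reg.val, dif_pos hsT]
  · refine ⟨l, fun s hs => ?_⟩
    have hsT : s ∈ Icc 0 T := ⟨hc.trans hs.1.le, hs.2.le.trans hd⟩
    have := @h₁ ⟨s, hsT⟩ (by
      rw [Subtype.dist_eq, Real.dist_eq, abs_sub_comm, abs_of_pos (sub_pos.2 hs.2)]
      linarith [hs.1, min_le_left η₁ η₂]) hs.2
    rwa [Reg.val, dif_pos hsT]

end Reg

/-! ## Remainders of differentiable functions along sequences -/

/-- The scale `r k` is only an upper bound of `‖z k‖`: in the applications it is the sup norm of a
function and `z k` is its value at a fixed point. If `r k = 0`, the inverse is `0` by convention and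
the term vanishes. -/
theorem tendsto_remainder {E F : Type*} [NormedAddCommGroup E] [NormedSpace ℝ E]
    [NormedAddCommGroup F] [NormedSpace ℝ F] {G : E → F} {G' : E →L[ℝ] F} {y : E}
    (hG : HasFDerivAt G G' y) {z : ℕ → E} {r : ℕ → ℝ} (hr : Tendsto r atTop (𝓝 0))
    (hz : ∀ k, ‖z k‖ ≤ r k) :
    Tendsto (fun k => (r k)⁻¹ • (G (y + z k) - G y - G' (z k))) atTop (𝓝 0) := by
  have hz0 : Tendsto z atTop (𝓝 0) := squeeze_zero_norm hz hr
  rw [Metric.tendsto_nhds]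
  intro ε hε
  filter_upwards [hz0.eventually ((hasFDerivAt_iff_isLittleO_nhds_zero.1 hG).def (half_pos hε))]
    with k hk
  have h0 : 0 ≤ r k := (norm_nonneg _).trans (hz k)
  rw [dist_zero_right, norm_smul, norm_inv, Real.norm_of_nonneg h0]
  rcases h0.eq_or_lt with h | h
  · rw [← h, inv_zero, zero_mul]
    exact hε
  · rw [inv_mul_lt_iff₀ h]
    nlinarith [hz k]

theorem tendsto_difference_quotient {E F : Type*} [NormedAddCommGroup E] [NormedSpace ℝ E]
    [NormedAddCommGroup F] [NormedSpace ℝ F] {G : E → F} {G' : E →L[ℝ] F} {y : E}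
    (hG : HasFDerivAt G G' y) (v : E) {r : ℕ → ℝ} (hr : Tendsto r atTop (𝓝 0))
    (hr0 : ∀ k, 0 < r k) :
    Tendsto (fun k => (r k)⁻¹ • (G (y + r k • v) - G y)) atTop (𝓝 (G' v)) := by
  have h1 := tendsto_remainder hG (z := fun k => r k • v) (r := fun k => r k * (‖v‖ + 1))
    (by simpa using hr.mul_const (‖v‖ + 1)) fun k => by
      rw [norm_smul, Real.norm_of_nonneg (hr0 k).le]
      nlinarith [hr0 k]
  have h2 := (h1.const_smul (‖v‖ + 1)).add_const (G' v)
  rw [smul_zero, zero_add] at h2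
  refine h2.congr fun k => ?_
  have h3 := (hr0 k).ne'
  have h4 : ‖v‖ + 1 ≠ 0 := by positivity
  rw [smul_smul, mul_inv, mul_comm (r k)⁻¹, ← mul_assoc, mul_inv_cancel₀ h4, one_mul, map_smul,
    smul_sub, smul_smul, inv_mul_cancel₀ h3, one_smul, sub_add_cancel]

/-- A sequence of positive scaling factors that tends to zero and brings a vector into a ball. -/
theorem exists_scaling {ρ : ℝ} (hρ : 0 < ρ) (a : ℝ) (ha : 0 ≤ a) :
    ∃ r : ℕ → ℝ, Tendsto r atTop (𝓝 0) ∧ (∀ k, 0 < r k) ∧ ∀ k, r k * a < ρ := by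
  refine ⟨fun k => ρ / (a + 1) * (1 / ((k : ℝ) + 1)), ?_, fun k => by positivity, fun k => ?_⟩
  · simpa using tendsto_one_div_add_atTop_nhds_zero_nat.const_mul (ρ / (a + 1))
  · have h1 : (1 : ℝ) / ((k : ℝ) + 1) ≤ 1 := by
      rw [div_le_one (by positivity)]
      linarith [(Nat.cast_nonneg k : (0 : ℝ) ≤ k)]
    have h2 : ρ / (a + 1) * a < ρ := by
      rw [div_mul_eq_mul_div, div_lt_iff₀ (by positivity)]
      nlinarith
    calc ρ / (a + 1) * (1 / ((k : ℝ) + 1)) * a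
        = ρ / (a + 1) * a * (1 / ((k : ℝ) + 1)) := by ring
      _ ≤ ρ / (a + 1) * a := mul_le_of_le_one_right (by positivity) h1
      _ < ρ := h2

/-! ## The Stieltjes part of the operator -/

section StieltjesPart

variable {n : ℕ} {T : ℝ} {Ω : Set (Vec n)} {g : Vec n → ℝ → Vec n} {h : ℝ → ℝ} {x₀ : Reg n T}
  {ρ C : ℝ}

theorem Reg.val_mem_closedBall_of_add_le {x : Reg n T} {s s' : ℝ}
    (hx : ‖x.val s - x.val s'‖ + ‖x - x₀‖ ≤ ρ) : x.val s ∈ Metric.closedBall (x₀.val s') ρ := by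
  rw [mem_closedBall_iff_norm]
  have h1 := norm_sub_le_norm_sub_add_norm_sub (x.val s) (x.val s') (x₀.val s')
  linarith [Reg.norm_val_sub_le x x₀ s']

theorem Reg.val_mem_closedBall {x : Reg n T} (hx : ‖x - x₀‖ ≤ ρ) (s : ℝ) :
    x.val s ∈ Metric.closedBall (x₀.val s) ρ := by
  rw [mem_closedBall_iff_norm]
  exact (Reg.norm_val_sub_le x x₀ s).trans hx

/-- On a short open interval beside a given point, `x` is close to its value at the midpoint `ξ`.
There `g(x(s), s)` is close to `g(x(ξ), s)`, and the latter is integrable because its first argument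
is fixed. -/
theorem ksIntegrable_superposition (hT : 0 ≤ T) (hb : BoundedVariationOn h (Icc 0 T))
    (hg : ∀ x ∈ Ω, KSIntegrable (g x) h 0 T)
    (hgd : ∀ x ∈ Ω, ∀ t ∈ Icc 0 T, DifferentiableAt ℝ (fun y => g y t) x) (hC0 : 0 ≤ C)
    (hC : ∀ x ∈ Ω, ∀ t ∈ Icc 0 T, ‖dgx g x t‖ ≤ C)
    (hball : ∀ s ∈ Icc 0 T, Metric.closedBall (x₀.val s) ρ ⊆ Ω) {x : Reg n T}
    (hx : ‖x - x₀‖ < ρ) : KSIntegrable (fun s => g (x.val s) s) h 0 T := by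
  refine ksIntegrable_of_local_approx hT (dominatedBy_varFun hb) fun ε hε t ht => ?_
  -- The first bound makes the error at most `ε`. The second keeps `x(s)` in the ball of radius `ρ`
  -- about `x₀(ξ)`, a convex part of `Ω`.
  obtain ⟨η, hη, H⟩ := x.exists_oscillation_lt (κ := min (ε / (C + 1)) (ρ - ‖x - x₀‖))
    (lt_min (by positivity) (sub_pos.2 hx)) ht
  refine ⟨η, hη, fun c d hc hcd hd htcd hcdη => ?_⟩
  have hξ : (c + d) / 2 ∈ Ioo c d := ⟨by linarith, by linarith⟩
  have hξT : (c + d) / 2 ∈ Icc 0 T := ⟨hc.trans hξ.1.le, hξ.2.le.trans hd⟩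
  have hmem := Reg.val_mem_closedBall hx.le ((c + d) / 2)
  refine ⟨g (x.val ((c + d) / 2)), (hg _ (hball _ hξT hmem)).mono hc hcd.le hd, fun s hs => ?_⟩
  have hsT : s ∈ Icc 0 T := ⟨hc.trans hs.1.le, hs.2.le.trans hd⟩
  have h1 := H c d hc hcd hd htcd hcdη s hs _ hξ
  have hmem' : x.val s ∈ Metric.closedBall (x₀.val ((c + d) / 2)) ρ :=
    Reg.val_mem_closedBall_of_add_le (by linarith [min_le_right (ε / (C + 1)) (ρ - ‖x - x₀‖)])
  refine (norm_sub_le_of_fderiv_le (G := fun y => g y s) (convex_closedBall _ _)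
    (fun y hy => hgd y (hball _ hξT hy) s hsT) (fun y hy => hC y (hball _ hξT hy) s hsT)
    hmem hmem').trans ?_
  have h2 := h1.trans_le (min_le_left _ _)
  rw [lt_div_iff₀ (by positivity)] at h2
  nlinarith [norm_nonneg (x.val s - x.val ((c + d) / 2))]

theorem norm_superposition_sub_le
    (hgd : ∀ x ∈ Ω, ∀ t ∈ Icc 0 T, DifferentiableAt ℝ (fun y => g y t) x)
    (hC : ∀ x ∈ Ω, ∀ t ∈ Icc 0 T, ‖dgx g x t‖ ≤ C)
    (hball : ∀ s ∈ Icc 0 T, Metric.closedBall (x₀.val s) ρ ⊆ Ω) {x : Reg n T} (hC0 : 0 ≤ C)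
    (hx : ‖x - x₀‖ ≤ ρ) {s : ℝ} (hs : s ∈ Icc 0 T) :
    ‖g (x.val s) s - g (x₀.val s) s‖ ≤ C * ‖x - x₀‖ := by
  refine (norm_sub_le_of_fderiv_le (G := fun y => g y s) (convex_closedBall _ _)
    (fun y hy => hgd y (hball _ hs hy) s hs) (fun y hy => hC y (hball _ hs hy) s hs)
    (Metric.mem_closedBall_self ((norm_nonneg _).trans hx))
    (Reg.val_mem_closedBall hx s)).trans ?_
  exact mul_le_mul_of_nonneg_left (Reg.norm_val_sub_le _ _ _) hC0

/-- The integrand is the pointwise limit of difference quotients of superpositions, bounded by `C *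
‖z‖`, so bounded convergence gives its integrability. -/
theorem ksIntegrable_derivative (hT : 0 ≤ T) (hb : BoundedVariationOn h (Icc 0 T)) (hρ : 0 < ρ)
    (hg : ∀ x ∈ Ω, KSIntegrable (g x) h 0 T)
    (hgd : ∀ x ∈ Ω, ∀ t ∈ Icc 0 T, DifferentiableAt ℝ (fun y => g y t) x) (hC0 : 0 ≤ C)
    (hC : ∀ x ∈ Ω, ∀ t ∈ Icc 0 T, ‖dgx g x t‖ ≤ C)
    (hball : ∀ s ∈ Icc 0 T, Metric.closedBall (x₀.val s) ρ ⊆ Ω) (z : Reg n T) :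
    KSIntegrable (fun s => dgx g (x₀.val s) s (z.val s)) h 0 T := by
  obtain ⟨r, hr, hr0, hrρ⟩ := exists_scaling hρ ‖z‖ (norm_nonneg z)
  have hn : ∀ k, ‖(x₀ + r k • z) - x₀‖ = r k * ‖z‖ := fun k => by
    rw [add_sub_cancel_left, norm_smul, Real.norm_of_nonneg (hr0 k).le]
  have hint : ∀ k, KSIntegrable (fun s => (r k)⁻¹ •
      (g ((x₀ + r k • z).val s) s - g (x₀.val s) s)) h 0 T := fun k => by
    obtain ⟨I, hI⟩ := ksIntegrable_superposition hT hb hg hgd hC0 hC hball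
      (x := x₀ + r k • z) (by rw [hn]; exact hrρ k)
    obtain ⟨J, hJ⟩ := ksIntegrable_superposition hT hb hg hgd hC0 hC hball
      (x := x₀) (by simpa using hρ)
    exact ⟨_, (hI.sub hJ).smul _⟩
  refine (ksIntegral_bounded_convergence (C := C * ‖z‖) hT (isVariation_varFun hT hb) hint
    (fun k s hs => ?_) fun s hs => ?_).1
  · rw [norm_smul, norm_inv, Real.norm_of_nonneg (hr0 k).le, inv_mul_le_iff₀ (hr0 k)]
    refine (norm_superposition_sub_le hgd hC hball hC0 ((hn k).trans_le (hrρ k).le) hs).trans_eq ?_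
    rw [hn]
    ring
  · simp only [Reg.val_add, Reg.val_smul]
    refine tendsto_difference_quotient (G := fun y => g y s) (DifferentiableAt.hasFDerivAt ?_)
      (z.val s) hr hr0
    exact hgd _ (hball s hs (Metric.mem_closedBall_self hρ.le)) s hs

/-- The pointwise remainder divided by `‖x k - x₀‖` tends to zero and is bounded by `2 C`. Bounded
convergence gives an estimate uniform in `t`, as the sup norm of `G[0, T]` requires. -/
theorem exists_ksIntegral_remainder (hT : 0 ≤ T) (hb : BoundedVariationOn h (Icc 0 T))
    (hρ : 0 < ρ) (hg : ∀ x ∈ Ω, KSIntegrable (g x) h 0 T)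
    (hgd : ∀ x ∈ Ω, ∀ t ∈ Icc 0 T, DifferentiableAt ℝ (fun y => g y t) x) (hC0 : 0 ≤ C)
    (hC : ∀ x ∈ Ω, ∀ t ∈ Icc 0 T, ‖dgx g x t‖ ≤ C)
    (hball : ∀ s ∈ Icc 0 T, Metric.closedBall (x₀.val s) ρ ⊆ Ω) {x : ℕ → Reg n T}
    (hx : ∀ k, ‖x k - x₀‖ < ρ) (hlim : Tendsto (fun k => ‖x k - x₀‖) atTop (𝓝 0)) :
    ∃ η : ℕ → ℝ, Tendsto η atTop (𝓝 0) ∧ ∀ k, ∀ t ∈ Icc 0 T,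
      ‖x k - x₀‖⁻¹ * ‖ksIntegral (fun s => g ((x k).val s) s) h 0 t
        - ksIntegral (fun s => g (x₀.val s) s) h 0 t
        - ksIntegral (fun s => dgx g (x₀.val s) s ((x k - x₀).val s)) h 0 t‖ ≤ η k := by
  have hi1 := fun k => ksIntegrable_superposition hT hb hg hgd hC0 hC hball (hx k)
  have hi2 := ksIntegrable_superposition hT hb hg hgd hC0 hC hball (x := x₀) (by simpa using hρ)
  have hi3 := fun k => ksIntegrable_derivative hT hb hρ hg hgd hC0 hC hball (x k - x₀)
  have hint : ∀ k, ∀ t ∈ Icc 0 T, HasKSIntegral (fun s => ‖x k - x₀‖⁻¹ •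
      (g ((x k).val s) s - g (x₀.val s) s - dgx g (x₀.val s) s ((x k - x₀).val s))) h 0 t
      (‖x k - x₀‖⁻¹ • (ksIntegral (fun s => g ((x k).val s) s) h 0 t
        - ksIntegral (fun s => g (x₀.val s) s) h 0 t
        - ksIntegral (fun s => dgx g (x₀.val s) s ((x k - x₀).val s)) h 0 t)) := fun k t ht =>
    (((((hi1 k).mono le_rfl ht.1 ht.2).hasKSIntegral ht.1).sub
      ((hi2.mono le_rfl ht.1 ht.2).hasKSIntegral ht.1)).sub
      (((hi3 k).mono le_rfl ht.1 ht.2).hasKSIntegral ht.1)).smul _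
  have hmem : ∀ s, x₀.val s ∈ Metric.closedBall (x₀.val s) ρ := fun s =>
    Metric.mem_closedBall_self hρ.le
  have hbound : ∀ k, ∀ s ∈ Icc 0 T, ‖‖x k - x₀‖⁻¹ • (g ((x k).val s) s - g (x₀.val s) s -
      dgx g (x₀.val s) s ((x k - x₀).val s))‖ ≤ C + C := by
    intro k s hs
    rw [norm_smul, norm_inv, norm_norm]
    rcases (norm_nonneg (x k - x₀)).eq_or_lt with h0 | h0
    · rw [← h0, inv_zero, zero_mul]
      exact add_nonneg hC0 hC0
    rw [inv_mul_le_iff₀ h0]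
    refine (norm_sub_le _ _).trans ?_
    have h1 := norm_superposition_sub_le hgd hC hball hC0 (hx k).le hs
    have h2 := (dgx g (x₀.val s) s).le_of_opNorm_le (hC _ (hball s hs (hmem s)) s hs)
      ((x k - x₀).val s)
    have h3 := mul_le_mul_of_nonneg_left (Reg.norm_val_le (x k - x₀) s) hC0
    linarith
  have hpt : ∀ s ∈ Icc 0 T, Tendsto (fun k => ‖x k - x₀‖⁻¹ • (g ((x k).val s) s -
      g (x₀.val s) s - dgx g (x₀.val s) s ((x k - x₀).val s))) atTop (𝓝 0) := by
    intro s hs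
    have h1 := tendsto_remainder (G := fun y => g y s)
      (hgd _ (hball s hs (hmem s)) s hs).hasFDerivAt (z := fun k => (x k - x₀).val s) hlim
      fun k => Reg.norm_val_le _ _
    refine h1.congr fun k => ?_
    rw [Reg.val_sub, add_sub_cancel]
    rfl
  obtain ⟨-, η, hη, H⟩ := ksIntegral_bounded_convergence hT (isVariation_varFun hT hb)
    (fun k => ⟨_, hint k T ⟨hT, le_rfl⟩⟩) hbound hpt
  refine ⟨η, hη, fun k t ht => ?_⟩
  have h1 := H k t ht
  have h2 : ksIntegral (fun _ => (0 : Vec n)) h 0 t = 0 := by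
    have := (hasKSIntegral_const (h := h) (a := 0) (b := t) (0 : Vec n)).ksIntegral_eq ht.1
    rwa [smul_zero] at this
  rwa [(hint k t ht).ksIntegral_eq ht.1, h2, sub_zero, norm_smul, norm_inv, norm_norm] at h1

end StieltjesPart

/-! ## The Lebesgue part of the operator -/

section LebesguePart

variable {n : ℕ} {T : ℝ} {Ω : Set (Vec n)} {F : Vec n → ℝ → Vec n} {x₀ : Reg n T} {ρ : ℝ}
  {θ : ℝ → ℝ}

/-- As in the Stieltjes case, `x` is frozen at midpoints of short intervals. The error is at most `θ
s * κ`, and `κ = 1 / (k + 1)` yields measurable approximants that converge almost everywhere. -/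
theorem aestronglyMeasurable_superposition (hT : 0 ≤ T)
    (hF : ∀ x ∈ Ω, AEStronglyMeasurable (F x) (volume.restrict (Icc 0 T)))
    (hFd : ∀ x ∈ Ω, ∀ t ∈ Icc 0 T, DifferentiableAt ℝ (fun y => F y t) x)
    (hθ : ∀ x ∈ Ω, ∀ t ∈ Icc 0 T, ‖fderiv ℝ (fun y => F y t) x‖ ≤ θ t)
    (hball : ∀ s ∈ Icc 0 T, Metric.closedBall (x₀.val s) ρ ⊆ Ω) {x : Reg n T}
    (hx : ‖x - x₀‖ < ρ) :
    AEStronglyMeasurable (fun s => F (x.val s) s) (volume.restrict (Ioc 0 T)) := by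
  have key : ∀ κ > 0, ∃ w : ℝ → Vec n, AEStronglyMeasurable w (volume.restrict (Ioc 0 T)) ∧
      ∀ᵐ s ∂volume.restrict (Ioc 0 T), ‖F (x.val s) s - w s‖ ≤ θ s * κ := by
    intro κ hκ
    refine cousin_induction (P := fun c d => ∃ w : ℝ → Vec n,
      AEStronglyMeasurable w (volume.restrict (Ioc c d)) ∧
      ∀ᵐ s ∂volume.restrict (Ioc c d), ‖F (x.val s) s - w s‖ ≤ θ s * κ) hT ?_ ?_ ?_
    · exact fun c _ => ⟨0, by simp, by simp⟩
    · rintro c d e - hcd hde - ⟨w, hw, hw'⟩ ⟨v, hv, hv'⟩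
      have h1 : ∀ᵐ s ∂volume.restrict (Ioc c d), w s = if s ≤ d then w s else v s := by
        filter_upwards [ae_restrict_mem measurableSet_Ioc] with s hs
        rw [if_pos hs.2]
      have h2 : ∀ᵐ s ∂volume.restrict (Ioc d e), v s = if s ≤ d then w s else v s := by
        filter_upwards [ae_restrict_mem measurableSet_Ioc] with s hs
        rw [if_neg (not_le.2 hs.1)]
      refine ⟨fun s => if s ≤ d then w s else v s, ?_, ?_⟩
      · rw [← Ioc_union_Ioc_eq_Ioc hcd hde, aestronglyMeasurable_union_iff]
        exact ⟨hw.congr h1, hv.congr h2⟩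
      · rw [← Ioc_union_Ioc_eq_Ioc hcd hde, ae_restrict_union_iff]
        constructor
        · filter_upwards [hw', h1] with s hs hs'
          rwa [← hs']
        · filter_upwards [hv', h2] with s hs hs'
          rwa [← hs']
    · intro t ht
      obtain ⟨η, hη, H⟩ := x.exists_oscillation_lt (κ := min κ (ρ - ‖x - x₀‖))
        (lt_min hκ (sub_pos.2 hx)) ht
      refine ⟨η, hη, fun c d hc hcd hd htcd hcdη => ?_⟩
      have hξ : (c + d) / 2 ∈ Ioo c d := ⟨by linarith, by linarith⟩
      have hξT : (c + d) / 2 ∈ Icc 0 T := ⟨hc.trans hξ.1.le, hξ.2.le.trans hd⟩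
      have hmem := Reg.val_mem_closedBall hx.le ((c + d) / 2)
      refine ⟨F (x.val ((c + d) / 2)), (hF _ (hball _ hξT hmem)).mono_measure
        (Measure.restrict_mono
          ((Ioc_subset_Ioc hc hd).trans Ioc_subset_Icc_self) le_rfl), ?_⟩
      -- The oscillation of `x` is controlled in the open interval only; the end point `d` is a null
      -- set.
      rw [← restrict_Ioo_eq_restrict_Ioc]
      filter_upwards [ae_restrict_mem measurableSet_Ioo] with s hs
      have hsT : s ∈ Icc 0 T := ⟨hc.trans hs.1.le, hs.2.le.trans hd⟩
      have h1 := H c d hc hcd hd htcd hcdη s hs _ hξ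
      have hmem' : x.val s ∈ Metric.closedBall (x₀.val ((c + d) / 2)) ρ :=
        Reg.val_mem_closedBall_of_add_le (by linarith [min_le_right κ (ρ - ‖x - x₀‖)])
      refine (norm_sub_le_of_fderiv_le (G := fun y => F y s) (convex_closedBall _ _)
        (fun y hy => hFd y (hball _ hξT hy) s hsT) (fun y hy => hθ y (hball _ hξT hy) s hsT)
        hmem hmem').trans ?_
      exact mul_le_mul_of_nonneg_left (h1.le.trans (min_le_left _ _))
        ((norm_nonneg _).trans (hθ _ (hball _ hξT hmem) s hsT))
  choose w hw hw' using fun k : ℕ => key (1 / ((k : ℝ) + 1)) (by positivity)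
  refine aestronglyMeasurable_of_tendsto_ae atTop hw ?_
  filter_upwards [ae_all_iff.2 hw'] with s hs
  rw [tendsto_iff_norm_sub_tendsto_zero]
  refine squeeze_zero (fun k => norm_nonneg _) (fun k => ?_)
    (by simpa using tendsto_one_div_add_atTop_nhds_zero_nat.const_mul (θ s))
  rw [norm_sub_rev, ← one_div]
  exact hs k

theorem aestronglyMeasurable_derivative (hT : 0 ≤ T) (hρ : 0 < ρ)
    (hF : ∀ x ∈ Ω, AEStronglyMeasurable (F x) (volume.restrict (Icc 0 T)))
    (hFd : ∀ x ∈ Ω, ∀ t ∈ Icc 0 T, DifferentiableAt ℝ (fun y => F y t) x)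
    (hθ : ∀ x ∈ Ω, ∀ t ∈ Icc 0 T, ‖fderiv ℝ (fun y => F y t) x‖ ≤ θ t)
    (hball : ∀ s ∈ Icc 0 T, Metric.closedBall (x₀.val s) ρ ⊆ Ω) (z : Reg n T) :
    AEStronglyMeasurable (fun s => fderiv ℝ (fun y => F y s) (x₀.val s) (z.val s))
      (volume.restrict (Ioc 0 T)) := by
  obtain ⟨r, hr, hr0, hrρ⟩ := exists_scaling hρ ‖z‖ (norm_nonneg z)
  refine aestronglyMeasurable_of_tendsto_ae atTop (f := fun k s => (r k)⁻¹ •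
      (F ((x₀ + r k • z).val s) s - F (x₀.val s) s)) (fun k => ?_) ?_
  · have h1 : ‖(x₀ + r k • z) - x₀‖ < ρ := by
      rw [add_sub_cancel_left, norm_smul, Real.norm_of_nonneg (hr0 k).le]
      exact hrρ k
    have h2 : ‖x₀ - x₀‖ < ρ := by simpa using hρ
    exact ((aestronglyMeasurable_superposition hT hF hFd hθ hball h1).sub
      (aestronglyMeasurable_superposition hT hF hFd hθ hball h2)).const_smul (r k)⁻¹
  · filter_upwards [ae_restrict_mem measurableSet_Ioc] with s hs
    simp only [Reg.val_add, Reg.val_smul]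
    refine tendsto_difference_quotient (G := fun y => F y s) (DifferentiableAt.hasFDerivAt ?_)
      (z.val s) hr hr0
    exact hFd _ (hball s ⟨hs.1.le, hs.2⟩ (Metric.mem_closedBall_self hρ.le)) s ⟨hs.1.le, hs.2⟩

theorem integrableOn_superposition (hT : 0 ≤ T) {m : ℝ → ℝ} (hm : IntegrableOn m (Icc 0 T))
    (hF : ∀ x ∈ Ω, AEStronglyMeasurable (F x) (volume.restrict (Icc 0 T)))
    (hFm : ∀ x ∈ Ω, ∀ t ∈ Icc 0 T, ‖F x t‖ ≤ m t)
    (hFd : ∀ x ∈ Ω, ∀ t ∈ Icc 0 T, DifferentiableAt ℝ (fun y => F y t) x)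
    (hθ : ∀ x ∈ Ω, ∀ t ∈ Icc 0 T, ‖fderiv ℝ (fun y => F y t) x‖ ≤ θ t)
    (hball : ∀ s ∈ Icc 0 T, Metric.closedBall (x₀.val s) ρ ⊆ Ω) {x : Reg n T}
    (hx : ‖x - x₀‖ < ρ) : IntegrableOn (fun s => F (x.val s) s) (Ioc 0 T) := by
  refine (hm.mono_set Ioc_subset_Icc_self).mono'
    (aestronglyMeasurable_superposition hT hF hFd hθ hball hx) ?_
  filter_upwards [ae_restrict_mem measurableSet_Ioc] with s hs
  have hs' := Ioc_subset_Icc_self hs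
  exact hFm _ (hball s hs' (Reg.val_mem_closedBall hx.le s)) s hs'

theorem integrableOn_derivative (hT : 0 ≤ T) (hρ : 0 < ρ)
    (hF : ∀ x ∈ Ω, AEStronglyMeasurable (F x) (volume.restrict (Icc 0 T)))
    (hFd : ∀ x ∈ Ω, ∀ t ∈ Icc 0 T, DifferentiableAt ℝ (fun y => F y t) x)
    (hθi : IntegrableOn θ (Icc 0 T))
    (hθ : ∀ x ∈ Ω, ∀ t ∈ Icc 0 T, ‖fderiv ℝ (fun y => F y t) x‖ ≤ θ t)
    (hball : ∀ s ∈ Icc 0 T, Metric.closedBall (x₀.val s) ρ ⊆ Ω) (z : Reg n T) :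
    IntegrableOn (fun s => fderiv ℝ (fun y => F y s) (x₀.val s) (z.val s)) (Ioc 0 T) := by
  refine ((hθi.mono_set Ioc_subset_Icc_self).mul_const ‖z‖).mono'
    (aestronglyMeasurable_derivative hT hρ hF hFd hθ hball z) ?_
  filter_upwards [ae_restrict_mem measurableSet_Ioc] with s hs
  have hs' := Ioc_subset_Icc_self hs
  have h1 := hθ _ (hball s hs' (Metric.mem_closedBall_self hρ.le)) s hs'
  refine (ContinuousLinearMap.le_of_opNorm_le _ h1 _).trans ?_
  exact mul_le_mul_of_nonneg_left (Reg.norm_val_le z s) ((norm_nonneg _).trans h1)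

theorem norm_integral_sub_le {u : ℝ → Vec n} {m : ℝ → ℝ}
    (hm : IntegrableOn m (Icc 0 T)) (hu : IntegrableOn u (Ioc 0 T))
    (hum : ∀ s ∈ Icc 0 T, ‖u s‖ ≤ m s) {c d : ℝ} (hc : 0 ≤ c) (hcd : c ≤ d) (hd : d ≤ T) :
    ‖(∫ s in (0 : ℝ)..d, u s) - ∫ s in (0 : ℝ)..c, u s‖ ≤
      (∫ s in (0 : ℝ)..d, m s) - ∫ s in (0 : ℝ)..c, m s := by
  have hi : ∀ {E : Type} [NormedAddCommGroup E] {w : ℝ → E}, IntegrableOn w (Ioc 0 T) →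
      ∀ e, 0 ≤ e → e ≤ T → IntervalIntegrable w volume 0 e := fun hw e he he' =>
    (intervalIntegrable_iff_integrableOn_Ioc_of_le he).2
      (hw.mono_set (Ioc_subset_Ioc_right he'))
  have hm' := hm.mono_set (Ioc_subset_Icc_self (a := (0 : ℝ)) (b := T))
  rw [intervalIntegral.integral_interval_sub_left (hi hu d (hc.trans hcd) hd)
      (hi hu c hc (hcd.trans hd)),
    intervalIntegral.integral_interval_sub_left (hi hm' d (hc.trans hcd) hd)
      (hi hm' c hc (hcd.trans hd))]
  refine intervalIntegral.norm_integral_le_of_norm_le hcd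
    (Eventually.of_forall fun s hs => hum s ⟨hc.trans hs.1.le, hs.2.trans hd⟩) ?_
  rw [intervalIntegrable_iff_integrableOn_Ioc_of_le hcd]
  exact hm'.mono_set (Ioc_subset_Ioc hc hd)

/-- The scaled remainder is dominated by `2 θ` and tends to zero pointwise. The integral of its norm
over all of `(0, T]` serves as a bound for every `t`. -/
theorem exists_integral_remainder (hT : 0 ≤ T) (hρ : 0 < ρ) {m : ℝ → ℝ}
    (hm : IntegrableOn m (Icc 0 T))
    (hF : ∀ x ∈ Ω, AEStronglyMeasurable (F x) (volume.restrict (Icc 0 T)))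
    (hFm : ∀ x ∈ Ω, ∀ t ∈ Icc 0 T, ‖F x t‖ ≤ m t)
    (hFd : ∀ x ∈ Ω, ∀ t ∈ Icc 0 T, DifferentiableAt ℝ (fun y => F y t) x)
    (hθi : IntegrableOn θ (Icc 0 T))
    (hθ : ∀ x ∈ Ω, ∀ t ∈ Icc 0 T, ‖fderiv ℝ (fun y => F y t) x‖ ≤ θ t)
    (hball : ∀ s ∈ Icc 0 T, Metric.closedBall (x₀.val s) ρ ⊆ Ω) {x : ℕ → Reg n T}
    (hx : ∀ k, ‖x k - x₀‖ < ρ) (hlim : Tendsto (fun k => ‖x k - x₀‖) atTop (𝓝 0)) :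
    ∃ η : ℕ → ℝ, Tendsto η atTop (𝓝 0) ∧ ∀ k, ∀ t ∈ Icc 0 T,
      ‖x k - x₀‖⁻¹ * ‖(∫ s in (0 : ℝ)..t, F ((x k).val s) s)
        - (∫ s in (0 : ℝ)..t, F (x₀.val s) s)
        - ∫ s in (0 : ℝ)..t, fderiv ℝ (fun y => F y s) (x₀.val s) ((x k - x₀).val s)‖ ≤ η k := by
  have hx₀ : ‖x₀ - x₀‖ < ρ := by simpa using hρ
  have hθ' := hθi.mono_set (Ioc_subset_Icc_self (a := (0 : ℝ)) (b := T))
  have hIcc : ∀ s ∈ Ioc 0 T, s ∈ Icc 0 T := fun s hs => Ioc_subset_Icc_self hs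
  have hsup := fun (y : Reg n T) (hy : ‖y - x₀‖ < ρ) =>
    integrableOn_superposition hT hm hF hFm hFd hθ hball hy
  have hder := integrableOn_derivative hT hρ hF hFd hθi hθ hball
  have hmem : ∀ s, x₀.val s ∈ Metric.closedBall (x₀.val s) ρ := fun s =>
    Metric.mem_closedBall_self hρ.le
  set v : ℕ → ℝ → Vec n := fun k s => ‖x k - x₀‖⁻¹ • (F ((x k).val s) s - F (x₀.val s) s -
    fderiv ℝ (fun y => F y s) (x₀.val s) ((x k - x₀).val s)) with hv
  have hvi : ∀ k, IntegrableOn (v k) (Ioc 0 T) := fun k =>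
    (((hsup _ (hx k)).sub (hsup _ hx₀)).sub (hder (x k - x₀))).smul ‖x k - x₀‖⁻¹
  refine ⟨fun k => ∫ s in Ioc 0 T, ‖v k s‖, ?_, fun k t ht => ?_⟩
  · have h1 : Tendsto (fun k => ∫ s in Ioc 0 T, ‖v k s‖) atTop
        (𝓝 (∫ _ in Ioc 0 T, (0 : ℝ))) := by
      refine tendsto_integral_of_dominated_convergence (fun s => θ s + θ s)
        (fun k => (hvi k).aestronglyMeasurable.norm) (hθ'.add hθ') (fun k => ?_) ?_
      · filter_upwards [ae_restrict_mem measurableSet_Ioc] with s hs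
        have hs' := hIcc s hs
        have h2 := hθ _ (hball s hs' (hmem s)) s hs'
        have h3 := (norm_nonneg _).trans h2
        rw [norm_norm, hv]
        dsimp only
        rw [norm_smul, norm_inv, norm_norm]
        rcases (norm_nonneg (x k - x₀)).eq_or_lt with h0 | h0
        · rw [← h0, inv_zero, zero_mul]
          exact add_nonneg h3 h3
        rw [inv_mul_le_iff₀ h0]
        refine (norm_sub_le _ _).trans ?_
        have h4 := norm_sub_le_of_fderiv_le (G := fun y => F y s) (convex_closedBall _ _)
          (fun y hy => hFd y (hball _ hs' hy) s hs') (fun y hy => hθ y (hball _ hs' hy) s hs')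
          (hmem s) (Reg.val_mem_closedBall (hx k).le s)
        have h5 := ContinuousLinearMap.le_of_opNorm_le _ h2 ((x k - x₀).val s)
        have h6 := mul_le_mul_of_nonneg_left (Reg.norm_val_le (x k - x₀) s) h3
        rw [← Reg.val_sub] at h4
        linarith
      · filter_upwards [ae_restrict_mem measurableSet_Ioc] with s hs
        have hs' := hIcc s hs
        have h1 := tendsto_remainder (G := fun y => F y s)
          (hFd _ (hball s hs' (hmem s)) s hs').hasFDerivAt (z := fun k => (x k - x₀).val s) hlim
          fun k => Reg.norm_val_le _ _
        rw [← norm_zero (E := Vec n)]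
        refine (h1.congr fun k => ?_).norm
        rw [Reg.val_sub, add_sub_cancel]
        simp only [hv, Reg.val_sub]
    simpa using h1
  · have hi : ∀ {w : ℝ → Vec n}, IntegrableOn w (Ioc 0 T) → IntervalIntegrable w volume 0 t :=
      fun hw => (intervalIntegrable_iff_integrableOn_Ioc_of_le ht.1).2
        (hw.mono_set (Ioc_subset_Ioc_right ht.2))
    rw [← intervalIntegral.integral_sub (hi (hsup _ (hx k))) (hi (hsup _ hx₀)),
      ← intervalIntegral.integral_sub ((hi (hsup _ (hx k))).sub (hi (hsup _ hx₀)))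
        (hi (hder _))]
    rw [← norm_norm (x k - x₀), ← norm_inv, ← norm_smul, ← intervalIntegral.integral_smul,
      intervalIntegral.integral_of_le ht.1]
    refine (norm_integral_le_integral_norm _).trans ?_
    exact setIntegral_mono_set (hvi k).norm (Eventually.of_forall fun s => norm_nonneg _)
      (Ioc_subset_Ioc_right ht.2).eventuallyLE

end LebesguePart

/-! ## Dependence of the operator on the parameter -/

section Parameter

variable {n : ℕ} {T : ℝ} {Ω : Set (Vec n)}

theorem clm_eq_sum {E : Type*} [NormedAddCommGroup E] [NormedSpace ℝ E] (A : Vec n →L[ℝ] E) :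
    A = ∑ j, (PiLp.proj 1 (fun _ : Fin n => ℝ) j : Vec n →L[ℝ] ℝ).smulRight
      (A (PiLp.single 1 j (1 : ℝ))) := by
  ext v
  conv_lhs => rw [vec_eq_sum v]
  simp

/-- Applied to a fixed vector, the derivative is a limit of measurable difference quotients. A
linear map depends continuously on its values on the finite basis, which gives measurability as a
map into operators. -/
theorem aestronglyMeasurable_fderiv (hΩ : IsOpen Ω) {F : Vec n → ℝ → Vec n}
    (hF : ∀ x ∈ Ω, AEStronglyMeasurable (F x) (volume.restrict (Icc 0 T)))
    (hFd : ∀ x ∈ Ω, ∀ t ∈ Icc 0 T, DifferentiableAt ℝ (fun y => F y t) x) {y : Vec n}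
    (hy : y ∈ Ω) :
    AEStronglyMeasurable (fun r => fderiv ℝ (fun y => F y r) y) (volume.restrict (Icc 0 T)) := by
  obtain ⟨ρ, hρ, hball⟩ := Metric.isOpen_iff.1 hΩ y hy
  have h1 : ∀ v : Vec n, AEStronglyMeasurable (fun r => fderiv ℝ (fun y => F y r) y v)
      (volume.restrict (Icc 0 T)) := by
    intro v
    obtain ⟨r, hr, hr0, hrρ⟩ := exists_scaling hρ ‖v‖ (norm_nonneg v)
    refine aestronglyMeasurable_of_tendsto_ae atTop
      (f := fun k s => (r k)⁻¹ • (F (y + r k • v) s - F y s)) (fun k => ?_) ?_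
    · refine ((hF _ (hball ?_)).sub (hF y hy)).const_smul (r k)⁻¹
      rw [mem_ball_iff_norm, add_sub_cancel_left, norm_smul, Real.norm_of_nonneg (hr0 k).le]
      exact hrρ k
    · filter_upwards [ae_restrict_mem measurableSet_Icc] with s hs
      exact tendsto_difference_quotient (G := fun y => F y s) (hFd y hy s hs).hasFDerivAt v hr hr0
  have h2 : (fun r => fderiv ℝ (fun y => F y r) y) = fun r => ∑ j,
      ContinuousLinearMap.smulRightL ℝ (Vec n) (Vec n) (PiLp.proj 1 (fun _ : Fin n => ℝ) j)
        (fderiv ℝ (fun y => F y r) y (PiLp.single 1 j (1 : ℝ))) :=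
    funext fun r => clm_eq_sum _
  rw [h2]
  refine Finset.aestronglyMeasurable_fun_sum _ fun j _ => ?_
  exact (ContinuousLinearMap.continuous _).comp_aestronglyMeasurable (h1 _)

/-- Differentiation under the integral sign turns `hK` into a bound for the derivative of `y ↦ ∫
F(y, r) dr`; the mean value inequality on `S` does the rest. -/
theorem norm_integral_increment_le (hΩ : IsOpen Ω) {F : Vec n → ℝ → Vec n} {m θ : ℝ → ℝ}
    (hm : IntegrableOn m (Icc 0 T)) (hθi : IntegrableOn θ (Icc 0 T))
    (hF : ∀ x ∈ Ω, AEStronglyMeasurable (F x) (volume.restrict (Icc 0 T)))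
    (hFm : ∀ x ∈ Ω, ∀ t ∈ Icc 0 T, ‖F x t‖ ≤ m t)
    (hFd : ∀ x ∈ Ω, ∀ t ∈ Icc 0 T, DifferentiableAt ℝ (fun y => F y t) x)
    (hθ : ∀ x ∈ Ω, ∀ t ∈ Icc 0 T, ‖fderiv ℝ (fun y => F y t) x‖ ≤ θ t) {c d K : ℝ}
    (hc : 0 ≤ c) (hcd : c ≤ d) (hd : d ≤ T)
    (hK : ∀ x ∈ Ω, ‖∫ r in c..d, fderiv ℝ (fun y => F y r) x‖ ≤ K) {S : Set (Vec n)}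
    (hS : Convex ℝ S) (hSΩ : S ⊆ Ω) {y y' : Vec n} (hy : y ∈ S) (hy' : y' ∈ S) :
    ‖(∫ r in c..d, F y' r) - ∫ r in c..d, F y r‖ ≤ K * ‖y' - y‖ := by
  have hI : uIoc c d ⊆ Icc 0 T := by
    rw [uIoc_of_le hcd]
    exact (Ioc_subset_Ioc hc hd).trans Ioc_subset_Icc_self
  have hle := Measure.restrict_mono_set (volume : Measure ℝ) hI
  refine hS.norm_image_sub_le_of_norm_hasFDerivWithin_le
    (f := fun y => ∫ r in c..d, F y r) (f' := fun y => ∫ r in c..d, fderiv ℝ (fun y => F y r) y)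
    (fun x hx => HasFDerivAt.hasFDerivWithinAt ?_) (fun x hx => hK x (hSΩ hx)) hy hy'
  refine intervalIntegral.hasFDerivAt_integral_of_dominated_of_fderiv_le (bound := θ)
    (F' := fun y r => fderiv ℝ (fun y => F y r) y) (hΩ.mem_nhds (hSΩ hx)) ?_ ?_ ?_ ?_ ?_ ?_
  · filter_upwards [hΩ.mem_nhds (hSΩ hx)] with z hz
    exact (hF z hz).mono_measure hle
  · rw [intervalIntegrable_iff]
    refine (hm.mono_set hI).mono' ((hF x (hSΩ hx)).mono_measure hle) ?_
    filter_upwards [ae_restrict_mem measurableSet_uIoc] with r hr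
    exact hFm x (hSΩ hx) r (hI hr)
  · exact (aestronglyMeasurable_fderiv hΩ hF hFd (hSΩ hx)).mono_measure hle
  · exact Eventually.of_forall fun r hr z hz => hθ z hz r (hI hr)
  · rw [intervalIntegrable_iff]
    exact hθi.mono_set hI
  · exact Eventually.of_forall fun r hr z hz => (hFd z hz r (hI hr)).hasFDerivAt

/-- The smallness in `hK` concerns integrals of the derivative at a fixed vector; there is no
smallness pointwise in time. So `x` and `x₀` are frozen at the midpoint of a short cell, where
`norm_integral_increment_le` applies. The main terms add up to the increment of `γ`, the freezing
errors to `κ ∫ θ` with arbitrary `κ > 0`. -/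
theorem norm_integral_superposition_sub_le (hT : 0 ≤ T) (hΩ : IsOpen Ω) {F : Vec n → ℝ → Vec n}
    {m θ γ : ℝ → ℝ} {K ρ : ℝ} {x₀ : Reg n T} (hρ : 0 < ρ)
    (hm : IntegrableOn m (Icc 0 T)) (hθi : IntegrableOn θ (Icc 0 T))
    (hF : ∀ x ∈ Ω, AEStronglyMeasurable (F x) (volume.restrict (Icc 0 T)))
    (hFm : ∀ x ∈ Ω, ∀ t ∈ Icc 0 T, ‖F x t‖ ≤ m t)
    (hFd : ∀ x ∈ Ω, ∀ t ∈ Icc 0 T, DifferentiableAt ℝ (fun y => F y t) x)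
    (hθ : ∀ x ∈ Ω, ∀ t ∈ Icc 0 T, ‖fderiv ℝ (fun y => F y t) x‖ ≤ θ t)
    (hK0 : 0 ≤ K) (hγ : MonotoneOn γ (Icc 0 T))
    (hK : ∀ x ∈ Ω, ∀ c d, 0 ≤ c → c ≤ d → d ≤ T →
      ‖∫ r in c..d, fderiv ℝ (fun y => F y r) x‖ ≤ K * (γ d - γ c))
    (hball : ∀ s ∈ Icc 0 T, Metric.closedBall (x₀.val s) ρ ⊆ Ω) {x : Reg n T}
    (hx : ‖x - x₀‖ < ρ) {t : ℝ} (ht : t ∈ Icc 0 T) :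
    ‖(∫ s in (0 : ℝ)..t, F (x.val s) s) - ∫ s in (0 : ℝ)..t, F (x₀.val s) s‖ ≤
      K * (γ T - γ 0) * ‖x - x₀‖ := by
  have hx₀ : ‖x₀ - x₀‖ < ρ := by simpa using hρ
  have hi1 := integrableOn_superposition hT hm hF hFm hFd hθ hball hx
  have hi2 := integrableOn_superposition hT hm hF hFm hFd hθ hball hx₀
  have hsub : ∀ {E : Type} [NormedAddCommGroup E] {w : ℝ → E}, IntegrableOn w (Ioc 0 T) →
      ∀ c d, 0 ≤ c → c ≤ d → d ≤ T → IntervalIntegrable w volume c d :=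
    fun hw c d hc hcd hd => (intervalIntegrable_iff_integrableOn_Ioc_of_le hcd).2
      (hw.mono_set (Ioc_subset_Ioc hc hd))
  have hθ' := hθi.mono_set (Ioc_subset_Icc_self (a := (0 : ℝ)) (b := T))
  set D : ℝ → Vec n := fun s => F (x.val s) s - F (x₀.val s) s
  have hDi : IntegrableOn D (Ioc 0 T) := hi1.sub hi2
  have key : ∀ κ > 0, ‖∫ s in (0 : ℝ)..t, D s‖ ≤
      K * (γ t - γ 0) * ‖x - x₀‖ + ∫ s in (0 : ℝ)..t, κ * θ s := by
    intro κ hκ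
    have hκθ : IntegrableOn (fun s => κ * θ s) (Ioc 0 T) := hθ'.const_mul κ
    refine cousin_induction (P := fun c d => ‖∫ s in c..d, D s‖ ≤
      K * (γ d - γ c) * ‖x - x₀‖ + ∫ s in c..d, κ * θ s) ht.1 ?_ ?_ ?_
    · intro c _
      simp
    · intro c d e hc hcd hde he h1 h2
      have heT := he.trans ht.2
      rw [← intervalIntegral.integral_add_adjacent_intervals
          (hsub hDi c d hc hcd (hde.trans heT)) (hsub hDi d e (hc.trans hcd) hde heT),
        ← intervalIntegral.integral_add_adjacent_intervals
          (hsub hκθ c d hc hcd (hde.trans heT)) (hsub hκθ d e (hc.trans hcd) hde heT)]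
      refine (norm_add_le _ _).trans ((add_le_add h1 h2).trans_eq ?_)
      ring
    · intro τ hτ
      have hτT : τ ∈ Icc 0 T := ⟨hτ.1, hτ.2.trans ht.2⟩
      -- Freezing `x` and freezing `x₀` cost `κ / 2 * θ s` each. The other entries of the minima
      -- keep the values in the ball about the midpoint value of `x₀`.
      obtain ⟨η₁, hη₁, H₁⟩ := x.exists_oscillation_lt (κ := min (κ / 2) (ρ - ‖x - x₀‖))
        (lt_min (half_pos hκ) (sub_pos.2 hx)) hτT
      obtain ⟨η₂, hη₂, H₂⟩ := x₀.exists_oscillation_lt (κ := min (κ / 2) ρ)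
        (lt_min (half_pos hκ) hρ) hτT
      refine ⟨min η₁ η₂, lt_min hη₁ hη₂, fun c d hc hcd hd htcd hcdη => ?_⟩
      have hdT := hd.trans ht.2
      have hξ : (c + d) / 2 ∈ Ioo c d := ⟨by linarith, by linarith⟩
      set ξ := (c + d) / 2
      have hξT : ξ ∈ Icc 0 T := ⟨hc.trans hξ.1.le, hξ.2.le.trans hdT⟩
      have hmx := Reg.val_mem_closedBall hx.le ξ
      have hm0 := Reg.val_mem_closedBall hx₀.le ξ
      have hxΩ := hball _ hξT hmx
      have h0Ω := hball _ hξT hm0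
      have hFi : ∀ y ∈ Ω, IntervalIntegrable (F y) volume c d := by
        intro y hy
        refine hsub (IntegrableOn.mono_set (Integrable.mono' hm (hF y hy) ?_) Ioc_subset_Icc_self)
          c d hc hcd.le hdT
        filter_upwards [ae_restrict_mem measurableSet_Icc] with r hr
        exact hFm y hy r hr
      have h1 := norm_integral_increment_le hΩ hm hθi hF hFm hFd hθ hc hcd.le hdT
        (fun y hy => hK y hy c d hc hcd.le hdT) (convex_closedBall _ _) (hball _ hξT) hm0 hmx
      rw [← intervalIntegral.integral_sub (hFi _ hxΩ) (hFi _ h0Ω)] at h1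
      have hγ0 : 0 ≤ γ d - γ c := sub_nonneg.2
        (hγ ⟨hc, hcd.le.trans hdT⟩ ⟨hc.trans hcd.le, hdT⟩ hcd.le)
      have h2 : ‖∫ s in c..d, (D s - (F (x.val ξ) s - F (x₀.val ξ) s))‖ ≤
          ∫ s in c..d, κ * θ s := by
        refine intervalIntegral.norm_integral_le_of_norm_le hcd.le ?_
          (hsub hκθ c d hc hcd.le hdT)
        filter_upwards [Measure.ae_ne volume d] with s hsd hs
        have hs' : s ∈ Ioo c d := ⟨hs.1, lt_of_le_of_ne hs.2 hsd⟩
        have hsT : s ∈ Icc 0 T := ⟨hc.trans hs'.1.le, hs'.2.le.trans hdT⟩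
        have h3 := H₁ c d hc hcd hdT htcd (hcdη.trans_le (min_le_left _ _)) s hs' ξ hξ
        have h4 := H₂ c d hc hcd hdT htcd (hcdη.trans_le (min_le_right _ _)) s hs' ξ hξ
        have hlip : ∀ z : Reg n T, z.val ξ ∈ Metric.closedBall (x₀.val ξ) ρ →
            z.val s ∈ Metric.closedBall (x₀.val ξ) ρ → ‖z.val s - z.val ξ‖ ≤ κ / 2 →
            ‖F (z.val s) s - F (z.val ξ) s‖ ≤ κ / 2 * θ s := by
          intro z hz hz' hzκ
          refine (norm_sub_le_of_fderiv_le (G := fun y => F y s) (convex_closedBall _ _)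
            (fun y hy => hFd y (hball _ hξT hy) s hsT) (fun y hy => hθ y (hball _ hξT hy) s hsT)
            hz hz').trans ?_
          rw [mul_comm]
          exact mul_le_mul_of_nonneg_right hzκ ((norm_nonneg _).trans (hθ _ (hball _ hξT hz) s hsT))
        have h5 := hlip x hmx (Reg.val_mem_closedBall_of_add_le
          (by linarith [min_le_right (κ / 2) (ρ - ‖x - x₀‖)])) (h3.le.trans (min_le_left _ _))
        have h6 := hlip x₀ hm0 (Reg.val_mem_closedBall_of_add_le
          (by simpa using h4.le.trans (min_le_right _ _))) (h4.le.trans (min_le_left _ _))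
        have h7 : D s - (F (x.val ξ) s - F (x₀.val ξ) s) =
            (F (x.val s) s - F (x.val ξ) s) - (F (x₀.val s) s - F (x₀.val ξ) s) := by
          exact sub_sub_sub_comm _ _ _ _
        rw [h7]
        refine (norm_sub_le _ _).trans ((add_le_add h5 h6).trans_eq ?_)
        ring
      rw [intervalIntegral.integral_sub (hsub hDi c d hc hcd.le hdT)
        ((hFi _ hxΩ).sub (hFi _ h0Ω))] at h2
      have h3 := norm_le_norm_add_norm_sub' (∫ s in c..d, D s)
        (∫ s in c..d, (F (x.val ξ) s - F (x₀.val ξ) s))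
      have h4 := mul_le_mul_of_nonneg_left (Reg.norm_val_sub_le x x₀ ξ) (mul_nonneg hK0 hγ0)
      linarith
  have h1 : (∫ s in (0 : ℝ)..t, F (x.val s) s) - ∫ s in (0 : ℝ)..t, F (x₀.val s) s =
      ∫ s in (0 : ℝ)..t, D s :=
    (intervalIntegral.integral_sub (hsub hi1 0 t le_rfl ht.1 ht.2)
      (hsub hi2 0 t le_rfl ht.1 ht.2)).symm
  rw [h1]
  have h2 : ‖∫ s in (0 : ℝ)..t, D s‖ ≤ K * (γ t - γ 0) * ‖x - x₀‖ := by
    have h3 : Tendsto (fun κ : ℝ => K * (γ t - γ 0) * ‖x - x₀‖ + κ * ∫ s in (0 : ℝ)..t, θ s)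
        (𝓝[>] 0) (𝓝 (K * (γ t - γ 0) * ‖x - x₀‖ + 0 * ∫ s in (0 : ℝ)..t, θ s)) :=
      ((continuous_const.add (continuous_id.mul continuous_const)).tendsto 0).mono_left
        nhdsWithin_le_nhds
    rw [zero_mul, add_zero] at h3
    refine ge_of_tendsto h3 ?_
    filter_upwards [self_mem_nhdsWithin] with κ hκ
    have := key κ hκ
    rwa [intervalIntegral.integral_const_mul] at this
  refine h2.trans ?_
  have h3 := hγ ht ⟨hT, le_rfl⟩ ht.2
  gcongr

/-- With `y = x` the Stieltjes integrand is identically zero, so only the differentials of `f`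
remain. The factor `n` comes from passing to the operator norm. -/
theorem ParamDiffCond.exists_norm_integral_le {Λ : Set ℝ} {f : ℝ → Vec n → ℝ → Vec n}
    {g : Vec n → ℝ → Vec n} {h : ℝ → ℝ} (H : ParamDiffCond T Ω Λ f g h) :
    ∃ γ : ℝ → ℝ, MonotoneOn γ (Icc 0 T) ∧ ∀ ε > 0, ∃ δ > 0, ∀ lam₁ ∈ Λ, ∀ lam₂ ∈ Λ,
      |lam₁ - lam₂| < δ → ∀ x ∈ Ω, ∀ c d, 0 ≤ c → c ≤ d → d ≤ T →
        ‖∫ r in c..d, (dfx f lam₁ x r - dfx f lam₂ x r)‖ ≤ n * ε * (γ d - γ c) := by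
  obtain ⟨γ, hγ, H⟩ := H
  refine ⟨γ, hγ, fun ε hε => ?_⟩
  obtain ⟨δ, hδ, H⟩ := H ε hε
  refine ⟨δ, hδ, fun lam₁ h₁ lam₂ h₂ hlam x hx c d hc hcd hd => ?_⟩
  have hcT : c ∈ Icc 0 T := ⟨hc, hcd.trans hd⟩
  have hdT : d ∈ Icc 0 T := ⟨hc.trans hcd, hd⟩
  have h3 := H d hdT c hcT x hx x hx lam₁ h₁ lam₂ h₂ (by simpa using hlam)
  have h4 : ksIntegral (fun r => dgx g x r - dgx g x r) h c d = 0 := by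
    have := (hasKSIntegral_const (h := h) (a := c) (b := d)
      (0 : Vec n →L[ℝ] Vec n)).ksIntegral_eq hcd
    simpa only [sub_self, smul_zero] using this
  rw [h4, add_zero, abs_of_nonneg (sub_nonneg.2 (hγ hcT hdT hcd))] at h3
  refine (opNorm_le_matNorm _).trans ?_
  rw [mul_assoc]
  exact mul_le_mul_of_nonneg_left h3 n.cast_nonneg

end Parameter

/-! ## The operator and its derivative -/

section Operator

variable {n : ℕ} {T : ℝ} {Ω : Set (Vec n)} {x₀ : Reg n T}

/-- The sum of a constant and two indefinite integrals of dominated functions is regulated. -/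
theorem isRegulated_integral_add {u v : ℝ → Vec n} {h V m m' : ℝ → ℝ} (y : Vec n)
    (hV : DominatedBy h V 0 T) (hm : IntegrableOn m (Icc 0 T)) (hm' : KSIntegrable m' V 0 T)
    (hu : IntegrableOn u (Ioc 0 T)) (hum : ∀ s ∈ Icc 0 T, ‖u s‖ ≤ m s)
    (hv : KSIntegrable v h 0 T) (hvm : ∀ s ∈ Icc 0 T, ‖v s‖ ≤ m' s) :
    IsRegulated fun t : Icc (0 : ℝ) T =>
      y + (∫ s in (0 : ℝ)..t, u s) + ksIntegral v h 0 t := by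
  refine isRegulated_of_dominated
    (M := fun t => (∫ s in (0 : ℝ)..t, m s) + ksIntegral m' V 0 t) fun c d hcd => ?_
  have hcd' : (c : ℝ) ≤ d := hcd
  have h1 := norm_integral_sub_le hm hu hum c.2.1 hcd' d.2.2
  have h2 := (hv.hasKSIntegral_sub c.2.1 hcd' d.2.2).norm_le hcd' (hV.mono c.2.1 d.2.2)
    (fun s hs => hvm s ⟨c.2.1.trans hs.1, hs.2.trans d.2.2⟩)
    (hm'.hasKSIntegral_sub c.2.1 hcd' d.2.2)
  have h3 : y + (∫ s in (0 : ℝ)..d, u s) + ksIntegral v h 0 d -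
      (y + (∫ s in (0 : ℝ)..c, u s) + ksIntegral v h 0 c) =
      ((∫ s in (0 : ℝ)..d, u s) - ∫ s in (0 : ℝ)..c, u s) +
        (ksIntegral v h 0 d - ksIntegral v h 0 c) := by abel
  rw [h3]
  refine (norm_add_le _ _).trans ((add_le_add h1 h2).trans_eq ?_)
  ring

theorem phi_val {f : ℝ → Vec n → ℝ → Vec n} {g : Vec n → ℝ → Vec n} {h : ℝ → ℝ} {lam : ℝ}
    {x : Reg n T} (H : IsRegulated (phiFun f g h lam x)) {t : ℝ} (ht : t ∈ Icc 0 T) :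
    (phi f g h lam x).val t = x.val T + (∫ s in (0 : ℝ)..t, f lam (x.val s) s) +
      ksIntegral (fun s => g (x.val s) s) h 0 t := by
  rw [phi, dif_pos H, Reg.val_mk _ ht]
  rfl

theorem isRegulated_phiFun (hT : 0 ≤ T) {ρ C : ℝ} {θ m : ℝ → ℝ} {f : ℝ → Vec n → ℝ → Vec n}
    {g : Vec n → ℝ → Vec n} {h : ℝ → ℝ} {lam : ℝ} (hb : BoundedVariationOn h (Icc 0 T))
    (hg : StieltjesCond T Ω g h)
    (hgd : ∀ x ∈ Ω, ∀ t ∈ Icc 0 T, DifferentiableAt ℝ (fun y => g y t) x) (hC0 : 0 ≤ C)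
    (hC : ∀ x ∈ Ω, ∀ t ∈ Icc 0 T, ‖dgx g x t‖ ≤ C) (hm : IntegrableOn m (Icc 0 T))
    (hF : ∀ x ∈ Ω, AEStronglyMeasurable (f lam x) (volume.restrict (Icc 0 T)))
    (hFm : ∀ x ∈ Ω, ∀ t ∈ Icc 0 T, ‖f lam x t‖ ≤ m t)
    (hFd : ∀ x ∈ Ω, ∀ t ∈ Icc 0 T, DifferentiableAt ℝ (fun y => f lam y t) x)
    (hθ : ∀ x ∈ Ω, ∀ t ∈ Icc 0 T, ‖dfx f lam x t‖ ≤ θ t)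
    (hball : ∀ s ∈ Icc 0 T, Metric.closedBall (x₀.val s) ρ ⊆ Ω) {x : Reg n T}
    (hx : ‖x - x₀‖ < ρ) : IsRegulated (phiFun f g h lam x) := by
  obtain ⟨m', -, hm', hgm⟩ := hg.bound
  have hmem : ∀ s ∈ Icc 0 T, x.val s ∈ Ω := fun s hs =>
    hball s hs (Reg.val_mem_closedBall hx.le s)
  exact isRegulated_integral_add (x.val T) (dominatedBy_varFun hb) hm hm'
    (integrableOn_superposition hT hm hF hFm hFd hθ hball hx)
    (fun s hs => hFm _ (hmem s hs) s hs)
    (ksIntegrable_superposition hT hb hg.integrable hgd hC0 hC hball hx)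
    fun s hs => hgm _ (hmem s hs) s hs

/-- The linear operator `z ↦ z(T) + ∫_0^t A(s) z(s) ds + ∫_0^t B(s) z(s) dh(s)`. -/
theorem exists_linear_operator (hT : 0 ≤ T) {h V θ : ℝ → ℝ} {C : ℝ}
    {A B : ℝ → Vec n →L[ℝ] Vec n} (hV : DominatedBy h V 0 T) (hθi : IntegrableOn θ (Icc 0 T))
    (hA : ∀ z : Reg n T, IntegrableOn (fun s => A s (z.val s)) (Ioc 0 T))
    (hAθ : ∀ s ∈ Icc 0 T, ‖A s‖ ≤ θ s)
    (hB : ∀ z : Reg n T, KSIntegrable (fun s => B s (z.val s)) h 0 T)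
    (hBC : ∀ s ∈ Icc 0 T, ‖B s‖ ≤ C) :
    ∃ L : Reg n T →L[ℝ] Reg n T, ∀ z, ∀ t ∈ Icc 0 T, (L z).val t = z.val T +
      (∫ s in (0 : ℝ)..t, A s (z.val s)) + ksIntegral (fun s => B s (z.val s)) h 0 t := by
  have hAz : ∀ z : Reg n T, ∀ s ∈ Icc 0 T, ‖A s (z.val s)‖ ≤ θ s * ‖z‖ := fun z s hs =>
    ((A s).le_of_opNorm_le (hAθ s hs) _).trans (mul_le_mul_of_nonneg_left (Reg.norm_val_le z s)
      ((norm_nonneg _).trans (hAθ s hs)))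
  have hBz : ∀ z : Reg n T, ∀ s ∈ Icc 0 T, ‖B s (z.val s)‖ ≤ C * ‖z‖ := fun z s hs =>
    ((B s).le_of_opNorm_le (hBC s hs) _).trans (mul_le_mul_of_nonneg_left (Reg.norm_val_le z s)
      ((norm_nonneg _).trans (hBC s hs)))
  have hreg := fun z : Reg n T => isRegulated_integral_add (z.val T) hV (hθi.mul_const ‖z‖)
    ⟨_, hasKSIntegral_const (C * ‖z‖)⟩ (hA z) (hAz z) (hB z) (hBz z)
  have hAi : ∀ (z : Reg n T), ∀ t ∈ Icc 0 T,
      IntervalIntegrable (fun s => A s (z.val s)) volume 0 t := fun z t ht =>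
    (intervalIntegrable_iff_integrableOn_Ioc_of_le ht.1).2
      ((hA z).mono_set (Ioc_subset_Ioc_right ht.2))
  have hBi : ∀ (z : Reg n T), ∀ t ∈ Icc 0 T, HasKSIntegral (fun s => B s (z.val s)) h 0 t
      (ksIntegral (fun s => B s (z.val s)) h 0 t) := fun z t ht =>
    ((hB z).mono le_rfl ht.1 ht.2).hasKSIntegral ht.1
  let L₀ : Reg n T →ₗ[ℝ] Reg n T :=
    { toFun := fun z => Reg.mk _ (hreg z)
      map_add' := fun z w => by
        refine Reg.ext_val fun t ht => ?_
        refine Eq.trans ?_ (Reg.val_add _ _ t).symm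
        rw [Reg.val_mk (hreg (z + w)) ht, Reg.val_mk (hreg z) ht, Reg.val_mk (hreg w) ht]
        simp only [Reg.val_add, map_add]
        rw [((hBi z t ht).add (hBi w t ht)).ksIntegral_eq ht.1,
          intervalIntegral.integral_add (hAi z t ht) (hAi w t ht)]
        abel
      map_smul' := fun c z => by
        refine Reg.ext_val fun t ht => ?_
        refine Eq.trans ?_ (Reg.val_smul c _ t).symm
        rw [Reg.val_mk (hreg (c • z)) ht, Reg.val_mk (hreg z) ht]
        simp only [Reg.val_smul, map_smul]
        rw [((hBi z t ht).smul c).ksIntegral_eq ht.1, intervalIntegral.integral_smul, smul_add,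
          smul_add] }
  have hval : ∀ z, ∀ t ∈ Icc 0 T, (L₀ z).val t = z.val T +
      (∫ s in (0 : ℝ)..t, A s (z.val s)) + ksIntegral (fun s => B s (z.val s)) h 0 t :=
    fun z t ht => Reg.val_mk (hreg z) ht
  have h0 : (0 : ℝ) ∈ Icc 0 T := ⟨le_rfl, hT⟩
  have hC0 : 0 ≤ C := (norm_nonneg _).trans (hBC 0 h0)
  have hD := hV.increment_nonneg le_rfl hT le_rfl
  have hθi' := hθi.mono_set (Ioc_subset_Icc_self (a := (0 : ℝ)) (b := T))
  have hθ0 : ∀ s ∈ Ioc 0 T, 0 ≤ θ s := fun s hs =>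
    (norm_nonneg _).trans (hAθ s (Ioc_subset_Icc_self hs))
  have hθ0' : 0 ≤ ∫ s in Ioc 0 T, θ s := setIntegral_nonneg measurableSet_Ioc hθ0
  refine ⟨L₀.mkContinuous (1 + (∫ s in Ioc 0 T, θ s) + C * (V T - V 0)) fun z => ?_, hval⟩
  refine Reg.norm_le (by positivity) fun t ht => ?_
  rw [hval z t ht]
  have h1 : ‖∫ s in (0 : ℝ)..t, A s (z.val s)‖ ≤ (∫ s in Ioc 0 T, θ s) * ‖z‖ := by
    rw [← integral_mul_const]
    refine (intervalIntegral.norm_integral_le_of_norm_le (g := fun s => θ s * ‖z‖) ht.1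
      (Eventually.of_forall fun s hs => hAz z s ⟨hs.1.le, hs.2.trans ht.2⟩) ?_).trans ?_
    · rw [intervalIntegrable_iff_integrableOn_Ioc_of_le ht.1]
      exact IntegrableOn.mono_set (hθi'.mul_const ‖z‖) (Ioc_subset_Ioc_right ht.2)
    · rw [intervalIntegral.integral_of_le ht.1]
      refine setIntegral_mono_set (hθi'.mul_const ‖z‖) ?_
        (Ioc_subset_Ioc_right ht.2).eventuallyLE
      filter_upwards [ae_restrict_mem measurableSet_Ioc] with s hs
      exact mul_nonneg (hθ0 s hs) (norm_nonneg z)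
  have h2 : ‖ksIntegral (fun s => B s (z.val s)) h 0 t‖ ≤ C * (V T - V 0) * ‖z‖ := by
    refine ((hBi z t ht).norm_le_const ht.1 (hV.mono le_rfl ht.2)
      fun s hs => hBz z s ⟨hs.1, hs.2.trans ht.2⟩).trans ?_
    have h3 := hV.increment_nonneg ht.1 ht.2 le_rfl
    have h4 : C * ‖z‖ * (V t - V 0) ≤ C * ‖z‖ * (V T - V 0) :=
      mul_le_mul_of_nonneg_left (by linarith) (mul_nonneg hC0 (norm_nonneg z))
    linarith
  refine (norm_add₃_le).trans ?_
  have h3 := Reg.norm_val_le z T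
  linarith

/-- The operator is Fréchet differentiable. -/
theorem exists_hasFDerivAt_phi (hT : 0 ≤ T) {ρ C : ℝ} {θ m : ℝ → ℝ}
    {f : ℝ → Vec n → ℝ → Vec n} {g : Vec n → ℝ → Vec n} {h : ℝ → ℝ} {lam : ℝ} (hρ : 0 < ρ)
    (hb : BoundedVariationOn h (Icc 0 T)) (hg : StieltjesCond T Ω g h)
    (hgd : ∀ x ∈ Ω, ∀ t ∈ Icc 0 T, DifferentiableAt ℝ (fun y => g y t) x) (hC0 : 0 ≤ C)
    (hC : ∀ x ∈ Ω, ∀ t ∈ Icc 0 T, ‖dgx g x t‖ ≤ C) (hm : IntegrableOn m (Icc 0 T))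
    (hF : ∀ x ∈ Ω, AEStronglyMeasurable (f lam x) (volume.restrict (Icc 0 T)))
    (hFm : ∀ x ∈ Ω, ∀ t ∈ Icc 0 T, ‖f lam x t‖ ≤ m t)
    (hFd : ∀ x ∈ Ω, ∀ t ∈ Icc 0 T, DifferentiableAt ℝ (fun y => f lam y t) x)
    (hθi : IntegrableOn θ (Icc 0 T)) (hθ : ∀ x ∈ Ω, ∀ t ∈ Icc 0 T, ‖dfx f lam x t‖ ≤ θ t)
    (hball : ∀ s ∈ Icc 0 T, Metric.closedBall (x₀.val s) ρ ⊆ Ω) :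
    ∃ L : Reg n T →L[ℝ] Reg n T, HasFDerivAt (phi f g h lam) L x₀ := by
  have hmem : ∀ s ∈ Icc 0 T, x₀.val s ∈ Ω := fun s hs =>
    hball s hs (Metric.mem_closedBall_self hρ.le)
  obtain ⟨L, hL⟩ := exists_linear_operator hT (A := fun s => dfx f lam (x₀.val s) s)
    (B := fun s => dgx g (x₀.val s) s) (dominatedBy_varFun hb) hθi
    (integrableOn_derivative hT hρ hF hFd hθi hθ hball) (fun s hs => hθ _ (hmem s hs) s hs)
    (ksIntegrable_derivative hT hb hρ hg.integrable hgd hC0 hC hball)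
    (fun s hs => hC _ (hmem s hs) s hs)
  -- Sequences suffice because neighbourhood filters in a normed space are countably generated; the
  -- convergence theorems are available only for sequences.
  refine ⟨L, hasFDerivAt_iff_tendsto.2 (tendsto_of_seq_tendsto fun x hx => ?_)⟩
  have hlim : Tendsto (fun k => ‖x k - x₀‖) atTop (𝓝 0) :=
    tendsto_iff_norm_sub_tendsto_zero.1 hx
  obtain ⟨N, hN⟩ := eventually_atTop.1 (hlim.eventually (gt_mem_nhds hρ))
  refine (tendsto_add_atTop_iff_nat N).1 ?_
  have hxN : ∀ k, ‖x (k + N) - x₀‖ < ρ := fun k => hN _ (Nat.le_add_left _ _)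
  have hlimN := hlim.comp (tendsto_add_atTop_nat N)
  obtain ⟨η₁, hη₁, H₁⟩ := exists_ksIntegral_remainder hT hb hρ hg.integrable hgd hC0 hC hball
    hxN hlimN
  obtain ⟨η₂, hη₂, H₂⟩ := exists_integral_remainder hT hρ hm hF hFm hFd hθi hθ hball hxN hlimN
  have hη := hη₁.add hη₂
  rw [add_zero] at hη
  refine squeeze_zero
    (fun k => mul_nonneg (inv_nonneg.2 (norm_nonneg _)) (norm_nonneg _)) (fun k => ?_) hη
  have h0 : (0 : ℝ) ∈ Icc 0 T := ⟨le_rfl, hT⟩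
  -- Nonnegativity, needed to pass to the sup norm, is read off from the two estimates at `t = 0`.
  have hη0 : 0 ≤ η₁ k + η₂ k := add_nonneg
    (le_trans (by positivity) (H₁ k 0 h0)) (le_trans (by positivity) (H₂ k 0 h0))
  rw [Function.comp_apply, ← norm_norm (x (k + N) - x₀), ← norm_inv, ← norm_smul]
  refine Reg.norm_le hη0 fun t ht => ?_
  have hr := fun (y : Reg n T) (hy : ‖y - x₀‖ < ρ) => isRegulated_phiFun hT hb hg hgd hC0 hC hm
    hF hFm hFd hθ hball hy
  rw [Reg.val_smul, Reg.val_sub, Reg.val_sub, phi_val (hr _ (hxN k)) ht,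
    phi_val (hr x₀ (by simpa using hρ)) ht, hL _ t ht, norm_smul, norm_inv, norm_norm]
  have h1 := H₁ k t ht
  have h2 := H₂ k t ht
  refine le_trans ?_ (add_le_add h1 h2)
  rw [← mul_add]
  refine mul_le_mul_of_nonneg_left (le_trans (le_of_eq ?_) (norm_add_le _ _)) (by positivity)
  congr 1
  rw [Reg.val_sub _ _ T]
  simp only [dfx]
  abel

end Operator

/-! ## Solutions of the differential equation -/

section Solutions

variable {n : ℕ} {T : ℝ}

/-- Integrable functions that define the same distribution coincide almost everywhere. -/
theorem ae_eq_of_pairing_eq {u v : ℝ → Vec n} (hT : 0 ≤ T) (hu : IntegrableOn u (Ioc 0 T))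
    (hv : IntegrableOn v (Ioc 0 T))
    (H : ∀ φ : ℝ → Vec n, IsTest T φ → pairing T u φ = pairing T v φ) :
    ∀ᵐ s ∂volume.restrict (Ioc 0 T), u s = v s := by
  have hproj : ∀ (i : Fin n) {w : ℝ → Vec n}, IntegrableOn w (Ioc 0 T) →
      IntegrableOn (fun s => w s i) (Ioc 0 T) := fun i w hw =>
    (PiLp.proj 1 (fun _ : Fin n => ℝ) i : Vec n →L[ℝ] ℝ).integrable_comp hw
  have h1 : ∀ i : Fin n, ∀ᵐ s, s ∈ Ioo 0 T → u s i - v s i = 0 := by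
    intro i
    have hw : IntegrableOn (fun s => u s i - v s i) (Ioc 0 T) := (hproj i hu).sub (hproj i hv)
    refine isOpen_Ioo.ae_eq_zero_of_integral_contDiff_smul_eq_zero
      (hw.mono_set Ioo_subset_Ioc_self).locallyIntegrableOn fun ψ hψ _ hsupp => ?_
    have hψ0 : ∀ t, t ∉ Ioo 0 T → ψ t = 0 := fun t ht =>
      image_eq_zero_of_notMem_tsupport fun h => ht (hsupp h)
    have htest : IsTest T fun t => ψ t • (PiLp.single 1 i (1 : ℝ) : Vec n) :=
      ⟨hψ.smul contDiff_const, fun t ht => by simp only [hψ0 t ht, zero_smul]⟩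
    have hpair : ∀ w : ℝ → Vec n, pairing T w (fun t => ψ t • (PiLp.single 1 i (1 : ℝ) : Vec n)) =
        ∫ t in Ioc 0 T, ψ t * w t i := by
      intro w
      rw [pairing, intervalIntegral.integral_of_le hT]
      refine integral_congr_ae (Eventually.of_forall fun t => ?_)
      simp [dot, mul_comm]
    have h2 := H _ htest
    rw [hpair, hpair] at h2
    obtain ⟨M, hM⟩ : ∃ M, ∀ t ∈ Ioc 0 T, ‖ψ t‖ ≤ M := by
      obtain ⟨M, hM⟩ := isCompact_Icc.exists_bound_of_continuousOn
        (hψ.continuous.continuousOn (s := Icc 0 T))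
      exact ⟨M, fun t ht => hM t (Ioc_subset_Icc_self ht)⟩
    have hi : ∀ {w : ℝ → ℝ}, IntegrableOn w (Ioc 0 T) →
        IntegrableOn (fun t => ψ t * w t) (Ioc 0 T) := fun hw =>
      Integrable.bdd_mul (c := M) hw hψ.continuous.aestronglyMeasurable
        (by filter_upwards [ae_restrict_mem measurableSet_Ioc] with t ht using hM t ht)
    have h3 : ∫ t in Ioc 0 T, ψ t • (u t i - v t i) = 0 := by
      simp only [smul_eq_mul, mul_sub]
      rw [integral_sub (hi (hproj i hu)) (hi (hproj i hv)), h2, sub_self]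
    rw [← h3, setIntegral_eq_integral_of_forall_compl_eq_zero]
    intro t ht
    rw [hψ0 t fun h => ht (Ioo_subset_Ioc_self h), zero_smul]
  rw [← restrict_Ioo_eq_restrict_Ioc]
  filter_upwards [ae_restrict_of_ae (ae_all_iff.2 h1), ae_restrict_mem measurableSet_Ioo]
    with s hs hs'
  ext i
  exact sub_eq_zero.1 (hs i hs')

/-- Neither the distribution `Dx₀` nor the product with `Dh` depends on the parameter. Subtracting
the two equations shows that the two functions `f(·, x₀(s), s)` define the same distribution, hence
have the same integrals. -/
theorem IsPeriodicSolution.phi_eq {Ω : Set (Vec n)} {f : ℝ → Vec n → ℝ → Vec n}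
    {g : Vec n → ℝ → Vec n} {h : ℝ → ℝ} {x₀ : Reg n T} {lam mu : ℝ} (hT : 0 ≤ T)
    (h1 : IsPeriodicSolution T Ω f g h x₀ lam) (h2 : IsPeriodicSolution T Ω f g h x₀ mu)
    (hi1 : IntegrableOn (fun s => f lam (x₀.val s) s) (Ioc 0 T))
    (hi2 : IntegrableOn (fun s => f mu (x₀.val s) s) (Ioc 0 T)) :
    phi f g h lam x₀ = phi f g h mu x₀ := by
  have h3 := ae_eq_of_pairing_eq hT hi1 hi2 fun φ hφ => by
    have h4 := h1.eqn φ hφ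
    have h5 := h2.eqn φ hφ
    linarith
  have h6 : phiFun f g h lam x₀ = phiFun f g h mu x₀ := by
    funext t
    unfold phiFun
    congr 2
    rw [intervalIntegral.integral_of_le t.2.1, intervalIntegral.integral_of_le t.2.1]
    exact integral_congr_ae (ae_restrict_of_ae_restrict_of_subset (Ioc_subset_Ioc_right t.2.2) h3)
  exact congrArg (fun F => @dite _ (IsRegulated F) (Classical.propDecidable _)
    (fun H => Reg.mk F H) fun _ => 0) h6

end Solutions

/-! ## Local uniqueness -/

/-- Let `e = Id - L` be invertible. Near `x₀`, a point `x` that satisfies `x = p + L (x - x₀)` up to a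
small multiple of `‖x - x₀‖` coincides with `x₀`. If `p ≠ x₀`, there is no such point near `x₀`. -/
theorem exists_forall_eq_of_approx {E : Type*} [NormedAddCommGroup E] [NormedSpace ℝ E]
    (e : E ≃L[ℝ] E) (p x₀ : E) : ∃ ε > 0, ∃ δ > 0, ∀ x, ‖x - x₀‖ < δ →
      ‖e (x - x₀) - (p - x₀)‖ ≤ ε * ‖x - x₀‖ → x = x₀ := by
  set a := ‖(e.symm : E →L[ℝ] E)‖
  set b := ‖(e : E →L[ℝ] E)‖
  have ha : 0 ≤ a := norm_nonneg _
  have hb : 0 ≤ b := norm_nonneg _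
  -- This makes `a * ε < 1`, which absorbs the error when `p = x₀`, and `ε ≤ 1`, which is used when
  -- `p ≠ x₀`.
  refine ⟨1 / (a + 1), by positivity, ?_⟩
  by_cases hp : p = x₀
  · refine ⟨1, one_pos, fun x _ hx => ?_⟩
    rw [hp, sub_self, sub_zero] at hx
    have h1 : ‖x - x₀‖ ≤ a * ‖e (x - x₀)‖ := by
      have := (e.symm : E →L[ℝ] E).le_opNorm (e (x - x₀))
      simpa using this
    by_contra hne
    have h2 : 0 < ‖x - x₀‖ := norm_pos_iff.2 (sub_ne_zero.2 hne)
    have h3 : a * ‖e (x - x₀)‖ ≤ a * (1 / (a + 1) * ‖x - x₀‖) := mul_le_mul_of_nonneg_left hx ha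
    have h4 : a * (1 / (a + 1) * ‖x - x₀‖) = a / (a + 1) * ‖x - x₀‖ := by ring
    have h5 : a / (a + 1) < 1 := by
      rw [div_lt_one (by positivity)]
      linarith
    nlinarith
  · have h0 : 0 < ‖p - x₀‖ := norm_pos_iff.2 (sub_ne_zero.2 hp)
    -- The approximate equation gives `‖p - x₀‖ ≤ (b + 1) * ‖x - x₀‖`, which fails below this
    -- radius.
    refine ⟨‖p - x₀‖ / (b + 1), by positivity, fun x hxδ hx => ?_⟩
    exfalso
    rw [lt_div_iff₀ (by positivity)] at hxδ
    have h1 : ‖e (x - x₀)‖ ≤ b * ‖x - x₀‖ := (e : E →L[ℝ] E).le_opNorm _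
    have h2 := norm_sub_le_norm_sub_add_norm_sub (p - x₀) (e (x - x₀)) 0
    rw [sub_zero, sub_zero, norm_sub_rev (p - x₀)] at h2
    have h3 : 1 / (a + 1) * ‖x - x₀‖ ≤ ‖x - x₀‖ := by
      refine mul_le_of_le_one_left (norm_nonneg _) ?_
      rw [div_le_one (by positivity)]
      linarith
    nlinarith

end MDEBif

/-! ### Exclusion of bifurcation points near `(x₀, λ₀)` -/

theorem mainTheorem4 (n : ℕ) (T : ℝ) (hT : 0 < T)
    (Ω : Set (MDEBif.Vec n)) (hΩ : IsOpen Ω) (Λ : Set ℝ) (hΛ : IsOpen Λ)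
    (f : ℝ → MDEBif.Vec n → ℝ → MDEBif.Vec n) (g : MDEBif.Vec n → ℝ → MDEBif.Vec n) (h : ℝ → ℝ)
    (hh : MDEBif.IntegratorCond T h)
    (hf : MDEBif.CaraCond T Ω Λ f)
    (hg : MDEBif.StieltjesCond T Ω g h)
    (hdf : MDEBif.DiffCondF T Ω Λ f)
    (hdg : MDEBif.DiffCondG T Ω g h)
    (x₀ : MDEBif.Reg n T)
    (hx₀ : ∀ lam ∈ Λ, MDEBif.IsPeriodicSolution T Ω f g h x₀ lam)
    (ρ : ℝ) (hρ : 0 < ρ)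
    (hball : ∀ x ∈ Metric.closedBall x₀ ρ, ∀ t ∈ Set.Icc 0 T, x.val t ∈ Ω)
    (hpar : MDEBif.ParamCond T Ω Λ f)
    (hpard : MDEBif.ParamDiffCond T Ω Λ f g h)
    (lam₀ : ℝ) (hlam₀ : lam₀ ∈ Λ)
    (hiso : ∃ e : MDEBif.Reg n T ≃L[ℝ] MDEBif.Reg n T,
      (e : MDEBif.Reg n T →L[ℝ] MDEBif.Reg n T) =
        ContinuousLinearMap.id ℝ (MDEBif.Reg n T) - fderiv ℝ (MDEBif.phi f g h lam₀) x₀) :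
    ∃ δ > 0, ∀ (x : MDEBif.Reg n T) (lam : ℝ), ‖x - x₀‖ + |lam - lam₀| < δ →
      ¬ MDEBif.IsBifurcationPoint f g h (Metric.closedBall x₀ ρ) Λ x lam := by
  open MDEBif in
  have hT0 := hT.le
  have hcl := fun s (hs : s ∈ Icc 0 T) => closedBall_subset_of_forall_reg hρ.le hball hs
  have h0 : (0 : ℝ) ∈ Icc 0 T := ⟨le_rfl, hT0⟩
  have hx₀Ω := hcl 0 h0 (Metric.mem_closedBall_self hρ.le)
  have hxx : ‖x₀ - x₀‖ < ρ := by simpa using hρ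
  obtain ⟨m, hm0, hm, hfm⟩ := hf.bound
  obtain ⟨θ, hθi, hθ⟩ := hdf.bound
  obtain ⟨C, hC⟩ := hdg.bdd
  have hC0 : 0 ≤ n * C := mul_nonneg n.cast_nonneg
    ((matNorm_nonneg _).trans (hC _ hx₀Ω 0 h0))
  have hC' : ∀ x ∈ Ω, ∀ t ∈ Icc 0 T, ‖dgx g x t‖ ≤ n * C := fun x hx t ht =>
    (opNorm_le_matNorm _).trans (mul_le_mul_of_nonneg_left (hC x hx t ht) n.cast_nonneg)
  have hθ' : ∀ lam ∈ Λ, ∀ x ∈ Ω, ∀ t ∈ Icc 0 T, ‖dfx f lam x t‖ ≤ n * θ t :=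
    fun lam hlam x hx t ht => (opNorm_le_matNorm _).trans
      (mul_le_mul_of_nonneg_left (hθ lam hlam x hx t ht) n.cast_nonneg)
  have hθi' : IntegrableOn (fun t => n * θ t) (Icc 0 T) := hθi.const_mul (n : ℝ)
  have hb := hh.bv
  have hint := fun lam (hlam : lam ∈ Λ) (x : Reg n T) (hx : ‖x - x₀‖ < ρ) =>
    integrableOn_superposition hT0 hm (hf.meas lam hlam) (hfm lam hlam) (hdf.diff lam hlam)
      (hθ' lam hlam) hcl hx
  have hreg := fun lam (hlam : lam ∈ Λ) (x : Reg n T) (hx : ‖x - x₀‖ < ρ) =>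
    isRegulated_phiFun hT0 hb hg hdg.diff hC0 hC' hm (hf.meas lam hlam) (hfm lam hlam)
      (hdf.diff lam hlam) (hθ' lam hlam) hcl hx
  have hp : ∀ lam ∈ Λ, phi f g h lam x₀ = phi f g h lam₀ x₀ := fun lam hlam =>
    (hx₀ lam hlam).phi_eq hT0 (hx₀ lam₀ hlam₀) (hint lam hlam x₀ hxx) (hint lam₀ hlam₀ x₀ hxx)
  obtain ⟨L, hL⟩ := exists_hasFDerivAt_phi hT0 hρ hb hg hdg.diff hC0 hC' hm (hf.meas lam₀ hlam₀)
    (hfm lam₀ hlam₀) (hdf.diff lam₀ hlam₀) hθi' (hθ' lam₀ hlam₀) hcl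
  obtain ⟨e, he⟩ := hiso
  -- Differentiability ensures that the `fderiv` in the hypothesis is the true derivative and not
  -- the default value `0`.
  rw [hL.fderiv] at he
  obtain ⟨ε, hε, δ₁, hδ₁, huniq⟩ := exists_forall_eq_of_approx e (phi f g h lam₀ x₀) x₀
  obtain ⟨δ₂, hδ₂, hrem⟩ := Metric.eventually_nhds_iff.1
    ((hasFDerivAt_iff_isLittleO.1 hL).def (half_pos hε))
  obtain ⟨γ, hγ, hγK⟩ := hpard.exists_norm_integral_le
  have hγ0 : 0 ≤ γ T - γ 0 := sub_nonneg.2 (hγ h0 ⟨hT0, le_rfl⟩ hT0)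
  -- The factor `n * ε' * (γ T - γ 0)` is the Lipschitz bound for the change of the operator with
  -- the parameter; it has to take at most half of `ε`.
  obtain ⟨ε', hε', hεε'⟩ : ∃ ε' > 0, n * ε' * (γ T - γ 0) ≤ ε / 2 := by
    refine ⟨ε / (2 * (n * (γ T - γ 0) + 1)), by positivity, ?_⟩
    rw [mul_div_assoc', div_mul_eq_mul_div, div_le_div_iff₀ (by positivity) two_pos]
    nlinarith
  obtain ⟨δ₃, hδ₃, hK⟩ := hγK ε' hε'
  have hlocal : ∀ (x : Reg n T) (lam : ℝ), ‖x - x₀‖ + |lam - lam₀| <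
      min (min δ₁ δ₂) (min δ₃ ρ) → lam ∈ Λ → phi f g h lam x = x → x = x₀ := by
    intro x lam hxl hlam hfix
    have h1 := norm_nonneg (x - x₀)
    have h2 := abs_nonneg (lam - lam₀)
    obtain ⟨⟨hx1, hx2⟩, hx3, hx4⟩ : (‖x - x₀‖ < δ₁ ∧ ‖x - x₀‖ < δ₂) ∧
        |lam - lam₀| < δ₃ ∧ ‖x - x₀‖ < ρ := by
      simp only [lt_min_iff] at hxl
      exact ⟨⟨by linarith [hxl.1.1], by linarith [hxl.1.2]⟩, by linarith [hxl.2.1],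
        by linarith [hxl.2.2]⟩
    refine huniq x hx1 ?_
    have hr1 := hrem (y := x) (by rwa [dist_eq_norm])
    have hr2 : ‖(phi f g h lam x - phi f g h lam₀ x) -
        (phi f g h lam x₀ - phi f g h lam₀ x₀)‖ ≤ ε / 2 * ‖x - x₀‖ := by
      refine Reg.norm_le (by positivity) fun t ht => ?_
      have hfd : ∀ y ∈ Ω, ∀ s ∈ Icc 0 T, HasFDerivAt (fun y => f lam y s - f lam₀ y s)
          (dfx f lam y s - dfx f lam₀ y s) y := fun y hy s hs =>
        (hdf.diff lam hlam y hy s hs).hasFDerivAt.sub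
          (hdf.diff lam₀ hlam₀ y hy s hs).hasFDerivAt
      have hii : ∀ {w : ℝ → Vec n}, IntegrableOn w (Ioc 0 T) →
          IntervalIntegrable w MeasureTheory.volume 0 t := fun hw =>
        (intervalIntegrable_iff_integrableOn_Ioc_of_le ht.1).2
          (hw.mono_set (Ioc_subset_Ioc_right ht.2))
      have key := norm_integral_superposition_sub_le hT0 hΩ
        (F := fun y s => f lam y s - f lam₀ y s) (m := fun s => m s + m s)
        (θ := fun s => n * θ s + n * θ s) (K := n * ε') hρ (hm.add hm) (hθi'.add hθi')
        (fun y hy => (hf.meas lam hlam y hy).sub (hf.meas lam₀ hlam₀ y hy))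
        (fun y hy s hs => (norm_sub_le _ _).trans
          (add_le_add (hfm lam hlam y hy s hs) (hfm lam₀ hlam₀ y hy s hs)))
        (fun y hy s hs => (hfd y hy s hs).differentiableAt)
        (fun y hy s hs => by
          rw [(hfd y hy s hs).fderiv]
          exact (norm_sub_le _ _).trans
            (add_le_add (hθ' lam hlam y hy s hs) (hθ' lam₀ hlam₀ y hy s hs)))
        (by positivity) hγ
        (fun y hy c d hc hcd hd => by
          refine le_trans (le_of_eq ?_) (hK lam hlam lam₀ hlam₀ hx3 y hy c d hc hcd hd)
          congr 1
          refine intervalIntegral.integral_congr fun s hs => ?_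
          rw [uIcc_of_le hcd] at hs
          exact (hfd y hy s ⟨hc.trans hs.1, hs.2.trans hd⟩).fderiv) hcl hx4 ht
      rw [intervalIntegral.integral_sub (hii (hint lam hlam x hx4)) (hii (hint lam₀ hlam₀ x hx4)),
        intervalIntegral.integral_sub (hii (hint lam hlam x₀ hxx))
          (hii (hint lam₀ hlam₀ x₀ hxx))] at key
      -- The end values `x(T)` and the Stieltjes integrals do not depend on the parameter and
      -- cancel, which leaves the Lebesgue integrals estimated in `key`.
      rw [Reg.val_sub, Reg.val_sub, Reg.val_sub, phi_val (hreg lam hlam x hx4) ht,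
        phi_val (hreg lam₀ hlam₀ x hx4) ht, phi_val (hreg lam hlam x₀ hxx) ht,
        phi_val (hreg lam₀ hlam₀ x₀ hxx) ht, add_sub_add_right_eq_sub, add_sub_add_left_eq_sub,
        add_sub_add_right_eq_sub, add_sub_add_left_eq_sub]
      exact key.trans (mul_le_mul_of_nonneg_right hεε' h1)
    rw [hfix, hp lam hlam, sub_self, sub_zero] at hr2
    have h3 : e (x - x₀) = (x - x₀) - L (x - x₀) := by
      have := congrArg (fun A : Reg n T →L[ℝ] Reg n T => A (x - x₀)) he
      simpa using this
    -- The first summand is the effect of the parameter, since `x` is the value of the operator at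
    -- `lam`; the second is the Taylor remainder at `lam₀`.
    have h4 : e (x - x₀) - (phi f g h lam₀ x₀ - x₀) = (x - phi f g h lam₀ x) +
        (phi f g h lam₀ x - phi f g h lam₀ x₀ - L (x - x₀)) := by
      rw [h3]
      abel
    rw [h4]
    refine (norm_add_le _ _).trans ((add_le_add hr2 hr1).trans_eq ?_)
    ring
  refine ⟨min (min δ₁ δ₂) (min δ₃ ρ), by positivity, fun y mu hy hbif => ?_⟩
  obtain ⟨⟨-, hmu, hfix⟩, hnear⟩ := hbif
  -- The supposed bifurcation point is itself a solution, so its first component is `x₀`. The strict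
  -- inequality `hy` persists in a neighbourhood, where all solutions have this same first
  -- component.
  obtain rfl := hlocal y mu hy hmu hfix
  have hopen : IsOpen {q : Reg n T × ℝ | ‖q.1 - y‖ + |q.2 - lam₀| <
      min (min δ₁ δ₂) (min δ₃ ρ)} := by
    refine isOpen_lt ?_ continuous_const
    fun_prop
  obtain ⟨x, lam, hU, -, hlam, hfix', hne⟩ := hnear _
    (mem_nhdsWithin_of_mem_nhds (hopen.mem_nhds hy))
  exact hne (hlocal x lam hU hlam hfix')
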